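/- Let $\Sigma$ be a compact smooth manifold without boundary of dimension $n-1$ ($n\ge 1$) with a fixed orientation, and let $M$ be a smooth $n$-manifold diffeomorphic to $\Sigma\times\mathbb R$. Let $A$ run over a finite set of fields of degrees $0\le q_A\le n$. Let $\Phi\to M$ be a phase bundle with coordinates $(y^A,p_A)$, that is, an open subset of the total space of the vector bundle $\bigoplus_A\Lambda^{q_A}T^*M\oplus\bigoplus_{A:\,q_A<n}\Lambda^{n-q_A-1}T^*M$ over $M$ with its projection to $M$. Let $\mathcal H$ be a Hamiltonian, that is, a smooth map over $M$ from $\Phi$ to $\Lambda^nT^*M$. Let $$\theta=\sum_{A:\,q_A<n}(-1)^{n-q_A}\,p_A\wedge dy^A+\mathcal H$$ be the Cartan–Poincaré $n$-form on $\Phi$, where $y^A$, $p_A$ are regarded as tautological horizontal forms on $\Phi$. A smooth section $\sigma$ of $\Phi\to M$, with component forms $y^A_\sigma$, $p_A^\sigma$ on $M$, is a solution of the covariant Hamilton equations if, at every point of $M$, along $\sigma$, $$(-1)^{n-q_A-1}dy^A_\sigma=\frac{\partial^L\mathcal H}{\partial p_A},\qquad -dp_A^\sigma=\frac{\partial^R\mathcal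 H}{\partial y^A}\quad(q_A<n),\qquad 0=\frac{\partial^R\mathcal H}{\partial y^A}\quad(q_A=n),$$ where the left and right simple derivatives are defined by $\delta\mathcal H=\delta p_A\wedge\frac{\partial^L\mathcal H}{\partial p_A}$ and $\delta\mathcal H=\frac{\partial^R\mathcal H}{\partial y^A}\wedge\delta y^A$ for vertical variations $\delta p_A$, $\delta y^A$. Let $G$ be a group of $d$-jet diffeomorphisms of $\Phi\to M$: diffeomorphisms of $\Phi$ that cover a diffeomorphism of $M$ and that, together with their inverses, map any two local sections which have at a point the same value and the same exterior derivatives of all components to local sections with the same property at the image point. Let $\mathfrak g$ be the linear span of the vector fields on $\Phi$ that generate a smooth one-parameter group of diffeomorphisms belonging to $G$. Suppose that $G$ is * a symmetry group: $(\eta^{-1})^*\theta=\theta$ for every $\eta\in G$; and * vertically transitive: for every $p\in\Phi$, each vertical tangent vector at $p$ lies in the span of $\{v|_p : v\in\mathfrak g\}$. For $v\in\mathfrak g$ let $J_v=i_v\theta$ be its Noether current. Let $\sigma$ be a smooth global section of $\Phi\to M$. Then: 1. (Differential version) If $d(\sigma^*J_v)=0$ for all $v\in\mathfrak g$, then $\sigma$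 is a solution of the covariant Hamilton equations. 2. (Integral version) Suppose moreover that $G$ is localizable (i.e. a gauge group): for every pair of smooth embeddings $\Sigma_1,\Sigma_2$ of $\Sigma$ into $M$ with disjoint images and every $v\in\mathfrak g$ there is $w\in\mathfrak g$ such that $w=v$ at all points of $\Phi$ over $\Sigma_1$ and $w=0$ at all points of $\Phi$ over $\Sigma_2$. Then $\sigma$ is a solution of the covariant Hamilton equations if and only if $$\int_{\Sigma_0}\sigma^*J_v=0$$ for all $v\in\mathfrak g$ and all smooth embeddings $\Sigma_0$ of $\Sigma$ into $M$. -/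

import Mathlib

open scoped Manifold ContDiff

namespace CovariantNoether

noncomputable section

/-! ### Wedge product of alternating forms -/

section Wedge

variable {V : Type*} [AddCommGroup V] [Module ℝ V] [TopologicalSpace V]

theorem continuous_domCoprod {k l : ℕ} (a : V [⋀^Fin k]→L[ℝ] ℝ) (b : V [⋀^Fin l]→L[ℝ] ℝ) :
    Continuous fun v : Fin k ⊕ Fin l → V => LinearMap.mul' ℝ ℝ
      (a.toAlternatingMap.domCoprod b.toAlternatingMap v) := by
  simp only [AlternatingMap.domCoprod_apply, sum_apply, map_sum]
  refine continuous_finsetSum _ fun σ _ => ?_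
  induction σ using Quotient.inductionOn' with
  | h σ =>
    rw [AlternatingMap.domCoprod.summand_mk'']
    have h : Continuous fun v : Fin k ⊕ Fin l → V =>
        a (fun i => v (σ (Sum.inl i))) * b (fun i => v (σ (Sum.inr i))) :=
      (a.cont.comp (by fun_prop)).mul (b.cont.comp (by fun_prop))
    rcases Int.units_eq_one_or (Equiv.Perm.sign σ) with hs | hs
    · simpa [hs] using h
    · have h' := h.neg
      simp only [Pi.neg_def] at h'
      simpa [hs] using h'

/-- The wedge product `a ∧ b` of a `k`-form and an `l`-form (the sum over the `(k, l)`-shuffles),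
regarded as an `n`-form where `n = k + l`. -/
def wedge {k l n : ℕ} (a : V [⋀^Fin k]→L[ℝ] ℝ) (b : V [⋀^Fin l]→L[ℝ] ℝ) (h : k + l = n) :
    V [⋀^Fin n]→L[ℝ] ℝ :=
  { ((LinearMap.mul' ℝ ℝ).compAlternatingMap
      (a.toAlternatingMap.domCoprod b.toAlternatingMap)).domDomCongr
        (finSumFinEquiv.trans (finCongr h)) with
    cont := (continuous_domCoprod a b).comp
      (continuous_pi fun i => continuous_apply ((finSumFinEquiv.trans (finCongr h)) i)) }

end Wedge

/-! ### Differential forms on manifolds without boundary -/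

section DifferentialForms

variable {E : Type*} [NormedAddCommGroup E] [NormedSpace ℝ E]
  {H : Type*} [TopologicalSpace H]
  {E' : Type*} [NormedAddCommGroup E'] [NormedSpace ℝ E']
  {H' : Type*} [TopologicalSpace H']

/-- (Not necessarily smooth) differential `k`-forms on `N`. -/
abbrev DiffForm (I : ModelWithCorners ℝ E H) (N : Type*) [TopologicalSpace N] [ChartedSpace H N]
    (k : ℕ) : Type _ :=
  (x : N) → TangentSpace I x [⋀^Fin k]→L[ℝ] ℝ

/-- Vector fields on `N`, without smoothness condition. -/
abbrev VField (I : ModelWithCorners ℝ E H) (N : Type*) [TopologicalSpace N] [ChartedSpace H N] :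
    Type _ :=
  (x : N) → TangentSpace I x

variable {I : ModelWithCorners ℝ E H} {N : Type*} [TopologicalSpace N] [ChartedSpace H N]
  {I' : ModelWithCorners ℝ E' H'} {N' : Type*} [TopologicalSpace N'] [ChartedSpace H' N']
  {k : ℕ}

/-- Pullback `f^* α`. -/
def pullback (I : ModelWithCorners ℝ E H) {I' : ModelWithCorners ℝ E' H'} (f : N → N')
    (α : DiffForm I' N' k) : DiffForm I N k :=
  fun x => (α (f x)).compContinuousLinearMap (mfderiv I I' f x)

/-- The form `α` in the preferred chart around `x₀`: the pullback of `α` along the inverse chart. -/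
def inChart [I.Boundaryless] (α : DiffForm I N k) (x₀ : N) : E → E [⋀^Fin k]→L[ℝ] ℝ :=
  fun y => (α ((extChartAt I x₀).symm y)).compContinuousLinearMap
    (mfderiv 𝓘(ℝ, E) I (extChartAt I x₀).symm y)

def IsSmoothForm [I.Boundaryless] (α : DiffForm I N k) : Prop :=
  ∀ x₀ : N, ContDiffOn ℝ ∞ (inChart α x₀) (extChartAt I x₀).target

/-- The exterior derivative `dα`; at `x` it is computed in the preferred chart around `x`. -/
def extD [I.Boundaryless] (α : DiffForm I N k) : DiffForm I N (k + 1) :=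
  fun x => (extDeriv (inChart α x) (extChartAt I x x)).compContinuousLinearMap
    (mfderiv I 𝓘(ℝ, E) (extChartAt I x) x)

/-- The interior product `i_v α = α(v, ·, …, ·)`. -/
def interior (v : VField I N) (α : DiffForm I N (k + 1)) : DiffForm I N k :=
  fun x => ContinuousAlternatingMap.curryLeft (E := E) (α x) (v x)

end DifferentialForms

/-! ### Integration of top degree forms over a compact oriented manifold -/

section Integration

variable {m : ℕ} {S : Type*} [TopologicalSpace S] [ChartedSpace (EuclideanSpace ℝ (Fin m)) S]
  [IsManifold (𝓡 m) ∞ S] [CompactSpace S] [T2Space S]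

/-- An orientation of `S`, given by a nowhere vanishing smooth top degree form. -/
structure OrientationForm (m : ℕ) (S : Type*) [TopologicalSpace S]
    [ChartedSpace (EuclideanSpace ℝ (Fin m)) S] where
  form : DiffForm (𝓡 m) S m
  smooth : IsSmoothForm form
  ne_zero : ∀ x, form x ≠ 0

variable (m S) in
/-- A smooth partition of unity `(ρ_i)` on `S` with `ρ_i` supported in the chart around `i`. -/
def chartPartition : SmoothPartitionOfUnity S (𝓡 m) S Set.univ :=
  (SmoothPartitionOfUnity.exists_isSubordinate_chartAt_source (𝓡 m) S).choose

/-- The integral `∫_S α` of an `m`-form over the compact `m`-manifold `S` oriented by `o`: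
`∑_i ∫ ρ_i α` with each summand computed in the chart around `i`, with a sign that says
whether this chart is positively oriented. Only finitely many summands are nonzero. -/
def integral (o : OrientationForm m S) (α : DiffForm (𝓡 m) S m) : ℝ :=
  ∑ᶠ i : S, ∫ y in (extChartAt (𝓡 m) i).target,
    chartPartition m S i ((extChartAt (𝓡 m) i).symm y) *
      (SignType.sign (inChart o.form i y fun j => EuclideanSpace.single j 1) : ℝ) *
      inChart α i y fun j => EuclideanSpace.single j 1

end Integration

/-! ### Bundles of forms -/

section FormBundle

variable {E : Type*} [NormedAddCommGroup E] [NormedSpace ℝ E]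

instance finiteDimensional_continuousMultilinearMap [FiniteDimensional ℝ E] (k : ℕ) :
    FiniteDimensional ℝ (ContinuousMultilinearMap ℝ (fun _ : Fin k => E) ℝ) :=
  FiniteDimensional.of_injective
    (ContinuousMultilinearMap.toMultilinearMapLinear :
      ContinuousMultilinearMap ℝ (fun _ : Fin k => E) ℝ →ₗ[ℝ]
        MultilinearMap ℝ (fun _ : Fin k => E) ℝ)
    ContinuousMultilinearMap.toMultilinearMap_injective

instance finiteDimensional_continuousAlternatingMap [FiniteDimensional ℝ E] (k : ℕ) :
    FiniteDimensional ℝ (E [⋀^Fin k]→L[ℝ] ℝ) :=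
  FiniteDimensional.of_injective
    (ContinuousAlternatingMap.toContinuousMultilinearMapLI (𝕜 := ℝ) (E := E) (F := ℝ)
      (ι := Fin k)).toLinearMap
    (ContinuousAlternatingMap.toContinuousMultilinearMapLI (𝕜 := ℝ) (E := E) (F := ℝ)
      (ι := Fin k)).injective

theorem contDiff_compContinuousLinearMapCLM [FiniteDimensional ℝ E] (k : ℕ) :
    ContDiff ℝ ∞ (fun L : E →L[ℝ] E =>
      (ContinuousAlternatingMap.compContinuousLinearMapCLM L :
        (E [⋀^Fin k]→L[ℝ] ℝ) →L[ℝ] (E [⋀^Fin k]→L[ℝ] ℝ))) := by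
  rw [contDiff_clm_apply_iff]
  intro f
  let T := (ContinuousAlternatingMap.toContinuousMultilinearMapLI (𝕜 := ℝ) (E := E) (F := ℝ)
    (ι := Fin k))
  obtain ⟨P, hP⟩ := T.toLinearMap.exists_leftInverse_of_injective
    (LinearMap.ker_eq_bot.2 T.injective)
  have h1 : ContDiff ℝ ∞ fun L : E →L[ℝ] E =>
      ContinuousMultilinearMap.compContinuousLinearMapContinuousMultilinear ℝ
        (fun _ : Fin k => E) (fun _ => E) ℝ (fun _ => L) f.toContinuousMultilinearMap :=
    (((ContinuousMultilinearMap.compContinuousLinearMapContinuousMultilinear ℝ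
      (fun _ : Fin k => E) (fun _ => E) ℝ).contDiff).comp
        (contDiff_pi.2 fun _ => contDiff_id)).clm_apply contDiff_const
  have h2 := (LinearMap.toContinuousLinearMap P).contDiff (n := ∞) |>.comp h1
  convert h2 using 1
  funext L
  exact (LinearMap.congr_fun hP (f.compContinuousLinearMap L)).symm

variable {J : Type*} [Fintype J]

/-- The typical fibre `⨁_j Λ^{r j} E^*`. -/
abbrev FormFibre (E : Type*) [NormedAddCommGroup E] [NormedSpace ℝ E] {J : Type*} (r : J → ℕ) :
    Type _ :=
  (j : J) → E [⋀^Fin (r j)]→L[ℝ] ℝ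

/-- The endomorphism of the typical fibre given by pullback along `L` in each summand. -/
def fibrePullback (r : J → ℕ) (L : E →L[ℝ] E) : FormFibre E r →L[ℝ] FormFibre E r :=
  ContinuousLinearMap.pi fun j =>
    (ContinuousAlternatingMap.compContinuousLinearMapCLM L).comp (ContinuousLinearMap.proj j)

theorem contDiff_fibrePullback [FiniteDimensional ℝ E] (r : J → ℕ) :
    ContDiff ℝ ∞ (fibrePullback (E := E) r) := by
  rw [contDiff_clm_apply_iff]
  intro f
  rw [contDiff_pi]
  intro j
  exact (contDiff_compContinuousLinearMapCLM (E := E) (r j)).clm_apply contDiff_const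

variable (E) (M : Type*) [TopologicalSpace M] [ChartedSpace E M] [IsManifold 𝓘(ℝ, E) ∞ M]
  [FiniteDimensional ℝ E]

/-- The vector bundle `⨁_j Λ^{r j} T^*M` over `M`, where `r : J → ℕ` is a finite family of degrees.
A form is carried from one chart to another by pullback along the coordinate change of `TM` in the
opposite direction, so that, exactly as for `TangentSpace`, the preferred chart at `x` identifies
the fibre over `x` with `⨁_j Λ^{r j} T_x^*M`. -/
def formBundleCore (r : J → ℕ) : VectorBundleCore ℝ M (FormFibre E r) (atlas E M) where
  baseSet i := i.1.source
  isOpen_baseSet i := i.1.open_source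
  indexAt := achart E
  mem_baseSet_at := mem_chart_source E
  coordChange i j x := fibrePullback r ((tangentBundleCore 𝓘(ℝ, E) M).coordChange j i x)
  coordChange_self i x hx f := by
    have h : (tangentBundleCore 𝓘(ℝ, E) M).coordChange i i x = ContinuousLinearMap.id ℝ E :=
      ContinuousLinearMap.ext ((tangentBundleCore 𝓘(ℝ, E) M).coordChange_self i x hx)
    rw [h]
    rfl
  continuousOn_coordChange i j := by
    refine (contDiff_fibrePullback (E := E) r).continuous.comp_continuousOn ?_
    have := (tangentBundleCore 𝓘(ℝ, E) M).continuousOn_coordChange j i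
    rwa [Set.inter_comm] at this
  coordChange_comp i j k x hx f := by
    have h : ((tangentBundleCore 𝓘(ℝ, E) M).coordChange j i x).comp
        ((tangentBundleCore 𝓘(ℝ, E) M).coordChange k j x) =
        (tangentBundleCore 𝓘(ℝ, E) M).coordChange k i x :=
      ContinuousLinearMap.ext
        ((tangentBundleCore 𝓘(ℝ, E) M).coordChange_comp k j i x ⟨⟨hx.2, hx.1.2⟩, hx.1.1⟩)
    rw [← h]
    rfl

instance formBundleCore_isContMDiff (r : J → ℕ) :
    (formBundleCore E M r).IsContMDiff 𝓘(ℝ, E) ∞ where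
  contMDiffOn_coordChange i j := by
    have : IsManifold 𝓘(ℝ, E) (∞ + 1) M := by simpa
    have h := (tangentBundleCore.isContMDiff (I := 𝓘(ℝ, E)) (M := M)
      (n := ∞)).contMDiffOn_coordChange j i
    rw [Set.inter_comm] at h
    exact (contDiff_fibrePullback (E := E) r).contMDiff.comp_contMDiffOn h

/-- The total space of `⨁_j Λ^{r j} T^*M`. -/
abbrev FormBundle (r : J → ℕ) : Type _ :=
  Bundle.TotalSpace (FormFibre E r) (formBundleCore E M r).Fiber

/-- The model with corners of the total space of `⨁_j Λ^{r j} T^*M` and of its open subsets. -/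
abbrev bundleModel (r : J → ℕ) : ModelWithCorners ℝ (E × FormFibre E r)
    (ModelProd E (FormFibre E r)) :=
  𝓘(ℝ, E).prod 𝓘(ℝ, FormFibre E r)

variable {E M}
variable {r : J → ℕ}

/-- The `j`-th component of an element of the fibre over `x`, as a form on `T_x M`. -/
def component {x : M} (f : (formBundleCore E M r).Fiber x) (j : J) :
    TangentSpace 𝓘(ℝ, E) x [⋀^Fin (r j)]→L[ℝ] ℝ :=
  (f : FormFibre E r) j

/-- The projection to `M` of an open part `Φ` of the total space. -/
def proj (Φ : TopologicalSpace.Opens (FormBundle E M r)) (z : Φ) : M :=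
  z.1.proj

/-- The `j`-th coordinate of `Φ` as a horizontal form on `Φ` (the tautological form):
at `z` it is the pullback to `T_z Φ` of the `j`-th component of `z`. -/
def tautForm (Φ : TopologicalSpace.Opens (FormBundle E M r)) (j : J) :
    DiffForm (bundleModel E r) Φ (r j) :=
  fun z => (component z.1.2 j).compContinuousLinearMap
    (mfderiv (bundleModel E r) 𝓘(ℝ, E) (proj Φ) z)

/-- `σ` restricts to a smooth section of `Φ → M` on the open set `U`
(its values outside `U` are irrelevant). -/
def IsLocalSection (Φ : TopologicalSpace.Opens (FormBundle E M r)) (σ : M → Φ) (U : Set M) :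
    Prop :=
  IsOpen U ∧ ContMDiffOn 𝓘(ℝ, E) (bundleModel E r) ∞ σ U ∧ ∀ x ∈ U, proj Φ (σ x) = x

/-- Two local sections around `x` define the same `d`-jet at `x`: they have the same value at `x`
and the exterior derivatives at `x` of their components agree. -/
def DJetEq (Φ : TopologicalSpace.Opens (FormBundle E M r)) (x : M) (σ τ : M → Φ) : Prop :=
  σ x = τ x ∧ ∀ j, extD (pullback 𝓘(ℝ, E) σ (tautForm Φ j)) x =
    extD (pullback 𝓘(ℝ, E) τ (tautForm Φ j)) x

/-- The map `g`, which covers the diffeomorphism `gM`, maps local sections with the same `d`-jet at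
a point to local sections with the same `d`-jet at the image point. -/
def PreservesDJets (Φ : TopologicalSpace.Opens (FormBundle E M r)) (g : Φ → Φ)
    (gM : Diffeomorph 𝓘(ℝ, E) 𝓘(ℝ, E) M M ∞) : Prop :=
  ∀ (x : M) (σ τ : M → Φ) (U : Set M), x ∈ U → IsLocalSection Φ σ U → IsLocalSection Φ τ U →
    DJetEq Φ x σ τ → DJetEq Φ (gM x) (g ∘ σ ∘ gM.symm) (g ∘ τ ∘ gM.symm)

/-- `d`-jet diffeomorphisms of `Φ → M`: diffeomorphisms of `Φ` that cover a diffeomorphism of `M`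
and preserve, together with their inverse, equality of `d`-jets of sections. -/
def IsDJetDiffeo (Φ : TopologicalSpace.Opens (FormBundle E M r)) (g : Equiv.Perm Φ) : Prop :=
  ContMDiff (bundleModel E r) (bundleModel E r) ∞ g ∧
  ContMDiff (bundleModel E r) (bundleModel E r) ∞ g.symm ∧
  ∃ gM : Diffeomorph 𝓘(ℝ, E) 𝓘(ℝ, E) M M ∞, (∀ z, proj Φ (g z) = gM (proj Φ z)) ∧
    PreservesDJets Φ g gM ∧ PreservesDJets Φ g.symm gM.symm

/-- `v` is the generating vector field of a flow (a smooth one-parameter group `φ` of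
diffeomorphisms of `Φ`) in `G`. -/
def IsGenerator (Φ : TopologicalSpace.Opens (FormBundle E M r)) (G : Subgroup (Equiv.Perm Φ))
    (v : VField (bundleModel E r) Φ) : Prop :=
  ContMDiff (bundleModel E r) (bundleModel E r).tangent ∞
    (fun z => (⟨z, v z⟩ : TangentBundle (bundleModel E r) Φ)) ∧
  ∃ φ : ℝ → Equiv.Perm Φ, (∀ t, φ t ∈ G) ∧ (∀ s t, φ (s + t) = φ s * φ t) ∧
    ContMDiff (𝓘(ℝ, ℝ).prod (bundleModel E r)) (bundleModel E r) ∞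
      (fun p : ℝ × Φ => φ p.1 p.2) ∧
    ∀ z, IsMIntegralCurve (I := bundleModel E r) (fun t => φ t z) v

/-- The Lie algebra of `G`: the linear span of the generating vector fields of the flows in `G`. -/
def lieAlg (Φ : TopologicalSpace.Opens (FormBundle E M r)) (G : Subgroup (Equiv.Perm Φ)) :
    Submodule ℝ (VField (bundleModel E r) Φ) :=
  Submodule.span ℝ {v | IsGenerator Φ G v}

/-- Every vertical tangent vector of `Φ` at `z` lies in the span of the values at `z` of the vector
fields in the Lie algebra of `G`. -/
def IsVerticallyTransitive (Φ : TopologicalSpace.Opens (FormBundle E M r))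
    (G : Subgroup (Equiv.Perm Φ)) : Prop :=
  ∀ (z : Φ) (u : TangentSpace (bundleModel E r) z),
    mfderiv (bundleModel E r) 𝓘(ℝ, E) (proj Φ) z u = 0 →
      u ∈ Submodule.span ℝ {w : TangentSpace (bundleModel E r) z | ∃ v ∈ lieAlg Φ G, w = v z}

variable (E M) in
/-- A horizontal `n`-form-valued function `z ↦ F z ∈ Λ^n T^*_{π z} M`. -/
abbrev HorForm (r : J → ℕ) (n : ℕ) : Type _ :=
  (z : FormBundle E M r) → TangentSpace 𝓘(ℝ, E) z.proj [⋀^Fin n]→L[ℝ] ℝ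

/-- A horizontal form-valued function, regarded as a differential form on `Φ`. -/
def horizontalForm {n : ℕ} (F : HorForm E M r n)
    (Φ : TopologicalSpace.Opens (FormBundle E M r)) : DiffForm (bundleModel E r) Φ n :=
  fun z => (F z.1).compContinuousLinearMap (mfderiv (bundleModel E r) 𝓘(ℝ, E) (proj Φ) z)

open scoped Classical in
/-- The element `f + s δ` of the typical fibre, where `δ` changes the `j`-th component only. -/
def varyFibre (f : FormFibre E r) (j : J) (δ : E [⋀^Fin (r j)]→L[ℝ] ℝ) (s : ℝ) :
    FormFibre E r :=
  f + s • (Pi.single j δ : FormFibre E r)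

/-- The variation `z + s δ` of the `j`-th component of `z`. -/
def vary (z : FormBundle E M r) (j : J)
    (δ : TangentSpace 𝓘(ℝ, E) z.proj [⋀^Fin (r j)]→L[ℝ] ℝ) (s : ℝ) : FormBundle E M r :=
  ⟨z.proj, varyFibre z.2 j δ s⟩

/-- `η` is the left simple derivative of `F` with respect to the `j`-th coordinate at `z`:
`F (z + s δ) = F z + s δ ∧ η + o(s)`. -/
def IsLeftSimpleDeriv {n l : ℕ} (F : HorForm E M r n) (z : FormBundle E M r) (j : J)
    (η : TangentSpace 𝓘(ℝ, E) z.proj [⋀^Fin l]→L[ℝ] ℝ) (h : r j + l = n) : Prop :=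
  ∀ (δ : TangentSpace 𝓘(ℝ, E) z.proj [⋀^Fin (r j)]→L[ℝ] ℝ)
    (u : Fin n → TangentSpace 𝓘(ℝ, E) z.proj),
    HasDerivAt (fun s => F (vary z j δ s) u) (wedge δ η h u) 0

/-- `η` is the right simple derivative of `F` with respect to the `j`-th coordinate at `z`:
`F (z + s δ) = F z + s η ∧ δ + o(s)`. -/
def IsRightSimpleDeriv {n l : ℕ} (F : HorForm E M r n) (z : FormBundle E M r) (j : J)
    (η : TangentSpace 𝓘(ℝ, E) z.proj [⋀^Fin l]→L[ℝ] ℝ) (h : l + r j = n) : Prop :=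
  ∀ (δ : TangentSpace 𝓘(ℝ, E) z.proj [⋀^Fin (r j)]→L[ℝ] ℝ)
    (u : Fin n → TangentSpace 𝓘(ℝ, E) z.proj),
    HasDerivAt (fun s => F (vary z j δ s) u) (wedge η δ h u) 0

end FormBundle

/-! ### Phase bundle, Cartan-Poincaré form and Hamilton equations -/

section Phase

variable {m : ℕ} {M : Type*} [TopologicalSpace M]
  [ChartedSpace (EuclideanSpace ℝ (Fin (m + 1))) M] [IsManifold (𝓡 (m + 1)) ∞ M]
  {ι : Type*} [Fintype ι]

/-- The index set of the coordinates of the phase bundle over an `(m + 1)`-dimensional spacetime: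
the fields `y^A` (`Sum.inl A`) and the momenta `p_A` (`Sum.inr A`), where a field of top degree
`q A = m + 1` has no momentum. -/
abbrev PhaseIndex (m : ℕ) (q : ι → ℕ) : Type _ := ι ⊕ {A : ι // q A ≤ m}

/-- The degrees of the coordinates: `y^A` is a `q A`-form, `p_A` an `(n - q A - 1)`-form, where
`n = m + 1`. -/
def phaseDeg (m : ℕ) (q : ι → ℕ) : PhaseIndex m q → ℕ :=
  Sum.elim q fun A => m - q A.1

/-- The total space of the bundle over `M` with fibre coordinates `(y^A, p_A)`. -/
abbrev PhaseTotal (M : Type*) [TopologicalSpace M]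
    [ChartedSpace (EuclideanSpace ℝ (Fin (m + 1))) M] [IsManifold (𝓡 (m + 1)) ∞ M] (q : ι → ℕ) :
    Type _ :=
  FormBundle (EuclideanSpace ℝ (Fin (m + 1))) M (phaseDeg m q)

/-- The model with corners of phase bundles. -/
abbrev phaseModel (m : ℕ) (q : ι → ℕ) :=
  bundleModel (EuclideanSpace ℝ (Fin (m + 1))) (phaseDeg m q)

variable {q : ι → ℕ}

/-- A Hamiltonian: a map over `M` to the bundle of `n`-forms, `n = m + 1`. Only its values on
the phase bundle `Φ` matter. -/
abbrev Hamiltonian (M : Type*) [TopologicalSpace M]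
    [ChartedSpace (EuclideanSpace ℝ (Fin (m + 1))) M] [IsManifold (𝓡 (m + 1)) ∞ M] (q : ι → ℕ) :
    Type _ :=
  HorForm (EuclideanSpace ℝ (Fin (m + 1))) M (phaseDeg m q) (m + 1)

/-- The Cartan-Poincaré form `θ = ∑_A (-1)^(n - q_A) p_A ∧ dy^A + H` on `Φ`, `n = m + 1`. -/
def cartanPoincare (Φ : TopologicalSpace.Opens (PhaseTotal (m := m) M q))
    (H : Hamiltonian (m := m) M q) : DiffForm (phaseModel m q) Φ (m + 1) :=
  fun z => ∑ A : {A : ι // q A ≤ m}, (-1 : ℝ) ^ (m + 1 - q A.1) •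
      wedge (tautForm Φ (Sum.inr A) z) (extD (tautForm Φ (Sum.inl A.1)) z)
        (by have := A.2; simp only [phaseDeg, Sum.elim_inl, Sum.elim_inr]; omega) +
    horizontalForm H Φ z

/-- The Noether current `J_v = i_v θ`. -/
def noetherCurrent (Φ : TopologicalSpace.Opens (PhaseTotal (m := m) M q))
    (H : Hamiltonian (m := m) M q) (v : VField (phaseModel m q) Φ) :
    DiffForm (phaseModel m q) Φ m :=
  interior v (cartanPoincare Φ H)

/-- `G` is a symmetry group of the system `(Φ, H)`: it consists of `d`-jet diffeomorphisms that
leave the Cartan-Poincaré form invariant. -/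
def IsSymmetryGroup (Φ : TopologicalSpace.Opens (PhaseTotal (m := m) M q))
    (H : Hamiltonian (m := m) M q) (G : Subgroup (Equiv.Perm Φ)) : Prop :=
  ∀ g ∈ G, IsDJetDiffeo Φ g ∧
    pullback (phaseModel m q) g.symm (cartanPoincare Φ H) = cartanPoincare Φ H

/-- Global smooth sections of `Φ → M`. -/
structure PhaseSection (Φ : TopologicalSpace.Opens (PhaseTotal (m := m) M q)) where
  val : (x : M) → (formBundleCore (EuclideanSpace ℝ (Fin (m + 1))) M (phaseDeg m q)).Fiber x
  mem : ∀ x, (⟨x, val x⟩ : PhaseTotal (m := m) M q) ∈ Φ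
  smooth : ContMDiff (𝓡 (m + 1)) (phaseModel m q) ∞ fun x => (⟨⟨x, val x⟩, mem x⟩ : Φ)

/-- A section as a map `M → Φ`. -/
def PhaseSection.map {Φ : TopologicalSpace.Opens (PhaseTotal (m := m) M q)}
    (σ : PhaseSection Φ) (x : M) : Φ :=
  ⟨⟨x, σ.val x⟩, σ.mem x⟩

/-- The coordinate `y^A` or `p_A` of a section, as a differential form on `M`. -/
def PhaseSection.coord {Φ : TopologicalSpace.Opens (PhaseTotal (m := m) M q)}
    (σ : PhaseSection Φ) (j : PhaseIndex m q) : DiffForm (𝓡 (m + 1)) M (phaseDeg m q j) :=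
  fun x => component (σ.val x) j

/-- The covariant Hamilton equations `(-1)^(n - q_A - 1) dy^A = ∂^L H / ∂p_A` and
`- dp_A = ∂^R H / ∂y^A` along `σ`, where `n = m + 1`; for a field of top degree `q_A = n`, which has
no momentum, only `0 = ∂^R H / ∂y^A` remains. -/
def HamiltonEquations {Φ : TopologicalSpace.Opens (PhaseTotal (m := m) M q)}
    (H : Hamiltonian (m := m) M q) (σ : PhaseSection Φ) : Prop :=
  (∀ (x : M) (A : ι) (hA : q A ≤ m),
    IsLeftSimpleDeriv H (σ.map x).1 (Sum.inr ⟨A, hA⟩)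
      ((-1 : ℝ) ^ (m - q A) • extD (σ.coord (Sum.inl A)) x)
      (by simp only [phaseDeg, Sum.elim_inl, Sum.elim_inr]; omega)) ∧
  (∀ (x : M) (A : ι) (hA : q A ≤ m),
    IsRightSimpleDeriv H (σ.map x).1 (Sum.inl A) (-extD (σ.coord (Sum.inr ⟨A, hA⟩)) x)
      (by simp only [phaseDeg, Sum.elim_inl, Sum.elim_inr]; omega)) ∧
  (∀ (x : M) (A : ι) (hA : q A = m + 1),
    IsRightSimpleDeriv H (σ.map x).1 (Sum.inl A) (0 : _ [⋀^Fin 0]→L[ℝ] ℝ)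
      (by simp only [phaseDeg, Sum.elim_inl]; omega))

/-- `G` is localizable: for disjoint embeddings `f₁`, `f₂` of `S` and every `v` in the Lie algebra
some `w` in the Lie algebra agrees with `v` over `f₁(S)` and vanishes over `f₂(S)`. -/
def IsLocalizable (S : Type*) [TopologicalSpace S] [ChartedSpace (EuclideanSpace ℝ (Fin m)) S]
    (Φ : TopologicalSpace.Opens (PhaseTotal (m := m) M q)) (G : Subgroup (Equiv.Perm Φ)) : Prop :=
  ∀ f₁ f₂ : S → M, Manifold.IsSmoothEmbedding (𝓡 m) (𝓡 (m + 1)) ∞ f₁ →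
    Manifold.IsSmoothEmbedding (𝓡 m) (𝓡 (m + 1)) ∞ f₂ →
    Disjoint (Set.range f₁) (Set.range f₂) →
    ∀ v ∈ lieAlg Φ G, ∃ w ∈ lieAlg Φ G,
      (∀ z : Φ, proj Φ z ∈ Set.range f₁ → w z = v z) ∧
      (∀ z : Φ, proj Φ z ∈ Set.range f₂ → w z = 0)

end Phase

end

end CovariantNoether

/-! Write `n = m + 1`. The argument combines two applications of Cartan's formula, both obtained
from the first variation of a pulled-back form, `d/dt (G_t^* α) = G_t^*(i dα) + d(G_t^*(i α))`,
where `i` is contraction with the velocity of `G` (`hasDerivAt_pullback_slice`).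

The first application takes `G_t = φ_t ∘ σ`, where `φ` is the flow of a generator `v` of the
symmetry group. Invariance of `θ` makes the left side vanish, so `d(σ^* J_v) = -σ^*(i_v dθ)`
(`noether_identity`); both sides are linear in `v`, so this holds on the whole Lie algebra
(`noether_identity_lieAlg`).

The second application takes `G_s = σ + s δ`, where `δ` is a fibre element that is constant in a
bundle chart. It expresses `dθ(δ, Tσ w_1, …, Tσ w_n)` as the derivative of `H` along `δ` plus the
terms `(-1)^(n - q_A) δp_A ∧ dy^A + dp_A ∧ δy^A` (`hasDerivAt_hamiltonian`). Hence the Hamilton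
equations say exactly that `dθ` vanishes on one vertical vector and `n` vectors tangent to the
section (`hamiltonEquations_iff`).

Differential version: if the currents are closed, `dθ(·, Tσ w)` kills the values of the Lie algebra
along `σ`, and vertical transitivity puts every vertical vector in their span
(`hamiltonEquations_of_closed`). Conversely, the Hamilton equations make every current closed: split
`v` along `σ` into a tangent and a vertical part; the tangent part contributes an `(n+1)`-form on an
`n`-dimensional space (`extD_noetherCurrent_eq_zero`).

Integral version, from integrals to equations: deform the slice `s = c` of the cylinder through the
graphs of `c + t φ`. By Stokes, the derivative at `t = 0` of the integral of `α` is the integral of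
`φ` times the contraction of `dα` with `∂_s`. If all these integrals vanish, the choice of `φ` as
the density of that contraction gives a vanishing integral of a square, hence `dα = 0`
(`extD_eq_zero_of_integral_eq_zero`). From equations to integrals: the currents are closed, so their
integrals do not change when a hypersurface is translated along the cylinder (`integral_translate`).
Localizability provides `w` that agrees with `v` over the hypersurface and vanishes over a distant
translate, so the charge of `v` equals that of `w`, which is zero. -/

namespace CovariantNoether

/-! ### Algebra of the wedge product -/

section WedgeAlgebra

variable {V : Type*} [AddCommGroup V] [Module ℝ V] [TopologicalSpace V]
  {W : Type*} [AddCommGroup W] [Module ℝ W] [TopologicalSpace W]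

theorem wedge_apply {k l n : ℕ} (a : V [⋀^Fin k]→L[ℝ] ℝ) (b : V [⋀^Fin l]→L[ℝ] ℝ)
    (h : k + l = n) (v : Fin n → V) :
    wedge a b h v = LinearMap.mul' ℝ ℝ (a.toAlternatingMap.domCoprod b.toAlternatingMap
      (fun i => v (finCongr h (finSumFinEquiv i)))) := rfl

omit [TopologicalSpace V] in
-- The coproduct of alternating maps sums over shuffles, that is over cosets of `S_k × S_l`;
-- alternatizing the plain product sums over all permutations and counts each coset `k! l!` times.
-- With the full sum, bilinearity and naturality can be checked term by term.
theorem mul'_domCoprod_apply {k l : ℕ} (a : V [⋀^Fin k]→ₗ[ℝ] ℝ) (b : V [⋀^Fin l]→ₗ[ℝ] ℝ)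
    (v : Fin k ⊕ Fin l → V) :
    ((k.factorial * l.factorial : ℕ) : ℝ) * LinearMap.mul' ℝ ℝ (a.domCoprod b v) =
      ∑ σ : Equiv.Perm (Fin k ⊕ Fin l), ((Equiv.Perm.sign σ : ℤ) : ℝ) *
        (a (fun i => v (σ (Sum.inl i))) * b (fun i => v (σ (Sum.inr i)))) := by
  have h := congrArg (fun F => LinearMap.mul' ℝ ℝ (F v))
    (MultilinearMap.domCoprod_alternization_eq a b)
  simp only [Fintype.card_fin, AlternatingMap.smul_apply] at h
  rw [map_nsmul, nsmul_eq_mul] at h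
  rw [← h, MultilinearMap.alternatization_apply, map_sum]
  refine Finset.sum_congr rfl fun σ _ => ?_
  rcases Int.units_eq_one_or (Equiv.Perm.sign σ) with hs | hs <;> simp [hs]

theorem wedge_apply_sum {k l n : ℕ} (a : V [⋀^Fin k]→L[ℝ] ℝ) (b : V [⋀^Fin l]→L[ℝ] ℝ)
    (h : k + l = n) (v : Fin n → V) :
    wedge a b h v = ((k.factorial * l.factorial : ℕ) : ℝ)⁻¹ *
      ∑ σ : Equiv.Perm (Fin k ⊕ Fin l), ((Equiv.Perm.sign σ : ℤ) : ℝ) *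
        (a (fun i => v (finCongr h (finSumFinEquiv (σ (Sum.inl i))))) *
          b (fun i => v (finCongr h (finSumFinEquiv (σ (Sum.inr i)))))) := by
  rw [wedge_apply, eq_inv_mul_iff_mul_eq₀ (by positivity)]
  exact mul'_domCoprod_apply a.toAlternatingMap b.toAlternatingMap _

theorem wedge_compContinuousLinearMap {k l n : ℕ} (a : V [⋀^Fin k]→L[ℝ] ℝ)
    (b : V [⋀^Fin l]→L[ℝ] ℝ) (h : k + l = n) (L : W →L[ℝ] V) :
    (wedge a b h).compContinuousLinearMap L =
      wedge (a.compContinuousLinearMap L) (b.compContinuousLinearMap L) h := by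
  ext v
  simp [wedge_apply_sum, Function.comp_def]

theorem wedge_add_left {k l n : ℕ} (a a' : V [⋀^Fin k]→L[ℝ] ℝ) (b : V [⋀^Fin l]→L[ℝ] ℝ)
    (h : k + l = n) [ContinuousAdd V] : wedge (a + a') b h = wedge a b h + wedge a' b h := by
  ext v
  simp [wedge_apply_sum, ← mul_add, ← Finset.sum_add_distrib, add_mul]

theorem wedge_add_right {k l n : ℕ} (a : V [⋀^Fin k]→L[ℝ] ℝ) (b b' : V [⋀^Fin l]→L[ℝ] ℝ)
    (h : k + l = n) : wedge a (b + b') h = wedge a b h + wedge a b' h := by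
  ext v
  simp [wedge_apply_sum, ← mul_add, ← Finset.sum_add_distrib]

theorem wedge_smul_left {k l n : ℕ} (c : ℝ) (a : V [⋀^Fin k]→L[ℝ] ℝ) (b : V [⋀^Fin l]→L[ℝ] ℝ)
    (h : k + l = n) : wedge (c • a) b h = c • wedge a b h := by
  ext v
  simp only [wedge_apply_sum, ContinuousAlternatingMap.smul_apply, smul_eq_mul, Finset.mul_sum]
  refine Finset.sum_congr rfl fun σ _ => by ring

theorem wedge_smul_right {k l n : ℕ} (c : ℝ) (a : V [⋀^Fin k]→L[ℝ] ℝ) (b : V [⋀^Fin l]→L[ℝ] ℝ)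
    (h : k + l = n) : wedge a (c • b) h = c • wedge a b h := by
  ext v
  simp only [wedge_apply_sum, ContinuousAlternatingMap.smul_apply, smul_eq_mul, Finset.mul_sum]
  refine Finset.sum_congr rfl fun σ _ => by ring

theorem wedge_zero_left {k l n : ℕ} (b : V [⋀^Fin l]→L[ℝ] ℝ) (h : k + l = n) :
    wedge (0 : V [⋀^Fin k]→L[ℝ] ℝ) b h = 0 := by
  ext v
  simp [wedge_apply_sum]

/-- The wedge product as a bilinear map. -/
def wedgeLM {k l n : ℕ} (h : k + l = n) [ContinuousAdd V] :
    (V [⋀^Fin k]→L[ℝ] ℝ) →ₗ[ℝ] (V [⋀^Fin l]→L[ℝ] ℝ) →ₗ[ℝ] (V [⋀^Fin n]→L[ℝ] ℝ) :=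
  LinearMap.mk₂ ℝ (fun a b => wedge a b h) (fun a a' b => wedge_add_left a a' b h)
    (fun c a b => wedge_smul_left c a b h) (fun a b b' => wedge_add_right a b b' h)
    (fun c a b => wedge_smul_right c a b h)

end WedgeAlgebra

/-! ### Decomposable forms; signs in wedge products, contractions and alternatizations -/

section Determinants

variable {V : Type*} [NormedAddCommGroup V] [NormedSpace ℝ V]
  {W : Type*} [NormedAddCommGroup W] [NormedSpace ℝ W]

/-- The decomposable form `ℓ₁ ∧ ⋯ ∧ ℓₖ`. -/
def detForm {k : ℕ} (ℓ : Fin k → V →L[ℝ] ℝ) : V [⋀^Fin k]→L[ℝ] ℝ :=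
  { (Matrix.detRowAlternating (R := ℝ) (n := Fin k)).compLinearMap
      (LinearMap.pi fun i => (ℓ i : V →ₗ[ℝ] ℝ)) with
    cont := by
      change Continuous fun v : Fin k → V => Matrix.det (Matrix.of fun j i => ℓ i (v j))
      refine Continuous.matrix_det ?_
      exact continuous_pi fun j => continuous_pi fun i => (ℓ i).continuous.comp (continuous_apply j)}

theorem detForm_apply {k : ℕ} (ℓ : Fin k → V →L[ℝ] ℝ) (v : Fin k → V) :
    detForm ℓ v = Matrix.det (Matrix.of fun i j => ℓ i (v j)) := by
  rw [← Matrix.det_transpose]; rfl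

theorem detForm_compContinuousLinearMap {k : ℕ} (ℓ : Fin k → V →L[ℝ] ℝ) (L : W →L[ℝ] V) :
    (detForm ℓ).compContinuousLinearMap L = detForm fun i => (ℓ i).comp L := by
  ext v; simp [detForm_apply]

theorem detForm_apply_sum {k : ℕ} (ℓ : Fin k → V →L[ℝ] ℝ) (v : Fin k → V) :
    detForm ℓ v = ∑ σ : Equiv.Perm (Fin k), ((Equiv.Perm.sign σ : ℤ) : ℝ) * ∏ i, ℓ i (v (σ i)) := by
  rw [detForm_apply, ← Matrix.det_transpose, Matrix.det_apply']
  simp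

/-- Expansion in a basis. The sum runs over all index tuples instead of the increasing ones, so each
basis form occurs `k!` times; this is the factor in the coefficients. -/
theorem eq_sum_detForm [FiniteDimensional ℝ V] {k : ℕ} (a : V [⋀^Fin k]→L[ℝ] ℝ) :
    ∃ (ι : Type) (_ : Fintype ι) (c : ι → ℝ) (ℓ : ι → Fin k → V →L[ℝ] ℝ),
      a = ∑ r, c r • detForm (ℓ r) := by
  let b := Module.finBasis ℝ V
  refine ⟨Fin k → Fin (Module.finrank ℝ V), inferInstance,
    fun r => (k.factorial : ℝ)⁻¹ * a (fun i => b (r i)),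
    fun r i => LinearMap.toContinuousLinearMap (b.coord (r i)), ?_⟩
  ext v
  have h1 : ∀ w : Fin k → V, a w = ∑ r : Fin k → Fin (Module.finrank ℝ V),
      (∏ i, b.coord (r i) (w i)) * a (fun i => b (r i)) := by
    intro w
    have : w = fun i => ∑ j, b.coord j (w i) • b j := by
      funext i; exact (b.sum_repr (w i)).symm
    conv_lhs => rw [this]
    have := a.toMultilinearMap.map_sum (fun i j => b.coord j (w i) • b j)
    refine this.trans (Finset.sum_congr rfl fun r _ => ?_)
    exact a.toMultilinearMap.map_smul_univ _ _
  -- Averaging over permutations of the arguments turns the products of coordinates into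
  -- determinants.
  have h2 : (k.factorial : ℝ) * a v =
      ∑ σ : Equiv.Perm (Fin k), ((Equiv.Perm.sign σ : ℤ) : ℝ) * a (v ∘ σ) := by
    have : ∀ σ : Equiv.Perm (Fin k), ((Equiv.Perm.sign σ : ℤ) : ℝ) * a (v ∘ σ) = a v := by
      intro σ
      have := a.toAlternatingMap.map_perm v σ
      have h3 : a (v ∘ σ) = Equiv.Perm.sign σ • a v := this
      rw [h3]
      rcases Int.units_eq_one_or (Equiv.Perm.sign σ) with hs | hs <;> simp [hs]
    simp [this, Fintype.card_perm]
  rw [ContinuousAlternatingMap.sum_apply]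
  have hk : (k.factorial : ℝ) ≠ 0 := by positivity
  rw [← mul_right_inj' hk, h2]
  simp only [ContinuousAlternatingMap.smul_apply, smul_eq_mul, detForm_apply_sum]
  rw [Finset.mul_sum]
  simp_rw [h1 (v ∘ _)]
  simp_rw [Finset.mul_sum]
  rw [Finset.sum_comm]
  refine Finset.sum_congr rfl fun r _ => Finset.sum_congr rfl fun σ _ => ?_
  simp only [Function.comp_apply, LinearMap.coe_toContinuousLinearMap']
  field_simp

/-- Reduces identities that are linear in a form to products of covectors, where they become
statements about determinants and their Laplace expansions. -/
theorem detForm_induction [FiniteDimensional ℝ V] {k : ℕ} {P : (V [⋀^Fin k]→L[ℝ] ℝ) → Prop}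
    (hadd : ∀ a b, P a → P b → P (a + b)) (hsmul : ∀ (c : ℝ) a, P a → P (c • a))
    (hdet : ∀ ℓ, P (detForm ℓ)) (a : V [⋀^Fin k]→L[ℝ] ℝ) : P a := by
  obtain ⟨ι, _, c, ℓ, rfl⟩ := eq_sum_detForm a
  have h0 : P 0 := by simpa using hsmul 0 _ (hdet 0)
  exact Finset.sum_induction _ P hadd h0 fun r _ => hsmul _ _ (hdet _)

/-- A determinant is the alternatization of a product of covectors, and the coproduct of two
alternatizations is the alternatization of the joint product. With the shuffle normalization no
factorials remain. -/
theorem wedge_detForm {k l n : ℕ} (ℓ : Fin k → V →L[ℝ] ℝ) (μ : Fin l → V →L[ℝ] ℝ)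
    (h : k + l = n) :
    wedge (detForm ℓ) (detForm μ) h =
      detForm fun i => Fin.append ℓ μ ((finCongr h).symm i) := by
  subst h
  ext v
  have hD : ∀ {k : ℕ} (ℓ : Fin k → V →L[ℝ] ℝ), (detForm ℓ).toAlternatingMap =
      MultilinearMap.alternatization ((MultilinearMap.mkPiAlgebra ℝ (Fin k) ℝ).compLinearMap
        fun i => (ℓ i : V →ₗ[ℝ] ℝ)) := by
    intro k ℓ
    ext w
    rw [MultilinearMap.alternatization_apply]
    refine (detForm_apply_sum ℓ w).trans (Finset.sum_congr rfl fun σ _ => ?_)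
    rcases Int.units_eq_one_or (Equiv.Perm.sign σ) with hs | hs <;> simp [hs]
  rw [wedge_apply, hD, hD, ← MultilinearMap.domCoprod_alternization,
    MultilinearMap.alternatization_apply, map_sum, detForm_apply_sum]
  refine Fintype.sum_equiv (finSumFinEquiv.permCongr) _ _ fun σ => ?_
  rw [Equiv.Perm.sign_permCongr]
  have : ∏ i, (Fin.append ℓ μ ((finCongr rfl).symm i)) (v (finSumFinEquiv.permCongr σ i)) =
      (∏ i, ℓ i (v (finSumFinEquiv (σ (Sum.inl i))))) *
        ∏ i, μ i (v (finSumFinEquiv (σ (Sum.inr i)))) := by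
    rw [← finSumFinEquiv.prod_comp, Fintype.prod_sum_type]
    simp [Equiv.permCongr_apply]
  rw [this]
  rcases Int.units_eq_one_or (Equiv.Perm.sign σ) with hs | hs <;> simp [hs]

/-- Laplace expansion along the row of `c`. -/
theorem alternatizeUncurryFin_smulRight_detForm {k : ℕ} (c : V →L[ℝ] ℝ) (ℓ : Fin k → V →L[ℝ] ℝ) :
    ContinuousAlternatingMap.alternatizeUncurryFin (c.smulRight (detForm ℓ)) =
      detForm (Fin.cons c ℓ : Fin (k + 1) → V →L[ℝ] ℝ) := by
  ext v
  rw [ContinuousAlternatingMap.alternatizeUncurryFin_apply, detForm_apply, Matrix.det_succ_row_zero]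
  refine Finset.sum_congr rfl fun i _ => ?_
  simp only [ContinuousLinearMap.smulRight_apply, ContinuousAlternatingMap.smul_apply,
    detForm_apply, smul_eq_mul, Matrix.of_apply, Fin.cons_zero, zsmul_eq_mul]
  push_cast
  rw [mul_assoc]
  rfl

/-- Laplace expansion along the column of `u`. -/
theorem curryLeft_detForm {k : ℕ} (ℓ : Fin (k + 1) → V →L[ℝ] ℝ) (u : V) :
    (detForm ℓ).curryLeft u =
      ∑ i : Fin (k + 1), ((-1 : ℝ) ^ (i : ℕ) * ℓ i u) • detForm fun j => ℓ (i.succAbove j) := by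
  ext v
  rw [ContinuousAlternatingMap.curryLeft_apply_apply, detForm_apply, Matrix.det_succ_column_zero,
    ContinuousAlternatingMap.sum_apply]
  refine Finset.sum_congr rfl fun i _ => ?_
  simp only [ContinuousAlternatingMap.smul_apply, detForm_apply, smul_eq_mul, Matrix.of_apply]
  rfl

/-- This is the Leibniz rule `d(α ∧ b) = dα ∧ b` for constant `b`, with `f` in the role of the
derivative of `α`. The new covector enters in front, so no sign appears. By linearity `f` may be
taken of rank one with a decomposable value, and `b` decomposable. -/
theorem alternatizeUncurryFin_wedge [FiniteDimensional ℝ V] {k l n : ℕ}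
    (f : V →L[ℝ] V [⋀^Fin k]→L[ℝ] ℝ) (b : V [⋀^Fin l]→L[ℝ] ℝ) (h : k + l = n)
    (g : V →L[ℝ] V [⋀^Fin n]→L[ℝ] ℝ) (hg : ∀ u, g u = wedge (f u) b h) :
    ContinuousAlternatingMap.alternatizeUncurryFin g =
      wedge (ContinuousAlternatingMap.alternatizeUncurryFin f) b (by omega) := by
  let T : (V [⋀^Fin k]→L[ℝ] ℝ) →L[ℝ] (V [⋀^Fin n]→L[ℝ] ℝ) :=
    LinearMap.toContinuousLinearMap ((wedgeLM h).flip b)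
  have hT : g = T.comp f := by ext1 u; exact hg u
  subst hT
  clear hg
  let B := Module.finBasis ℝ V
  -- A linear map is a sum of maps of rank one.
  have hf : f = ∑ i, (LinearMap.toContinuousLinearMap (B.coord i)).smulRight (f (B i)) := by
    ext1 u
    conv_lhs => rw [← B.sum_repr u, map_sum]
    simp
  let Q : (V →L[ℝ] V [⋀^Fin k]→L[ℝ] ℝ) → Prop := fun f =>
    ContinuousAlternatingMap.alternatizeUncurryFin (T.comp f) =
      wedge (ContinuousAlternatingMap.alternatizeUncurryFin f) b (by omega)
  change Q f
  have hadd : ∀ f f', Q f → Q f' → Q (f + f') := fun f f' h1 h2 => by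
    simp only [Q] at *
    rw [ContinuousLinearMap.comp_add, ContinuousAlternatingMap.alternatizeUncurryFin_add, h1, h2,
      ContinuousAlternatingMap.alternatizeUncurryFin_add, wedge_add_left]
  have hsmul : ∀ (c : ℝ) f, Q f → Q (c • f) := fun c f h1 => by
    simp only [Q] at *
    rw [ContinuousLinearMap.comp_smul, ContinuousAlternatingMap.alternatizeUncurryFin_smul, h1,
      ContinuousAlternatingMap.alternatizeUncurryFin_smul, wedge_smul_left]
  have h0 : Q 0 := by
    simp only [Q]
    rw [ContinuousLinearMap.comp_zero]
    have e : ∀ n, ContinuousAlternatingMap.alternatizeUncurryFin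
        (0 : V →L[ℝ] V [⋀^Fin n]→L[ℝ] ℝ) = 0 := fun n => by
      ext v; simp [ContinuousAlternatingMap.alternatizeUncurryFin_apply]
    rw [e, e, wedge_zero_left]
  rw [hf]
  refine Finset.sum_induction _ Q hadd h0 fun i _ => ?_
  generalize LinearMap.toContinuousLinearMap (B.coord i) = c
  generalize f (B i) = a
  have hcomp : T.comp (c.smulRight a) = c.smulRight (wedge a b h) := by
    ext1 u
    simp only [ContinuousLinearMap.comp_apply, ContinuousLinearMap.smulRight_apply, map_smul]
    rfl
  simp only [Q]
  rw [hcomp]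
  clear hcomp hf hadd hsmul h0
  have hsr_add : ∀ {n : ℕ} (a a' : V [⋀^Fin n]→L[ℝ] ℝ),
      c.smulRight (a + a') = c.smulRight a + c.smulRight a' := fun a a' => by
    ext1 u; simp
  have hsr_smul : ∀ {n : ℕ} (r : ℝ) (a : V [⋀^Fin n]→L[ℝ] ℝ),
      c.smulRight (r • a) = r • c.smulRight a := fun r a => by
    ext1 u; exact smul_comm (c u) r a
  induction a using detForm_induction with
  | hadd a a' h1 h2 =>
    rw [wedge_add_left, hsr_add, hsr_add, ContinuousAlternatingMap.alternatizeUncurryFin_add,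
      ContinuousAlternatingMap.alternatizeUncurryFin_add, h1, h2, wedge_add_left]
  | hsmul r a h1 =>
    rw [wedge_smul_left, hsr_smul, hsr_smul, ContinuousAlternatingMap.alternatizeUncurryFin_smul,
      ContinuousAlternatingMap.alternatizeUncurryFin_smul, h1, wedge_smul_left]
  | hdet ℓ =>
    clear T Q
    induction b using detForm_induction with
    | hadd a a' h1 h2 =>
      rw [wedge_add_right, hsr_add, ContinuousAlternatingMap.alternatizeUncurryFin_add, h1, h2,
        wedge_add_right]
    | hsmul r a h1 =>
      rw [wedge_smul_right, hsr_smul, ContinuousAlternatingMap.alternatizeUncurryFin_smul, h1,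
        wedge_smul_right]
    | hdet μ =>
      rw [wedge_detForm, alternatizeUncurryFin_smulRight_detForm,
        alternatizeUncurryFin_smulRight_detForm, wedge_detForm]
      -- Both sides are determinants of the list `c, ℓ, μ` in this order; only the casts of the
      -- index differ.
      congr 1
      subst h
      funext i
      refine Fin.cases ?_ (fun i => ?_) i
      · have : ((finCongr (show k + 1 + l = k + l + 1 by omega)).symm 0) =
            Fin.castAdd l (0 : Fin (k + 1)) := by ext; simp
        rw [this, Fin.append_left]; rfl
      · refine Fin.addCases (fun i => ?_) (fun i => ?_) i
        · have : ((finCongr (show k + 1 + l = k + l + 1 by omega)).symm (Fin.castAdd l i).succ) =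
            Fin.castAdd l i.succ := by ext; simp
          rw [this, Fin.append_left]; simp
        · have : ((finCongr (show k + 1 + l = k + l + 1 by omega)).symm (Fin.natAdd k i).succ) =
            Fin.natAdd (k + 1) i := by ext; simp; omega
          rw [this, Fin.append_right]; simp

/-- In the Laplace expansion along `u` the covectors that factor through `P` contribute nothing. The
`i`-th covector of `b` stands in position `k + i`, which produces the sign `(-1)^k`. -/
theorem curryLeft_wedge_comp [FiniteDimensional ℝ V] [FiniteDimensional ℝ W] {k l n : ℕ}
    (a : W [⋀^Fin k]→L[ℝ] ℝ) (P : V →L[ℝ] W)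
    (b : V [⋀^Fin (l + 1)]→L[ℝ] ℝ) (h : k + (l + 1) = n + 1) {u : V} (hu : P u = 0) :
    (wedge (a.compContinuousLinearMap P) b h).curryLeft u =
      (-1 : ℝ) ^ k • wedge (a.compContinuousLinearMap P) (b.curryLeft u) (by omega) := by
  have hc_add : ∀ {n : ℕ} (a a' : V [⋀^Fin (n + 1)]→L[ℝ] ℝ),
      (a + a').curryLeft u = a.curryLeft u + a'.curryLeft u := fun a a' => by ext1 w; rfl
  have hc_smul : ∀ {n : ℕ} (r : ℝ) (a : V [⋀^Fin (n + 1)]→L[ℝ] ℝ),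
      (r • a).curryLeft u = r • a.curryLeft u := fun r a => by ext1 w; rfl
  have hp_add : ∀ {n : ℕ} (a a' : W [⋀^Fin n]→L[ℝ] ℝ), (a + a').compContinuousLinearMap P =
    a.compContinuousLinearMap P + a'.compContinuousLinearMap P := fun a a' => by ext1 w; rfl
  have hp_smul : ∀ {n : ℕ} (r : ℝ) (a : W [⋀^Fin n]→L[ℝ] ℝ), (r • a).compContinuousLinearMap P =
    r • a.compContinuousLinearMap P := fun r a => by ext1 w; rfl
  induction a using detForm_induction with
  | hadd a a' h1 h2 => rw [hp_add, wedge_add_left, hc_add, h1, h2, wedge_add_left, smul_add]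
  | hsmul r a h1 =>
    rw [hp_smul, wedge_smul_left, hc_smul, h1, wedge_smul_left, smul_comm]
  | hdet ℓ =>
    rw [detForm_compContinuousLinearMap]
    induction b using detForm_induction with
    | hadd a a' h1 h2 => rw [wedge_add_right, hc_add, hc_add, h1, h2, wedge_add_right, smul_add]
    | hsmul r a h1 => rw [wedge_smul_right, hc_smul, hc_smul, h1, wedge_smul_right, smul_comm]
    | hdet μ =>
      obtain rfl : n = k + l := by omega
      rw [wedge_detForm, curryLeft_detForm, curryLeft_detForm]
      have hsum : ∀ c : Fin (l + 1) → V [⋀^Fin l]→L[ℝ] ℝ, ∀ h,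
          wedge (detForm fun i => (ℓ i).comp P) (∑ i, c i) h =
          ∑ i, wedge (n := k + l) (detForm fun i => (ℓ i).comp P) (c i) h := fun c h =>
        map_sum (wedgeLM h (detForm fun i => (ℓ i).comp P)) c Finset.univ
      rw [hsum, Finset.smul_sum]
      have hs : ∀ F : Fin (k + l + 1) → V [⋀^Fin (k + l)]→L[ℝ] ℝ, ∑ i, F i =
        ∑ i : Fin k, F ((finCongr h) (Fin.castAdd (l + 1) i)) +
          ∑ i : Fin (l + 1), F ((finCongr h) (Fin.natAdd k i)) := fun F => by
        rw [← (finCongr h).sum_comp, Fin.sum_univ_add]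
      rw [hs, Finset.sum_eq_zero, zero_add]
      · refine Finset.sum_congr rfl fun i _ => ?_
        rw [wedge_smul_right, smul_smul, wedge_detForm]
        congr 1
        · rw [Equiv.symm_apply_apply, Fin.append_right]
          simp [pow_add, mul_assoc]
        · congr 1
          funext j
          refine Fin.addCases (fun j => ?_) (fun j => ?_) j
          · have : (finCongr h).symm (((finCongr h) (Fin.natAdd k i)).succAbove
                (Fin.castAdd l j)) = Fin.castAdd (l + 1) j := by
              rw [Equiv.symm_apply_eq, Fin.succAbove_of_castSucc_lt]
              · ext; simp
              · rw [Fin.lt_def]; simp; omega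
            rw [this]
            simp
          · have : (finCongr h).symm (((finCongr h) (Fin.natAdd k i)).succAbove
                (Fin.natAdd k j)) = Fin.natAdd k (i.succAbove j) := by
              rw [Equiv.symm_apply_eq]
              simp only [Fin.succAbove, Fin.lt_def]
              split_ifs <;> simp_all [Fin.ext_iff] <;> omega
            rw [this]
            simp
      · intro i _
        rw [Equiv.symm_apply_apply, Fin.append_left]
        simp [hu]

end Determinants

/-! ### Cartan's formula for `∂_t` on `ℝ × X` -/

section Calculus

variable {X : Type*} [NormedAddCommGroup X] [NormedSpace ℝ X]
  {E : Type*} [NormedAddCommGroup E] [NormedSpace ℝ E]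
  {F : Type*} [NormedAddCommGroup F] [NormedSpace ℝ F]

/-- Precomposition is smooth on multilinear maps; a linear left inverse of the inclusion of
alternating maps, continuous in finite dimension, transfers this to forms. -/
theorem contDiffAt_compContinuousLinearMap [FiniteDimensional ℝ E] {n : ℕ∞ω} {k : ℕ}
    {α : X → F [⋀^Fin k]→L[ℝ] ℝ} {L : X → E →L[ℝ] F} {x : X} (hα : ContDiffAt ℝ n α x)
    (hL : ContDiffAt ℝ n L x) :
    ContDiffAt ℝ n (fun x => (α x).compContinuousLinearMap (L x)) x := by
  let T := (ContinuousAlternatingMap.toContinuousMultilinearMapLI (𝕜 := ℝ) (E := E) (F := ℝ)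
    (ι := Fin k))
  let T' := (ContinuousAlternatingMap.toContinuousMultilinearMapLI (𝕜 := ℝ) (E := F) (F := ℝ)
    (ι := Fin k))
  obtain ⟨P, hP⟩ := T.toLinearMap.exists_leftInverse_of_injective
    (LinearMap.ker_eq_bot.2 T.injective)
  have hC : ContDiff ℝ n fun L : E →L[ℝ] F =>
      ContinuousMultilinearMap.compContinuousLinearMapContinuousMultilinear ℝ
        (fun _ : Fin k => E) (fun _ => F) ℝ (fun _ => L) := by
    have h : ContDiff ℝ n ⇑(ContinuousMultilinearMap.compContinuousLinearMapContinuousMultilinear ℝ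
      (fun _ : Fin k => E) (fun _ => F) ℝ) := ContinuousMultilinearMap.contDiff _
    exact h.comp (contDiff_pi.2 fun _ => contDiff_id)
  have h1 : ContDiffAt ℝ n (fun x =>
      ContinuousMultilinearMap.compContinuousLinearMapContinuousMultilinear ℝ
        (fun _ : Fin k => E) (fun _ => F) ℝ (fun _ => L x) (T' (α x))) x :=
    (hC.contDiffAt.comp x hL).clm_apply
      (T'.toContinuousLinearMap.contDiff.contDiffAt.comp x hα)
  have h2 := (LinearMap.toContinuousLinearMap P).contDiff (n := n) |>.contDiffAt.comp x h1
  convert h2 using 1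
  funext x
  exact (LinearMap.congr_fun hP ((α x).compContinuousLinearMap (L x))).symm

/-- Cartan's formula `L_{∂_t} β = i dβ + d(i β)`, evaluated on vectors tangent to the slice. All
later variational formulas descend from this one. -/
theorem hasDerivAt_slice {k : ℕ} {β : ℝ × X → (ℝ × X) [⋀^Fin (k + 1)]→L[ℝ] ℝ} {t : ℝ} {w : X}
    (hβ : DifferentiableAt ℝ β (t, w)) (v : Fin (k + 1) → X) :
    HasDerivAt (fun s => β (s, w) fun i => (0, v i))
      (extDeriv β (t, w) (Matrix.vecCons (1, 0) fun i => (0, v i)) +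
        extDeriv (fun w' => ((β (t, w')).curryLeft (1, 0)).compContinuousLinearMap
          (ContinuousLinearMap.inr ℝ ℝ X)) w v) t := by
  have hi : HasFDerivAt (fun w' : X => (t, w')) (ContinuousLinearMap.inr ℝ ℝ X) w :=
    hasFDerivAt_prodMk_right t w
  have hs : DifferentiableAt ℝ (fun w' => ((β (t, w')).curryLeft (1, 0)).compContinuousLinearMap
      (ContinuousLinearMap.inr ℝ ℝ X)) w := by
    have h1 : DifferentiableAt ℝ (fun w' => β (t, w')) w := hβ.comp w hi.differentiableAt
    have h2 : DifferentiableAt ℝ (fun w' => (β (t, w')).curryLeft) w := by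
      have hc := (ContinuousAlternatingMap.curryLeftLI (𝕜 := ℝ) (E := ℝ × X)
        (F := ℝ) (n := k)).toContinuousLinearMap.hasFDerivAt (x := β (t, w))
      exact (HasFDerivAt.comp (F := (ℝ × X) [⋀^Fin (k + 1)]→L[ℝ] ℝ)
        (G := ℝ × X →L[ℝ] (ℝ × X) [⋀^Fin k]→L[ℝ] ℝ) w hc h1.hasFDerivAt).differentiableAt
    have h2 : DifferentiableAt ℝ (fun w' => (β (t, w')).curryLeft (1, 0)) w :=
      h2.clm_apply (differentiableAt_const _)
    exact (ContinuousAlternatingMap.compContinuousLinearMapCLM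
      (ContinuousLinearMap.inr ℝ ℝ X)).differentiableAt.comp w h2
  have hd : ∀ u : Fin (k + 1) → ℝ × X, HasFDerivAt (fun p => β p u)
      ((ContinuousAlternatingMap.apply ℝ (ℝ × X) ℝ u).comp (fderiv ℝ β (t, w))) (t, w) := fun u =>
    (ContinuousAlternatingMap.apply ℝ (ℝ × X) ℝ u).hasFDerivAt.comp _ hβ.hasFDerivAt
  have ht : HasDerivAt (fun s => β (s, w) fun i => (0, v i))
      (fderiv ℝ β (t, w) (1, 0) fun i => (0, v i)) t := by
    have hj : HasDerivAt (fun s : ℝ => (s, w)) ((1 : ℝ), (0 : X)) t :=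
      (hasDerivAt_id t).prodMk (hasDerivAt_const t w)
    exact (hd _).comp_hasDerivAt t hj
  convert ht using 1
  -- Term `0` of `dβ` is the derivative in `t`. Term `i + 1` cancels term `i` of `d(i β)`, because
  -- `∂_t` occupies position `0` and shifts the sign by one.
  rw [extDeriv_apply hβ, extDeriv_apply hs, Fin.sum_univ_succ, add_assoc, add_eq_left.2 ?_]
  · simp only [Fin.val_zero, pow_zero, one_smul, Matrix.cons_val_zero]
    rw [(hd _).fderiv]
    rfl
  · rw [← Finset.sum_add_distrib]
    refine Finset.sum_eq_zero fun i _ => ?_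
    rw [(hd _).fderiv]
    have e : (fun w' => (((β (t, w')).curryLeft (1, 0)).compContinuousLinearMap
        (ContinuousLinearMap.inr ℝ ℝ X)) (i.removeNth v)) =
        (fun p => β p (i.succ.removeNth
          (Matrix.vecCons ((1 : ℝ), (0 : X)) fun i => (0, v i)))) ∘ fun w' => (t, w') := by
      funext w'
      simp only [ContinuousAlternatingMap.compContinuousLinearMap_apply, Function.comp_apply,
        ContinuousAlternatingMap.curryLeft_apply_apply]
      congr 1
      funext j
      refine Fin.cases ?_ (fun j => ?_) j <;> simp [Fin.removeNth]
    rw [e, ((hd _).comp w hi).fderiv]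
    simp [pow_succ]

/-- A function has no contraction, so in degree `0` Cartan's formula consists of its first term
only. -/
theorem hasDerivAt_slice_zero {β : ℝ × X → (ℝ × X) [⋀^Fin 0]→L[ℝ] ℝ} {t : ℝ} {w : X}
    (hβ : DifferentiableAt ℝ β (t, w)) (v : Fin 0 → X) :
    HasDerivAt (fun s => β (s, w) fun i => (0, v i))
      (extDeriv β (t, w) (Matrix.vecCons (1, 0) fun i => (0, v i))) t := by
  have hd : ∀ u : Fin 0 → ℝ × X, HasFDerivAt (fun p => β p u)
      ((ContinuousAlternatingMap.apply ℝ (ℝ × X) ℝ u).comp (fderiv ℝ β (t, w))) (t, w) := fun u =>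
    (ContinuousAlternatingMap.apply ℝ (ℝ × X) ℝ u).hasFDerivAt.comp _ hβ.hasFDerivAt
  have hj : HasDerivAt (fun s : ℝ => (s, w)) ((1 : ℝ), (0 : X)) t :=
    (hasDerivAt_id t).prodMk (hasDerivAt_const t w)
  have ht : HasDerivAt (fun s => β (s, w) fun i => (0, v i))
      (fderiv ℝ β (t, w) (1, 0) fun i => (0, v i)) t := by
    exact (hd _).comp_hasDerivAt t hj
  refine ht.congr_deriv ?_
  rw [extDeriv_apply hβ, Fin.sum_univ_succ]
  simp only [Fin.val_zero, pow_zero, one_smul, Matrix.cons_val_zero]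
  rw [(hd _).fderiv]
  simp only [Finset.univ_eq_empty, Finset.sum_empty, add_zero]
  change _ = fderiv ℝ β (t, w) (1, 0) _
  congr 1

end Calculus

/-! ### Pullback and exterior derivative in charts -/

section Naturality

variable {X : Type*} [NormedAddCommGroup X] [NormedSpace ℝ X]
  {E : Type*} [NormedAddCommGroup E] [NormedSpace ℝ E]
  {H : Type*} [TopologicalSpace H] {I : ModelWithCorners ℝ E H}
  {N : Type*} [TopologicalSpace N] [ChartedSpace H N]
  {E' : Type*} [NormedAddCommGroup E'] [NormedSpace ℝ E']
  {H' : Type*} [TopologicalSpace H'] {I' : ModelWithCorners ℝ E' H'}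
  {N' : Type*} [TopologicalSpace N'] [ChartedSpace H' N']
  {E'' : Type*} [NormedAddCommGroup E''] [NormedSpace ℝ E'']
  {H'' : Type*} [TopologicalSpace H''] {I'' : ModelWithCorners ℝ E'' H''}
  {N'' : Type*} [TopologicalSpace N''] [ChartedSpace H'' N'']
  {k : ℕ}

theorem pullback_pullback_apply {f : N → N'} {g : N' → N''} (α : DiffForm I'' N'' k) {x : N}
    (hg : MDifferentiableAt I' I'' g (f x)) (hf : MDifferentiableAt I I' f x) :
    pullback I f (pullback I' g α) x = pullback I (g ∘ f) α x := by
  simp only [pullback]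
  rw [mfderiv_comp x hg hf]
  rfl

theorem pullback_congr {f g : N → N'} (α : DiffForm I' N' k) {x : N}
    (h : f =ᶠ[nhds x] g) : pullback I f α x = pullback I g α x := by
  have h1 : (mfderiv I I' f x : E →L[ℝ] E') = mfderiv I I' g x := h.mfderiv_eq
  -- An equality of base points cannot be rewritten inside dependent types. All tangent spaces
  -- unfold to the model space, where the two forms can be compared; the same device recurs below.
  have h2 : (α (f x) : E' [⋀^Fin k]→L[ℝ] ℝ) = α (g x) :=
    (show ∀ y y', y = y' → (α y : E' [⋀^Fin k]→L[ℝ] ℝ) = α y' by rintro y _ rfl; rfl) _ _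
      h.eq_of_nhds
  change (α (f x) : E' [⋀^Fin k]→L[ℝ] ℝ).compContinuousLinearMap
    (mfderiv I I' f x : E →L[ℝ] E') = _
  rw [h1, h2]
  rfl

/-- Near a point, the pullback of a form can be computed in a chart of the target. -/
theorem pullback_eq_inChart [I.Boundaryless] [IsManifold I ∞ N] {G : X → N} (α : DiffForm I N k)
    {y : X} (hG : MDifferentiableAt 𝓘(ℝ, X) I G y) {p : N} (hp : G y ∈ (extChartAt I p).source) :
    (pullback 𝓘(ℝ, X) G α y : X [⋀^Fin k]→L[ℝ] ℝ) =
      (inChart α p (extChartAt I p (G y))).compContinuousLinearMap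
        (fderiv ℝ (extChartAt I p ∘ G) y) := by
  have : IsManifold I 1 N := IsManifold.of_le (n := ∞) (by simp)
  have hp' : G y ∈ (chartAt H p).source := by rwa [extChartAt_source] at hp
  have hs : MDifferentiableAt I 𝓘(ℝ, E) (extChartAt I p) (G y) := mdifferentiableAt_extChartAt hp'
  have ht : MDifferentiableAt 𝓘(ℝ, E) I (extChartAt I p).symm (extChartAt I p (G y)) := by
    have := mdifferentiableWithinAt_extChartAt_symm (I := I) ((extChartAt I p).map_source hp)
    rwa [I.range_eq_univ, mdifferentiableWithinAt_univ] at this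
  have hsG : MDifferentiableAt 𝓘(ℝ, X) 𝓘(ℝ, E) (extChartAt I p ∘ G) y := hs.comp y hG
  rw [← mfderiv_eq_fderiv]
  change _ = pullback 𝓘(ℝ, X) (extChartAt I p ∘ G) (pullback 𝓘(ℝ, E) (extChartAt I p).symm α) y
  rw [pullback_pullback_apply α (f := extChartAt I p ∘ G) ht hsG]
  refine pullback_congr α ?_
  filter_upwards [hG.continuousAt.preimage_mem_nhds (extChartAt_source_mem_nhds' hp)] with z hz
  exact ((extChartAt I p).left_inv hz).symm

theorem inChart_contDiffAt [I.Boundaryless] {α : DiffForm I N k} (hα : IsSmoothForm α) {p : N}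
    {y : E} (hy : y ∈ (extChartAt I p).target) : ContDiffAt ℝ ∞ (inChart α p) y :=
  (hα p).contDiffAt ((isOpen_extChartAt_target p).mem_nhds hy)

theorem contMDiffAt_extChartAt_symm [I.Boundaryless] [IsManifold I ∞ N] {p : N} {y : E}
    (hy : y ∈ (extChartAt I p).target) :
    ContMDiffAt 𝓘(ℝ, E) I ∞ (extChartAt I p).symm y :=
  (contMDiffOn_extChartAt_symm p).contMDiffAt ((isOpen_extChartAt_target p).mem_nhds hy)

section

variable [I.Boundaryless] [IsManifold I ∞ N] {G : X → N} {U : Set X} {α : DiffForm I N k}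

omit [I.Boundaryless] in
theorem contDiffAt_extChartAt_comp {y : X}
    (hG : ContMDiffAt 𝓘(ℝ, X) I ∞ G y) {p : N} (hp : G y ∈ (extChartAt I p).source) :
    ContDiffAt ℝ ∞ (extChartAt I p ∘ G) y := by
  rw [extChartAt_source] at hp
  exact ((contMDiffAt_extChartAt' hp).comp y hG).contDiffAt

theorem pullback_eventuallyEq_inChart (hU : IsOpen U)
    (hG : ContMDiffOn 𝓘(ℝ, X) I ∞ G U) {y : X} (hy : y ∈ U) {p : N}
    (hp : G y ∈ (extChartAt I p).source) :
    ∀ᶠ z in nhds y, (pullback 𝓘(ℝ, X) G α z : X [⋀^Fin k]→L[ℝ] ℝ) =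
      (inChart α p (extChartAt I p (G z))).compContinuousLinearMap
        (fderiv ℝ (extChartAt I p ∘ G) z) := by
  have hc : ContinuousAt G y := (hG.contMDiffAt (hU.mem_nhds hy)).continuousAt
  filter_upwards [hU.mem_nhds hy, hc.preimage_mem_nhds (extChartAt_source_mem_nhds' hp)]
    with z hz hz'
  exact pullback_eq_inChart α ((hG.contMDiffAt (hU.mem_nhds hz)).mdifferentiableAt (by simp)) hz'

theorem contDiffOn_pullback [FiniteDimensional ℝ X] (hα : IsSmoothForm α) (hU : IsOpen U)
    (hG : ContMDiffOn 𝓘(ℝ, X) I ∞ G U) :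
    ContDiffOn ℝ ∞ (F := X [⋀^Fin k]→L[ℝ] ℝ) (pullback 𝓘(ℝ, X) G α) U := by
  intro y hy
  refine ContDiffAt.contDiffWithinAt ?_
  have hp := mem_extChartAt_source (I := I) (G y)
  refine ContDiffAt.congr_of_eventuallyEq ?_ (pullback_eventuallyEq_inChart hU hG hy hp)
  have h1 : ContDiffAt ℝ ∞ (extChartAt I (G y) ∘ G) y :=
    contDiffAt_extChartAt_comp (hG.contMDiffAt (hU.mem_nhds hy)) hp
  have h2 := (inChart_contDiffAt hα ((extChartAt I (G y)).map_source hp)).comp y h1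
  exact contDiffAt_compContinuousLinearMap h2 (h1.fderiv_right (m := ∞) (by simp))

/-- The exterior derivative commutes with the pullback along a map from an open subset of a vector
space. -/
theorem extDeriv_pullback_eq (hα : IsSmoothForm α) (hU : IsOpen U)
    (hG : ContMDiffOn 𝓘(ℝ, X) I ∞ G U) {y : X} (hy : y ∈ U) :
    extDeriv (pullback 𝓘(ℝ, X) G α : X → X [⋀^Fin k]→L[ℝ] ℝ) y =
      pullback 𝓘(ℝ, X) G (extD α) y := by
  have hGy := hG.contMDiffAt (hU.mem_nhds hy)
  have hp := mem_extChartAt_source (I := I) (G y)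
  rw [Filter.EventuallyEq.extDeriv_eq (pullback_eventuallyEq_inChart hU hG hy hp)]
  have h1 : ContDiffAt ℝ ∞ (extChartAt I (G y) ∘ G) y := contDiffAt_extChartAt_comp hGy hp
  have h2 := (inChart_contDiffAt hα ((extChartAt I (G y)).map_source hp)).differentiableAt
    (by simp)
  have h3 := extDeriv_pullback (f := extChartAt I (G y) ∘ G) h2 h1 (r := ∞)
    (by simpa using WithTop.coe_le_coe.2 (le_top : (2 : ℕ∞) ≤ ⊤))
  refine h3.trans ?_
  have : IsManifold I 1 N := IsManifold.of_le (n := ∞) (by simp)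
  rw [← mfderiv_eq_fderiv, mfderiv_comp y (mdifferentiableAt_extChartAt (mem_chart_source H (G y)))
    (hGy.mdifferentiableAt (by simp))]
  rfl

theorem inChart_extD (hα : IsSmoothForm α) {p : N} {y : E} (hy : y ∈ (extChartAt I p).target) :
    inChart (extD α) p y = extDeriv (inChart α p) y :=
  (extDeriv_pullback_eq hα (isOpen_extChartAt_target p) (contMDiffOn_extChartAt_symm p) hy).symm

/-- The tangent space at `x` is identified with the model space through the preferred chart at `x`,
whose derivative there is therefore the identity. -/
theorem extD_apply_eq {β : DiffForm I N k} {x : N} :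
    extD β x = extDeriv (inChart β x) (extChartAt I x x) := by
  have : IsManifold I 1 N := IsManifold.of_le (n := ∞) (by simp)
  rw [extD, mfderiv_extChartAt_self]
  rfl

theorem IsSmoothForm.extD (hα : IsSmoothForm α) : IsSmoothForm (extD α) := by
  intro p
  have h := isOpen_extChartAt_target (I := I) p
  refine ContDiffOn.congr (f := extDeriv (inChart α p)) ?_ fun y hy => inChart_extD hα hy
  have hc : ContDiff ℝ ∞ ⇑(ContinuousAlternatingMap.alternatizeUncurryFinCLM (n := k) ℝ E ℝ) :=
    ContinuousLinearMap.contDiff _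
  refine hc.comp_contDiffOn ?_
  exact (hα p).fderiv_of_isOpen h (by simp)

end

section

variable [I.Boundaryless] [IsManifold I ∞ N] [I'.Boundaryless] [IsManifold I' ∞ N']
  {f : N → N'} {α : DiffForm I' N' k}

omit [I'.Boundaryless] [IsManifold I' ∞ N'] in
theorem inChart_pullback (hf : ContMDiff I I' ∞ f) {p : N} {y : E}
    (hy : y ∈ (extChartAt I p).target) : inChart (pullback I f α) p y =
      pullback 𝓘(ℝ, E) (f ∘ (extChartAt I p).symm) α y :=
  pullback_pullback_apply α (hf.mdifferentiable (by simp) _)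
    ((contMDiffAt_extChartAt_symm hy).mdifferentiableAt (by simp))

theorem IsSmoothForm.pullback [FiniteDimensional ℝ E] (hα : IsSmoothForm α)
    (hf : ContMDiff I I' ∞ f) : IsSmoothForm (pullback I f α) := by
  intro p
  refine ContDiffOn.congr ?_ fun y hy => inChart_pullback hf hy
  exact contDiffOn_pullback hα (isOpen_extChartAt_target p)
    (hf.comp_contMDiffOn (contMDiffOn_extChartAt_symm p))

end

end Naturality

/-! ### Chart derivatives, charts of form bundles, tautological forms -/

section

variable {E : Type*} [NormedAddCommGroup E] [NormedSpace ℝ E]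
  {H : Type*} [TopologicalSpace H] {I : ModelWithCorners ℝ E H} [I.Boundaryless]
  {N : Type*} [TopologicalSpace N] [ChartedSpace H N] [IsManifold I ∞ N]

/-- Links derivatives of inverse charts to the cocycle of the tangent bundle, from which
`formBundleCore` is built. Thus a bundle chart pulls components back along the inverse chart of the
base (`extChartAt_bundle_snd`). -/
theorem mfderiv_extChartAt_symm_eq_coordChange [IsManifold I 1 N] {p : N} {y : E}
    (hy : y ∈ (extChartAt I p).target) :
    (mfderiv 𝓘(ℝ, E) I (extChartAt I p).symm y : E →L[ℝ] E) =
      (tangentBundleCore I N).coordChange (achart H p) (achart H ((extChartAt I p).symm y))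
        ((extChartAt I p).symm y) := by
  have h := (contMDiffAt_extChartAt_symm hy).mdifferentiableAt (by simp)
  refine h.mfderiv.trans ?_
  rw [tangentBundleCore_coordChange_achart, (extChartAt I p).right_inv hy, I.range_eq_univ]
  simp only [writtenInExtChartAt, extChartAt_model_space_eq_id, PartialEquiv.refl_symm,
    PartialEquiv.refl_coe, modelWithCornersSelf_coe, Set.range_id, id, Function.comp_id]
  rfl

theorem mfderiv_extChartAt_symm_self (p : N) :
    (mfderiv 𝓘(ℝ, E) I (extChartAt I p).symm (extChartAt I p p) : E →L[ℝ] E) =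
      ContinuousLinearMap.id ℝ E := by
  have : IsManifold I 1 N := IsManifold.of_le (n := ∞) (by simp)
  have h := mfderivWithin_range_extChartAt_symm (I := I) (x := p)
  rwa [I.range_eq_univ, mfderivWithin_univ] at h

end

section FormBundle

variable {E : Type*} [NormedAddCommGroup E] [NormedSpace ℝ E] [FiniteDimensional ℝ E]
  {M : Type*} [TopologicalSpace M] [ChartedSpace E M] [IsManifold 𝓘(ℝ, E) ∞ M]
  {J : Type*} [Fintype J] {r : J → ℕ} {Φ : TopologicalSpace.Opens (FormBundle E M r)}


theorem extChartAt_opens_apply (z z' : Φ) :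
    extChartAt (bundleModel E r) z z' = extChartAt (bundleModel E r) z.1 z'.1 := rfl

theorem extChartAt_bundle_source (z : FormBundle E M r) :
    (extChartAt (bundleModel E r) z).source =
      Bundle.TotalSpace.proj ⁻¹' (extChartAt 𝓘(ℝ, E) z.proj).source := by
  rw [extChartAt_source, FiberBundle.chartedSpace_chartAt, extChartAt_source]
  ext z'
  rw [OpenPartialHomeomorph.trans_source, Bundle.Trivialization.source_eq]
  exact ⟨fun h => h.1, fun h => ⟨h, h, trivial⟩⟩

theorem mem_extChartAt_opens_source {z z' : Φ} :
    z' ∈ (extChartAt (bundleModel E r) z).source ↔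
      z'.1.proj ∈ (extChartAt 𝓘(ℝ, E) z.1.proj).source := by
  have h : z' ∈ (extChartAt (bundleModel E r) z).source ↔
      z'.1 ∈ (extChartAt (bundleModel E r) z.1).source := by
    rw [extChartAt_source, TopologicalSpace.Opens.chartAt_eq,
      OpenPartialHomeomorph.subtypeRestr_source, Set.mem_preimage, extChartAt_source]
  rw [h, extChartAt_bundle_source]
  rfl

theorem extChartAt_bundle_apply {z z' : FormBundle E M r} :
    extChartAt (bundleModel E r) z z' = (extChartAt 𝓘(ℝ, E) z.proj z'.proj,
      (formBundleCore E M r).coordChange (achart E z'.proj) (achart E z.proj) z'.proj z'.2) := by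
  rw [FiberBundle.extChartAt]
  rfl

theorem extChartAt_bundle_snd {z z' : FormBundle E M r} (j : J)
    (h : z'.proj ∈ (extChartAt 𝓘(ℝ, E) z.proj).source) :
    (extChartAt (bundleModel E r) z z').2 j =
      (component z'.2 j : E [⋀^Fin (r j)]→L[ℝ] ℝ).compContinuousLinearMap
        (mfderiv 𝓘(ℝ, E) 𝓘(ℝ, E) (extChartAt 𝓘(ℝ, E) z.proj).symm
          (extChartAt 𝓘(ℝ, E) z.proj z'.proj) : E →L[ℝ] E) := by
  have : IsManifold 𝓘(ℝ, E) 1 M := IsManifold.of_le (n := ∞) (by simp)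
  rw [mfderiv_extChartAt_symm_eq_coordChange ((extChartAt 𝓘(ℝ, E) z.proj).map_source h),
    (extChartAt 𝓘(ℝ, E) z.proj).left_inv h, extChartAt_bundle_apply]
  rfl

theorem proj_comp_extChartAt_symm {z : Φ} {w : E × FormFibre E r}
    (hw : w ∈ (extChartAt (bundleModel E r) z).target) :
    proj Φ ((extChartAt (bundleModel E r) z).symm w) =
      (extChartAt 𝓘(ℝ, E) (proj Φ z)).symm w.1 := by
  set z' := (extChartAt (bundleModel E r) z).symm w with hz'
  have h1 : z' ∈ (extChartAt (bundleModel E r) z).source := PartialEquiv.map_target _ hw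
  have h2 : extChartAt (bundleModel E r) z z' = w := PartialEquiv.right_inv _ hw
  have h3 := mem_extChartAt_opens_source.1 h1
  rw [← h2, extChartAt_opens_apply, extChartAt_bundle_apply]
  exact ((extChartAt 𝓘(ℝ, E) (proj Φ z)).left_inv h3).symm

theorem fst_mem_target {z : Φ} {w : E × FormFibre E r}
    (hw : w ∈ (extChartAt (bundleModel E r) z).target) :
    w.1 ∈ (extChartAt 𝓘(ℝ, E) (proj Φ z)).target := by
  have h1 : (extChartAt (bundleModel E r) z).symm w ∈ (extChartAt (bundleModel E r) z).source :=
    PartialEquiv.map_target _ hw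
  have h2 : extChartAt (bundleModel E r) z ((extChartAt (bundleModel E r) z).symm w) = w :=
    PartialEquiv.right_inv _ hw
  have h3 := mem_extChartAt_opens_source.1 h1
  rw [← h2, extChartAt_opens_apply, extChartAt_bundle_apply]
  exact (extChartAt 𝓘(ℝ, E) (proj Φ z)).map_source h3

theorem contMDiff_proj_opens : ContMDiff (bundleModel E r) 𝓘(ℝ, E) ∞ (proj Φ) :=
  (Bundle.contMDiff_proj (formBundleCore E M r).Fiber).comp contMDiff_subtype_val

theorem mfderiv_proj_comp_mfderiv_extChartAt_symm {z : Φ} {w : E × FormFibre E r}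
    (hw : w ∈ (extChartAt (bundleModel E r) z).target) :
    ((mfderiv (bundleModel E r) 𝓘(ℝ, E) (proj Φ) ((extChartAt (bundleModel E r) z).symm w) :
        E × FormFibre E r →L[ℝ] E).comp
      (mfderiv 𝓘(ℝ, E × FormFibre E r) (bundleModel E r) (extChartAt (bundleModel E r) z).symm w :
        E × FormFibre E r →L[ℝ] E × FormFibre E r)) =
      (mfderiv 𝓘(ℝ, E) 𝓘(ℝ, E) (extChartAt 𝓘(ℝ, E) (proj Φ z)).symm w.1 : E →L[ℝ] E).comp
        (ContinuousLinearMap.fst ℝ E (FormFibre E r)) := by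
  have h1 := mfderiv_comp w (contMDiff_proj_opens.mdifferentiable (by simp) _)
    ((contMDiffAt_extChartAt_symm hw).mdifferentiableAt (by simp))
  refine h1.symm.trans ?_
  have h2 : proj Φ ∘ (extChartAt (bundleModel E r) z).symm =ᶠ[nhds w]
      (extChartAt 𝓘(ℝ, E) (proj Φ z)).symm ∘ Prod.fst := by
    filter_upwards [(isOpen_extChartAt_target z).mem_nhds hw] with w' hw'
    exact proj_comp_extChartAt_symm hw'
  have h3 : HasMFDerivAt 𝓘(ℝ, E × FormFibre E r) 𝓘(ℝ, E) (Prod.fst : E × FormFibre E r → E) w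
      (ContinuousLinearMap.fst ℝ E (FormFibre E r)) :=
    (ContinuousLinearMap.fst ℝ E (FormFibre E r)).hasFDerivAt.hasMFDerivAt
  have h4 := ((contMDiffAt_extChartAt_symm (fst_mem_target hw)).mdifferentiableAt
    (n := ∞) (by simp)).hasMFDerivAt
  exact h2.mfderiv_eq.trans (h4.comp w h3).mfderiv

theorem inChart_horizontalForm {n : ℕ} (F : HorForm E M r n) {z : Φ} {w : E × FormFibre E r}
    (hw : w ∈ (extChartAt (bundleModel E r) z).target) :
    inChart (horizontalForm F Φ) z w =
      ((F ((extChartAt (bundleModel E r) z).symm w).1 : E [⋀^Fin n]→L[ℝ] ℝ).compContinuousLinearMap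
        (mfderiv 𝓘(ℝ, E) 𝓘(ℝ, E) (extChartAt 𝓘(ℝ, E) (proj Φ z)).symm w.1 :
          E →L[ℝ] E)).compContinuousLinearMap (ContinuousLinearMap.fst ℝ E (FormFibre E r)) := by
  have h := congrArg (fun L : E × FormFibre E r →L[ℝ] E =>
    (F ((extChartAt (bundleModel E r) z).symm w).1 : E [⋀^Fin n]→L[ℝ] ℝ).compContinuousLinearMap L)
    (mfderiv_proj_comp_mfderiv_extChartAt_symm hw)
  exact h

/-- The bundle chart pulls a component back along the inverse chart of the base, and `inChart` does
the same to a horizontal form. So the tautological form is the fibre coordinate itself, without any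
derivative of the chart, and its smoothness is evident. -/
theorem inChart_tautForm {z : Φ} {w : E × FormFibre E r} (j : J)
    (hw : w ∈ (extChartAt (bundleModel E r) z).target) :
    inChart (tautForm Φ j) z w =
      (w.2 j).compContinuousLinearMap (ContinuousLinearMap.fst ℝ E (FormFibre E r)) := by
  refine (inChart_horizontalForm (fun z => component z.2 j) hw).trans ?_
  congr 1
  set z' := (extChartAt (bundleModel E r) z).symm w with hz'
  have h1 : z' ∈ (extChartAt (bundleModel E r) z).source := PartialEquiv.map_target _ hw
  have h2 : extChartAt (bundleModel E r) z z' = w := PartialEquiv.right_inv _ hw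
  have h3 := mem_extChartAt_opens_source.1 h1
  have h4 := extChartAt_bundle_snd (z := z.1) (z' := z'.1) j h3
  rw [← h2, extChartAt_opens_apply, h4, extChartAt_bundle_apply]
  rfl

theorem isSmoothForm_tautForm (j : J) : IsSmoothForm (tautForm Φ j) := by
  intro z
  refine ContDiffOn.congr ?_ fun w hw => inChart_tautForm j hw
  have h : ContDiff ℝ ∞ fun w : E × FormFibre E r => w.2 j :=
    ((ContinuousLinearMap.proj (R := ℝ) (φ := fun j => E [⋀^Fin (r j)]→L[ℝ] ℝ) j).comp
      (ContinuousLinearMap.snd ℝ E (FormFibre E r))).contDiff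
  exact ContDiff.contDiffOn (contDiff_iff_contDiffAt.2 fun w =>
    contDiffAt_compContinuousLinearMap h.contDiffAt contDiffAt_const)

/-- At the centre of the preferred charts both inverse charts have derivative the identity. Vertical
vectors are therefore the pairs `(0, δ)`. -/
theorem mfderiv_proj_apply (z : Φ) (u : TangentSpace (bundleModel E r) z) :
    mfderiv (bundleModel E r) 𝓘(ℝ, E) (proj Φ) z u = (u : E × FormFibre E r).1 := by
  set c := extChartAt (bundleModel E r) z
  have h := mfderiv_proj_comp_mfderiv_extChartAt_symm
    (mem_extChartAt_target (I := bundleModel E r) z)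
  have h1 : (c z).1 = extChartAt 𝓘(ℝ, E) (proj Φ z) (proj Φ z) := by
    rw [extChartAt_opens_apply, extChartAt_bundle_apply]
    rfl
  have h2 : (mfderiv 𝓘(ℝ, E) 𝓘(ℝ, E) (extChartAt 𝓘(ℝ, E) (proj Φ z)).symm (c z).1 :
      E →L[ℝ] E) = ContinuousLinearMap.id ℝ E := by
    rw [h1]; exact mfderiv_extChartAt_symm_self _
  let A : Φ → E × FormFibre E r →L[ℝ] E := fun z => mfderiv (bundleModel E r) 𝓘(ℝ, E) (proj Φ) z
  let B : E × FormFibre E r →L[ℝ] E × FormFibre E r :=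
    mfderiv 𝓘(ℝ, E × FormFibre E r) (bundleModel E r) c.symm (c z)
  let u' : E × FormFibre E r := u
  change A z u' = u'.1
  have h3 : A (c.symm (c z)) (B u') = u'.1 := by
    refine (DFunLike.congr_fun h u').trans ?_
    rw [h2]; rfl
  have h4 : B u' = u' := DFunLike.congr_fun
    (mfderiv_extChartAt_symm_self (I := bundleModel E r) z) u'
  rwa [h4, extChartAt_to_inv] at h3

end FormBundle

/-! ### Smoothness of forms and of the Cartan-Poincaré form -/

section Wedge

variable {X A B C : Type*} [NormedAddCommGroup X] [NormedSpace ℝ X]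
  [NormedAddCommGroup A] [NormedSpace ℝ A] [FiniteDimensional ℝ A]
  [NormedAddCommGroup B] [NormedSpace ℝ B] [FiniteDimensional ℝ B]
  [NormedAddCommGroup C] [NormedSpace ℝ C]
  {V : Type*} [NormedAddCommGroup V] [NormedSpace ℝ V] [FiniteDimensional ℝ V] {k l n : ℕ}

theorem contDiffOn_bilinear (f : A →ₗ[ℝ] B →ₗ[ℝ] C) {a : X → A} {b : X → B} {U : Set X}
    (ha : ContDiffOn ℝ ∞ a U) (hb : ContDiffOn ℝ ∞ b U) :
    ContDiffOn ℝ ∞ (fun x => f (a x) (b x)) U :=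
  let F : A →L[ℝ] B →L[ℝ] C :=
    LinearMap.toContinuousLinearMap (LinearMap.toContinuousLinearMap.toLinearMap ∘ₗ f)
  (F.contDiff.comp_contDiffOn ha).clm_apply hb

theorem contDiffOn_wedge {a : X → V [⋀^Fin k]→L[ℝ] ℝ} {b : X → V [⋀^Fin l]→L[ℝ] ℝ} (h : k + l = n)
    {U : Set X} (ha : ContDiffOn ℝ ∞ a U) (hb : ContDiffOn ℝ ∞ b U) :
    ContDiffOn ℝ ∞ (fun x => wedge (a x) (b x) h) U :=
  contDiffOn_bilinear (wedgeLM h) ha hb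

end Wedge

section SmoothForms

variable {E : Type*} [NormedAddCommGroup E] [NormedSpace ℝ E]
  {H : Type*} [TopologicalSpace H] {I : ModelWithCorners ℝ E H} [I.Boundaryless]
  {N : Type*} [TopologicalSpace N] [ChartedSpace H N] [IsManifold I ∞ N] {k l n : ℕ}

omit [IsManifold I ∞ N] in
theorem inChart_wedge (α : DiffForm I N k) (β : DiffForm I N l) (h : k + l = n) (p : N) (y : E) :
    inChart (fun x => wedge (α x) (β x) h) p y = wedge (inChart α p y) (inChart β p y) h :=
  wedge_compContinuousLinearMap _ _ _ _

omit [IsManifold I ∞ N] in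
theorem IsSmoothForm.wedge [FiniteDimensional ℝ E] {α : DiffForm I N k} {β : DiffForm I N l}
    (hα : IsSmoothForm α) (hβ : IsSmoothForm β) (h : k + l = n) :
    IsSmoothForm (fun x => wedge (α x) (β x) h : DiffForm I N n) := fun p => by
  refine ContDiffOn.congr ?_ fun y _ => inChart_wedge α β h p y
  exact contDiffOn_wedge h (hα p) (hβ p)

omit [IsManifold I ∞ N] in
theorem IsSmoothForm.add {α β : DiffForm I N k} (hα : IsSmoothForm α) (hβ : IsSmoothForm β) :
    IsSmoothForm (α + β) := fun p => (hα p).add (hβ p)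

omit [IsManifold I ∞ N] in
theorem IsSmoothForm.const_smul {α : DiffForm I N k} (c : ℝ) (hα : IsSmoothForm α) :
    IsSmoothForm (c • α) := fun p => (hα p).const_smul c

omit [IsManifold I ∞ N] in
theorem isSmoothForm_zero : IsSmoothForm (0 : DiffForm I N k) := fun p => by
  have h : inChart (0 : DiffForm I N k) p = fun _ => 0 := rfl
  rw [h]; exact contDiffOn_const

omit [IsManifold I ∞ N] in
theorem IsSmoothForm.sum {ι : Type*} {s : Finset ι} {α : ι → DiffForm I N k}
    (hα : ∀ i ∈ s, IsSmoothForm (α i)) : IsSmoothForm (∑ i ∈ s, α i) :=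
  Finset.sum_induction _ IsSmoothForm (fun _ _ h h' => h.add h') isSmoothForm_zero hα

theorem extD_add {α β : DiffForm I N k} (hα : IsSmoothForm α) (hβ : IsSmoothForm β) :
    extD (α + β) = extD α + extD β := by
  funext x
  have hx := mem_extChartAt_target (I := I) x
  rw [extD_apply_eq, Pi.add_apply, extD_apply_eq, extD_apply_eq]
  exact extDeriv_add ((inChart_contDiffAt hα hx).differentiableAt (by simp))
    ((inChart_contDiffAt hβ hx).differentiableAt (by simp))

theorem extD_const_smul (c : ℝ) (α : DiffForm I N k) :
    extD (c • α) = c • extD α := by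
  funext x
  rw [extD_apply_eq, Pi.smul_apply, extD_apply_eq]
  exact extDeriv_smul c (inChart α x)

theorem extD_sum {ι : Type*} {s : Finset ι} {α : ι → DiffForm I N k}
    (hα : ∀ i ∈ s, IsSmoothForm (α i)) : extD (∑ i ∈ s, α i) = ∑ i ∈ s, extD (α i) := by
  classical
  induction s using Finset.induction_on with
  | empty =>
    simp only [Finset.sum_empty]
    simpa using extD_const_smul (0 : ℝ) (0 : DiffForm I N k)
  | insert i s hi ih =>
    rw [Finset.sum_insert hi, Finset.sum_insert hi, extD_add (hα _ (by simp))
      (IsSmoothForm.sum fun j hj => hα j (by simp [hj])), ih fun j hj => hα j (by simp [hj])]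

end SmoothForms

section Phase

variable {m : ℕ} {M : Type*} [TopologicalSpace M]
  [ChartedSpace (EuclideanSpace ℝ (Fin (m + 1))) M] [IsManifold (𝓡 (m + 1)) ∞ M]
  {ι : Type*} [Fintype ι] {q : ι → ℕ}

theorem isSmoothForm_cartanPoincare {Φ : TopologicalSpace.Opens (PhaseTotal (m := m) M q)}
    {H : Hamiltonian (m := m) M q} (hH : IsSmoothForm (horizontalForm H Φ)) :
    IsSmoothForm (cartanPoincare Φ H) := by
  have h : cartanPoincare Φ H = (∑ A : {A : ι // q A ≤ m}, (-1 : ℝ) ^ (m + 1 - q A.1) •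
      (fun z => wedge (tautForm Φ (Sum.inr A) z) (extD (tautForm Φ (Sum.inl A.1)) z)
        (by have := A.2; simp only [phaseDeg, Sum.elim_inl, Sum.elim_inr]; omega) :
          DiffForm (phaseModel m q) Φ (m + 1))) + horizontalForm H Φ := by
    funext z
    rw [Pi.add_apply, Finset.sum_apply]
    rfl
  rw [h]
  refine IsSmoothForm.add (IsSmoothForm.sum fun A _ => IsSmoothForm.const_smul _ ?_) hH
  exact (isSmoothForm_tautForm _).wedge (isSmoothForm_tautForm _).extD _

end Phase

/-! ### First variation of a pullback along a family of maps -/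

section Variation

variable {X : Type*} [NormedAddCommGroup X] [NormedSpace ℝ X] [FiniteDimensional ℝ X]
  {E : Type*} [NormedAddCommGroup E] [NormedSpace ℝ E]
  {H : Type*} [TopologicalSpace H] {I : ModelWithCorners ℝ E H} [I.Boundaryless]
  {N : Type*} [TopologicalSpace N] [ChartedSpace H N] [IsManifold I ∞ N] {k : ℕ}
  {G : ℝ × X → N} {U : Set (ℝ × X)} {α : DiffForm I N k}

/-- The velocity of the curve `s ↦ G (s, y)` at `t`. -/
noncomputable def velocity (I : ModelWithCorners ℝ E H) (G : ℝ × X → N) (t : ℝ) (y : X) :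
    TangentSpace I (G (t, y)) :=
  mfderiv 𝓘(ℝ, ℝ) I (fun s => G (s, y)) t (1 : ℝ)

omit [FiniteDimensional ℝ X] [I.Boundaryless] [IsManifold I ∞ N] in
theorem mfderiv_slice {t : ℝ} {y : X} (h : MDifferentiableAt 𝓘(ℝ, ℝ × X) I G (t, y)) :
    (mfderiv 𝓘(ℝ, X) I (fun y => G (t, y)) y : X →L[ℝ] E) =
      (mfderiv 𝓘(ℝ, ℝ × X) I G (t, y) : ℝ × X →L[ℝ] E).comp (ContinuousLinearMap.inr ℝ ℝ X) := by
  have h1 : HasMFDerivAt 𝓘(ℝ, X) 𝓘(ℝ, ℝ × X) (fun y : X => (t, y)) y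
      (ContinuousLinearMap.inr ℝ ℝ X) := (hasFDerivAt_prodMk_right t y).hasMFDerivAt
  exact (HasMFDerivAt.comp y (f := fun y : X => (t, y)) h.hasMFDerivAt h1).mfderiv

omit [FiniteDimensional ℝ X] [I.Boundaryless] [IsManifold I ∞ N] in
theorem velocity_eq {t : ℝ} {y : X} (h : MDifferentiableAt 𝓘(ℝ, ℝ × X) I G (t, y)) :
    velocity I G t y = mfderiv 𝓘(ℝ, ℝ × X) I G (t, y) (((1 : ℝ), (0 : X)) : ℝ × X) := by
  have h1 : HasMFDerivAt 𝓘(ℝ, ℝ) 𝓘(ℝ, ℝ × X) (fun s : ℝ => (s, y)) t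
      (ContinuousLinearMap.inl ℝ ℝ X) := (hasFDerivAt_prodMk_left t y).hasMFDerivAt
  have h2 := (HasMFDerivAt.comp t (f := fun s : ℝ => (s, y)) h.hasMFDerivAt h1).mfderiv
  exact DFunLike.congr_fun h2 (1 : ℝ)

omit [FiniteDimensional ℝ X] [I.Boundaryless] [IsManifold I ∞ N] in
theorem pullback_apply_inr {t : ℝ} {y : X} (h : MDifferentiableAt 𝓘(ℝ, ℝ × X) I G (t, y))
    (w : Fin k → X) :
    pullback 𝓘(ℝ, ℝ × X) G α (t, y) (fun i => ((0, w i) : ℝ × X)) =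
      pullback 𝓘(ℝ, X) (fun y => G (t, y)) α y w := by
  simp only [pullback]
  change (α (G (t, y)) : E [⋀^Fin k]→L[ℝ] ℝ) _ = (α (G (t, y)) : E [⋀^Fin k]→L[ℝ] ℝ) _
  congr 1
  funext i
  exact (DFunLike.congr_fun (mfderiv_slice h) (w i)).symm

omit [FiniteDimensional ℝ X] [I.Boundaryless] [IsManifold I ∞ N] in
theorem pullback_apply_vecCons {α : DiffForm I N (k + 1)} {t : ℝ} {y : X}
    (h : MDifferentiableAt 𝓘(ℝ, ℝ × X) I G (t, y)) (w : Fin k → X) :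
    pullback 𝓘(ℝ, ℝ × X) G α (t, y)
      (Matrix.vecCons ((1, 0) : ℝ × X) fun i => ((0, w i) : ℝ × X)) =
      α (G (t, y)) (Matrix.vecCons (velocity I G t y)
        fun i => mfderiv 𝓘(ℝ, X) I (fun y => G (t, y)) y (w i)) := by
  simp only [pullback]
  change (α (G (t, y)) : E [⋀^Fin (k + 1)]→L[ℝ] ℝ) _ = (α (G (t, y)) : E [⋀^Fin (k + 1)]→L[ℝ] ℝ) _
  congr 1
  funext i
  refine Fin.cases ?_ (fun i => ?_) i
  · exact (velocity_eq h).symm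
  · exact (DFunLike.congr_fun (mfderiv_slice h) (w i)).symm

/-- The contraction of the pullback along `G (t, ·)` with the velocity of `G`. -/
noncomputable def contraction (G : ℝ × X → N) (α : DiffForm I N (k + 1)) (t : ℝ) (y : X) :
    X [⋀^Fin k]→L[ℝ] ℝ :=
  (ContinuousAlternatingMap.curryLeft (E := E) (α (G (t, y))) (velocity I G t y)
    ).compContinuousLinearMap (mfderiv 𝓘(ℝ, X) I (fun y => G (t, y)) y : X →L[ℝ] E)

omit [FiniteDimensional ℝ X] [I.Boundaryless] [IsManifold I ∞ N] in
theorem contraction_eq {α : DiffForm I N (k + 1)} {t : ℝ} {y : X}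
    (h : MDifferentiableAt 𝓘(ℝ, ℝ × X) I G (t, y)) :
    contraction G α t y = ((pullback 𝓘(ℝ, ℝ × X) G α (t, y) :
      (ℝ × X) [⋀^Fin (k + 1)]→L[ℝ] ℝ).curryLeft (1, 0)).compContinuousLinearMap
        (ContinuousLinearMap.inr ℝ ℝ X) := by
  ext w
  exact (pullback_apply_vecCons h w).symm

theorem contDiffOn_contraction {α : DiffForm I N (k + 1)} (hα : IsSmoothForm α) (hU : IsOpen U)
    (hG : ContMDiffOn 𝓘(ℝ, ℝ × X) I ∞ G U) (t : ℝ) :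
    ContDiffOn ℝ ∞ (contraction G α t) {y | (t, y) ∈ U} := by
  let T : ((ℝ × X) [⋀^Fin (k + 1)]→L[ℝ] ℝ) →ₗ[ℝ] (X [⋀^Fin k]→L[ℝ] ℝ) :=
    { toFun := fun a => (a.curryLeft (1, 0)).compContinuousLinearMap
        (ContinuousLinearMap.inr ℝ ℝ X)
      map_add' := fun _ _ => rfl
      map_smul' := fun _ _ => rfl }
  have h1 : ContDiffOn ℝ ∞ (F := (ℝ × X) [⋀^Fin (k + 1)]→L[ℝ] ℝ)
      (fun y => pullback 𝓘(ℝ, ℝ × X) G α (t, y)) {y | (t, y) ∈ U} :=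
    (contDiffOn_pullback hα hU hG).comp (contDiff_prodMk_right t).contDiffOn fun y hy => hy
  refine ((LinearMap.toContinuousLinearMap T).contDiff.comp_contDiffOn h1).congr fun y hy => ?_
  exact contraction_eq ((hG.contMDiffAt (hU.mem_nhds hy)).mdifferentiableAt (by simp))

/-- The first variation of the pullback of a form of positive degree. -/
theorem hasDerivAt_pullback_slice {α : DiffForm I N (k + 1)} (hα : IsSmoothForm α) (hU : IsOpen U)
    (hG : ContMDiffOn 𝓘(ℝ, ℝ × X) I ∞ G U) {t : ℝ} {y : X} (hy : (t, y) ∈ U)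
    (w : Fin (k + 1) → X) :
    HasDerivAt (fun s => pullback 𝓘(ℝ, X) (fun y => G (s, y)) α y w)
      (contraction G (extD α) t y w + extDeriv (contraction G α t) y w) t := by
  have hmd : ∀ {p}, p ∈ U → MDifferentiableAt 𝓘(ℝ, ℝ × X) I G p := fun hp =>
    (hG.contMDiffAt (hU.mem_nhds hp)).mdifferentiableAt (by simp)
  have h1 := hasDerivAt_slice (β := pullback 𝓘(ℝ, ℝ × X) G α) (((contDiffOn_pullback hα hU
    hG).contDiffAt (hU.mem_nhds hy)).differentiableAt (by simp)) w
  have hc : Continuous fun s : ℝ => (s, y) := by fun_prop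
  have hc' : Continuous fun y : X => (t, y) := by fun_prop
  have h2 : (fun s => pullback 𝓘(ℝ, X) (fun y => G (s, y)) α y w) =ᶠ[nhds t]
      fun s => pullback 𝓘(ℝ, ℝ × X) G α (s, y) fun i => ((0, w i) : ℝ × X) := by
    filter_upwards [hc.continuousAt.preimage_mem_nhds (hU.mem_nhds hy)] with s hs
    exact (pullback_apply_inr (hmd hs) w).symm
  refine (h1.congr_of_eventuallyEq h2).congr_deriv ?_
  congr 1
  · rw [extDeriv_pullback_eq hα hU hG hy]
    exact pullback_apply_vecCons (hmd hy) w
  · refine DFunLike.congr_fun (Filter.EventuallyEq.extDeriv_eq ?_) w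
    filter_upwards [hc'.continuousAt.preimage_mem_nhds (hU.mem_nhds hy)] with z hz
    exact (contraction_eq (hmd hz)).symm

/-- The first variation of the pullback of a function. -/
theorem hasDerivAt_pullback_slice_zero {α : DiffForm I N 0} (hα : IsSmoothForm α) (hU : IsOpen U)
    (hG : ContMDiffOn 𝓘(ℝ, ℝ × X) I ∞ G U) {t : ℝ} {y : X} (hy : (t, y) ∈ U) (w : Fin 0 → X) :
    HasDerivAt (fun s => pullback 𝓘(ℝ, X) (fun y => G (s, y)) α y w)
      (contraction G (extD α) t y w) t := by
  have hmd : ∀ {p}, p ∈ U → MDifferentiableAt 𝓘(ℝ, ℝ × X) I G p := fun hp =>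
    (hG.contMDiffAt (hU.mem_nhds hp)).mdifferentiableAt (by simp)
  have h1 := hasDerivAt_slice_zero (β := pullback 𝓘(ℝ, ℝ × X) G α) (((contDiffOn_pullback hα hU
    hG).contDiffAt (hU.mem_nhds hy)).differentiableAt (by simp)) w
  have hc : Continuous fun s : ℝ => (s, y) := by fun_prop
  have h2 : (fun s => pullback 𝓘(ℝ, X) (fun y => G (s, y)) α y w) =ᶠ[nhds t]
      fun s => pullback 𝓘(ℝ, ℝ × X) G α (s, y) fun i => ((0, w i) : ℝ × X) := by
    filter_upwards [hc.continuousAt.preimage_mem_nhds (hU.mem_nhds hy)] with s hs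
    exact (pullback_apply_inr (hmd hs) w).symm
  refine (h1.congr_of_eventuallyEq h2).congr_deriv ?_
  rw [extDeriv_pullback_eq hα hU hG hy]
  exact pullback_apply_vecCons (hmd hy) w

end Variation

/-! ### Noether's identity -/

section Invariance

variable {E : Type*} [NormedAddCommGroup E] [NormedSpace ℝ E] [FiniteDimensional ℝ E]
  {H : Type*} [TopologicalSpace H] {I : ModelWithCorners ℝ E H} [I.Boundaryless]
  {N : Type*} [TopologicalSpace N] [ChartedSpace H N] [IsManifold I ∞ N]
  {E' : Type*} [NormedAddCommGroup E'] [NormedSpace ℝ E']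
  {H' : Type*} [TopologicalSpace H'] {I' : ModelWithCorners ℝ E' H'} [I'.Boundaryless]
  {Z : Type*} [TopologicalSpace Z] [ChartedSpace H' Z] [IsManifold I' ∞ Z] {k : ℕ}

/-- Noether's identity: if the flow of `v` preserves `θ`, then `d (σ^* i_v θ) = - σ^* i_v dθ`. -/
theorem noether_identity {θ : DiffForm I' Z (k + 1)} (hθ : IsSmoothForm θ) {v : VField I' Z}
    {φ : ℝ → Z → Z} (hφ : ContMDiff (𝓘(ℝ, ℝ).prod I') I' ∞ fun p : ℝ × Z => φ p.1 p.2)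
    (hinv : ∀ t, pullback I' (φ t) θ = θ) (h0 : ∀ z, φ 0 z = z)
    (hv : ∀ z, (mfderiv 𝓘(ℝ, ℝ) I' (fun t => φ t z) 0 (1 : ℝ) : E') = v z)
    {σ : N → Z} (hσ : ContMDiff I I' ∞ σ) :
    IsSmoothForm (pullback I σ (interior v θ)) ∧
      extD (pullback I σ (interior v θ)) = - pullback I σ (interior v (extD θ)) := by
  -- In a chart of `N`, contracting with `v` along `σ` is contracting with the velocity at time `0`
  -- of the family `φ_t ∘ σ`. This holds for `θ` and for `dθ` alike, whence the general degree.
  have hcon : ∀ (j : ℕ) (η : DiffForm I' Z (j + 1)) (p : N), ∀ y ∈ (extChartAt I p).target,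
      inChart (pullback I σ (interior v η)) p y =
        contraction (fun w : ℝ × E => φ w.1 (σ ((extChartAt I p).symm w.2))) η 0 y := by
    intro j η p y hy
    rw [inChart_pullback hσ hy]
    have e : (σ ∘ (extChartAt I p).symm) = fun y => φ 0 (σ ((extChartAt I p).symm y)) := by
      funext y; exact (h0 _).symm
    have hv' := hv (σ ((extChartAt I p).symm y))
    have hη : ∀ z z' : Z, z = z' → (η z : E' [⋀^Fin (j + 1)]→L[ℝ] ℝ) = η z' := by
      rintro z _ rfl; rfl
    ext w
    simp only [contraction, pullback, interior]
    change (η (σ ((extChartAt I p).symm y)) : E' [⋀^Fin (j + 1)]→L[ℝ] ℝ) _ =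
      (η (φ 0 (σ ((extChartAt I p).symm y))) : E' [⋀^Fin (j + 1)]→L[ℝ] ℝ) _
    rw [hη _ _ (h0 (σ ((extChartAt I p).symm y)))]
    congr 1
    funext i
    refine Fin.cases ?_ (fun i => ?_) i
    · exact hv'.symm
    · change (mfderiv 𝓘(ℝ, E) I' (σ ∘ (extChartAt I p).symm) y : E →L[ℝ] E') (w i) = _
      rw [e]
      rfl
  have hG : ∀ p : N, ContMDiffOn 𝓘(ℝ, ℝ × E) I' ∞
      (fun w : ℝ × E => φ w.1 (σ ((extChartAt I p).symm w.2)))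
        (Set.univ ×ˢ (extChartAt I p).target) := fun p => by
    have h1 : ContMDiffOn 𝓘(ℝ, ℝ × E) I ∞ (fun w : ℝ × E => (extChartAt I p).symm w.2)
        (Set.univ ×ˢ (extChartAt I p).target) :=
      (contMDiffOn_extChartAt_symm p).comp contDiff_snd.contMDiff.contMDiffOn fun w hw => hw.2
    have h2 : ContMDiffOn 𝓘(ℝ, ℝ × E) (𝓘(ℝ, ℝ).prod I') ∞
        (fun w : ℝ × E => (w.1, σ ((extChartAt I p).symm w.2)))
        (Set.univ ×ˢ (extChartAt I p).target) :=
      contDiff_fst.contMDiff.contMDiffOn.prodMk (hσ.comp_contMDiffOn h1)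
    exact hφ.comp_contMDiffOn h2
  have hU : ∀ p : N, IsOpen ((Set.univ : Set ℝ) ×ˢ (extChartAt I p).target) := fun p =>
    isOpen_univ.prod (isOpen_extChartAt_target p)
  have hs : IsSmoothForm (pullback I σ (interior v θ)) := fun p =>
    ((contDiffOn_contraction hθ (hU p) (hG p) 0).mono fun y hy => ⟨trivial, hy⟩).congr
      fun y hy => hcon k θ p y hy
  refine ⟨hs, ?_⟩
  funext x
  set G : ℝ × E → Z := fun w => φ w.1 (σ ((extChartAt I x).symm w.2)) with hGdef
  have hx := mem_extChartAt_target (I := I) x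
  have ho := isOpen_extChartAt_target (I := I) x
  have h1 : extDeriv (inChart (pullback I σ (interior v θ)) x) (extChartAt I x x) =
      extDeriv (contraction G θ 0) (extChartAt I x x) :=
    Filter.EventuallyEq.extDeriv_eq (Filter.eventually_of_mem (ho.mem_nhds hx) (hcon k θ x))
  have h2 : contraction G (extD θ) 0 (extChartAt I x x) =
      pullback I σ (interior v (extD θ)) x := by
    rw [← hcon (k + 1) (extD θ) x _ hx]
    have e1 := mfderiv_extChartAt_symm_self (I := I) x
    have e2 : ∀ z z' : N, z = z' → (pullback I σ (interior v (extD θ)) z :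
        E [⋀^Fin (k + 1)]→L[ℝ] ℝ) = pullback I σ (interior v (extD θ)) z' := by
      rintro z _ rfl; rfl
    change (pullback I σ (interior v (extD θ)) ((extChartAt I x).symm (extChartAt I x x)) :
      E [⋀^Fin (k + 1)]→L[ℝ] ℝ).compContinuousLinearMap (mfderiv 𝓘(ℝ, E) I
        (extChartAt I x).symm (extChartAt I x x) : E →L[ℝ] E) = _
    rw [e1, e2 _ _ (extChartAt_to_inv x)]
    rfl
  rw [extD_apply_eq, h1, Pi.neg_apply, ← h2]
  refine ContinuousAlternatingMap.ext fun w => ?_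
  have h3 := hasDerivAt_pullback_slice hθ (hU x) (hG x) (t := 0) (y := extChartAt I x x)
    ⟨trivial, hx⟩ w
  -- By invariance the pullback of `θ` along `φ_s ∘ σ` does not depend on `s`, so its first
  -- variation vanishes.
  have h4 : ∀ s, pullback 𝓘(ℝ, E) (fun y => G (s, y)) θ (extChartAt I x x) w =
      pullback 𝓘(ℝ, E) (σ ∘ (extChartAt I x).symm) θ (extChartAt I x x) w := by
    intro s
    have hφs : ContMDiff I' I' ∞ (φ s) :=
      hφ.comp (contMDiff_const.prodMk contMDiff_id : ContMDiff I' (𝓘(ℝ, ℝ).prod I') ∞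
        fun z => (s, z))
    have h5 := pullback_pullback_apply (f := σ ∘ (extChartAt I x).symm) (g := φ s) θ
      (x := extChartAt I x x) (I := 𝓘(ℝ, E)) (I' := I')
      (hφs.mdifferentiable (by simp) _) ((hσ.contMDiffAt.comp _
        (contMDiffAt_extChartAt_symm hx)).mdifferentiableAt (by simp))
    rw [hinv] at h5
    exact (DFunLike.congr_fun h5 w).symm
  have h6 := h3.unique ((hasDerivAt_const (0 : ℝ) (pullback 𝓘(ℝ, E) (σ ∘ (extChartAt I x).symm) θ
    (extChartAt I x x) w)).congr_of_eventuallyEq (Filter.Eventually.of_forall h4))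
  exact (neg_eq_of_add_eq_zero_right h6).symm

end Invariance

section Interior

variable {E : Type*} [NormedAddCommGroup E] [NormedSpace ℝ E]
  {H : Type*} [TopologicalSpace H] {I : ModelWithCorners ℝ E H}
  {N : Type*} [TopologicalSpace N] [ChartedSpace H N]
  {E' : Type*} [NormedAddCommGroup E'] [NormedSpace ℝ E']
  {H' : Type*} [TopologicalSpace H'] {I' : ModelWithCorners ℝ E' H'}
  {N' : Type*} [TopologicalSpace N'] [ChartedSpace H' N'] {k : ℕ}

theorem pullback_interior_add (f : N → N') (v w : VField I' N') (α : DiffForm I' N' (k + 1)) :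
    pullback I f (interior (v + w) α) =
      pullback I f (interior v α) + pullback I f (interior w α) := by
  funext x
  ext u
  exact DFunLike.congr_fun (map_add (ContinuousAlternatingMap.curryLeft (E := E') (α (f x)))
    (v (f x)) (w (f x))) fun i => mfderiv I I' f x (u i)

theorem pullback_interior_smul (f : N → N') (c : ℝ) (v : VField I' N')
    (α : DiffForm I' N' (k + 1)) :
    pullback I f (interior (c • v) α) = c • pullback I f (interior v α) := by
  funext x
  ext u
  exact DFunLike.congr_fun (map_smul (ContinuousAlternatingMap.curryLeft (E := E') (α (f x)))
    c (v (f x))) fun i => mfderiv I I' f x (u i)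

theorem pullback_interior_zero (f : N → N') (α : DiffForm I' N' (k + 1)) :
    pullback I f (interior (0 : VField I' N') α) = 0 := by
  funext x
  ext u
  exact DFunLike.congr_fun (map_zero (ContinuousAlternatingMap.curryLeft (E := E') (α (f x))))
    fun i => mfderiv I I' f x (u i)

end Interior

section Phase

variable {m : ℕ} {M : Type*} [TopologicalSpace M]
  [ChartedSpace (EuclideanSpace ℝ (Fin (m + 1))) M] [IsManifold (𝓡 (m + 1)) ∞ M]
  {ι : Type*} [Fintype ι] {q : ι → ℕ} {Φ : TopologicalSpace.Opens (PhaseTotal (m := m) M q)}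
  {H : Hamiltonian (m := m) M q} {G : Subgroup (Equiv.Perm Φ)}

/-- Noether's identity for the Lie algebra of a symmetry group. -/
theorem noether_identity_lieAlg (hH : IsSmoothForm (horizontalForm H Φ))
    (hG : IsSymmetryGroup Φ H G) (σ : PhaseSection Φ) {v : VField (phaseModel m q) Φ}
    (hv : v ∈ lieAlg Φ G) :
    IsSmoothForm (pullback (𝓡 (m + 1)) σ.map (noetherCurrent Φ H v)) ∧
      extD (pullback (𝓡 (m + 1)) σ.map (noetherCurrent Φ H v)) =
        -pullback (𝓡 (m + 1)) σ.map (interior v (extD (cartanPoincare Φ H))) := by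
  -- The claim is linear in `v`. Smoothness is carried along because additivity of `extD` requires
  -- it.
  induction hv using Submodule.span_induction with
  | mem v hv =>
    obtain ⟨-, φ, hφG, hφadd, hφ, hint⟩ := hv
    have h0 : φ 0 = 1 := by
      have := hφadd 0 0
      rw [add_zero] at this
      exact (mul_eq_left.1 this.symm)
    refine noether_identity (φ := fun t z => φ t z) (isSmoothForm_cartanPoincare hH) hφ ?_ ?_ ?_
      σ.smooth
    · intro t
      -- Invariance is stated for pullback along inverses, and `φ t` is the inverse of `φ (-t)`.
      have h1 := (hG (φ (-t)) (hφG _)).2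
      have h2 : (φ (-t)).symm = φ t := by
        change (φ (-t))⁻¹ = φ t
        rw [inv_eq_iff_mul_eq_one, ← hφadd, neg_add_cancel, h0]
      rwa [h2] at h1
    · intro z; rw [h0]; rfl
    · intro z
      have h1 := (hint z 0).mfderiv
      have h2 : ∀ z z' : Φ, z = z' → (v z : EuclideanSpace ℝ (Fin (m + 1)) ×
        FormFibre (EuclideanSpace ℝ (Fin (m + 1))) (phaseDeg m q)) = v z' := by
        rintro z _ rfl; rfl
      have h3 := DFunLike.congr_fun h1 (1 : ℝ)
      refine h3.trans ?_
      refine (one_smul ℝ _).trans ?_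
      refine h2 _ _ ?_
      change φ 0 z = z
      rw [h0]; rfl
  | zero =>
    rw [noetherCurrent, pullback_interior_zero, pullback_interior_zero]
    refine ⟨isSmoothForm_zero, ?_⟩
    simpa using extD_const_smul (0 : ℝ) (0 : DiffForm (𝓡 (m + 1)) M m)
  | add v w _ _ hv hw =>
    rw [noetherCurrent, pullback_interior_add, pullback_interior_add]
    refine ⟨hv.1.add hw.1, ?_⟩
    refine (extD_add hv.1 hw.1).trans ?_
    rw [hv.2, hw.2, neg_add]
  | smul c v _ hv =>
    rw [noetherCurrent, pullback_interior_smul, pullback_interior_smul]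
    refine ⟨hv.1.const_smul c, ?_⟩
    refine (extD_const_smul c _).trans ?_
    refine (congrArg (c • ·) hv.2).trans ?_
    exact smul_neg _ _

end Phase

/-! ### Variations of a section that are constant in a bundle chart -/

section Variation

variable {E : Type*} [NormedAddCommGroup E] [NormedSpace ℝ E] [FiniteDimensional ℝ E]
  {M : Type*} [TopologicalSpace M] [ChartedSpace E M] [IsManifold 𝓘(ℝ, E) ∞ M]
  {J : Type*} [Fintype J] {r : J → ℕ} {Φ : TopologicalSpace.Opens (FormBundle E M r)}

/-- A section in the bundle chart around `σ x`. -/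
noncomputable def sectionInChart (σ : M → Φ) (x : M) (y : E) : E × FormFibre E r :=
  extChartAt (bundleModel E r) (σ x) (σ ((extChartAt 𝓘(ℝ, E) x).symm y))

/-- The section `σ + t δ`, in charts around `x` and `σ x`. -/
noncomputable def sectionVariation (σ : M → Φ) (x : M) (δ : FormFibre E r) (w : ℝ × E) : Φ :=
  (extChartAt (bundleModel E r) (σ x)).symm (sectionInChart σ x w.2 + w.1 • ((0 : E), δ))

/-- The domain of `sectionVariation`. -/
def variationDomain (σ : M → Φ) (x : M) (δ : FormFibre E r) : Set (ℝ × E) :=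
  {w | w.2 ∈ (extChartAt 𝓘(ℝ, E) x).target ∧
    sectionInChart σ x w.2 + w.1 • ((0 : E), δ) ∈ (extChartAt (bundleModel E r) (σ x)).target}

variable {σ : M → Φ} (hσ : ContMDiff 𝓘(ℝ, E) (bundleModel E r) ∞ σ) (hp : ∀ x, proj Φ (σ x) = x)
  {x : M} {δ : FormFibre E r}

include hp in
theorem section_mem_source {y : E} (hy : y ∈ (extChartAt 𝓘(ℝ, E) x).target) :
    σ ((extChartAt 𝓘(ℝ, E) x).symm y) ∈ (extChartAt (bundleModel E r) (σ x)).source := by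
  rw [mem_extChartAt_opens_source]
  have h1 := hp x
  have h2 := hp ((extChartAt 𝓘(ℝ, E) x).symm y)
  simp only [proj] at h1 h2
  rw [h1, h2]
  exact PartialEquiv.map_target _ hy

include hp in
theorem sectionInChart_fst {y : E} (hy : y ∈ (extChartAt 𝓘(ℝ, E) x).target) :
    (sectionInChart σ x y).1 = y := by
  rw [sectionInChart, extChartAt_opens_apply, extChartAt_bundle_apply]
  have h1 := hp x
  have h2 := hp ((extChartAt 𝓘(ℝ, E) x).symm y)
  simp only [proj] at h1 h2
  rw [h1, h2]
  exact (extChartAt 𝓘(ℝ, E) x).right_inv hy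

include hσ hp in
theorem contDiffOn_sectionInChart :
    ContDiffOn ℝ ∞ (sectionInChart σ x) (extChartAt 𝓘(ℝ, E) x).target := by
  intro y hy
  refine ContDiffAt.contDiffWithinAt ?_
  exact contDiffAt_extChartAt_comp (I := bundleModel E r)
    (G := fun y => σ ((extChartAt 𝓘(ℝ, E) x).symm y))
    (hσ.contMDiffAt.comp y (contMDiffAt_extChartAt_symm hy)) (section_mem_source hp hy)

include hσ hp in
theorem contDiffOn_sectionInChart_add :
    ContDiffOn ℝ ∞ (fun w : ℝ × E => sectionInChart σ x w.2 + w.1 • ((0 : E), δ))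
      (Set.univ ×ˢ (extChartAt 𝓘(ℝ, E) x).target) := by
  have h1 := (contDiffOn_sectionInChart hσ hp (x := x)).comp
    (contDiff_snd (𝕜 := ℝ) (E := ℝ) (F := E)).contDiffOn
    (s := Set.univ ×ˢ (extChartAt 𝓘(ℝ, E) x).target) fun w hw => hw.2
  exact h1.add (contDiff_fst.smul contDiff_const).contDiffOn

include hσ hp in
theorem isOpen_variationDomain : IsOpen (variationDomain σ x δ) := by
  have h := (contDiffOn_sectionInChart_add hσ hp (x := x) (δ := δ)).continuousOn.isOpen_inter_preimage
    (isOpen_univ.prod (isOpen_extChartAt_target x))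
    (isOpen_extChartAt_target (I := bundleModel E r) (σ x))
  have e : variationDomain σ x δ = (Set.univ ×ˢ (extChartAt 𝓘(ℝ, E) x).target) ∩
      (fun w : ℝ × E => sectionInChart σ x w.2 + w.1 • ((0 : E), δ)) ⁻¹'
        (extChartAt (bundleModel E r) (σ x)).target := by
    ext w
    exact ⟨fun h => ⟨⟨trivial, h.1⟩, h.2⟩, fun h => ⟨h.1.2, h.2⟩⟩
  rw [e]
  exact h

include hp in
theorem zero_mem_variationDomain {y : E} (hy : y ∈ (extChartAt 𝓘(ℝ, E) x).target) :
    ((0 : ℝ), y) ∈ variationDomain σ x δ := by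
  refine ⟨hy, ?_⟩
  simp only [zero_smul, add_zero]
  exact PartialEquiv.map_source _ (section_mem_source hp hy)

include hσ hp in
theorem contMDiffOn_sectionVariation :
    ContMDiffOn 𝓘(ℝ, ℝ × E) (bundleModel E r) ∞ (sectionVariation σ x δ)
      (variationDomain σ x δ) := by
  refine (contMDiffOn_extChartAt_symm (I := bundleModel E r) (σ x)).comp
    ((contDiffOn_sectionInChart_add hσ hp (x := x) (δ := δ)).contMDiffOn.mono ?_) ?_
  · exact fun w hw => ⟨trivial, hw.1⟩
  · exact fun w hw => hw.2

theorem extChartAt_sectionVariation {w : ℝ × E} (hw : w ∈ variationDomain σ x δ) :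
    extChartAt (bundleModel E r) (σ x) (sectionVariation σ x δ w) =
      sectionInChart σ x w.2 + w.1 • ((0 : E), δ) :=
  PartialEquiv.right_inv _ hw.2

include hp in
theorem proj_sectionVariation {w : ℝ × E} (hw : w ∈ variationDomain σ x δ) :
    proj Φ (sectionVariation σ x δ w) = (extChartAt 𝓘(ℝ, E) x).symm w.2 := by
  rw [sectionVariation, proj_comp_extChartAt_symm hw.2, hp x]
  congr 1
  simp [sectionInChart_fst hp hw.1]

include hp in
theorem sectionVariation_zero {y : E} (hy : y ∈ (extChartAt 𝓘(ℝ, E) x).target) :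
    sectionVariation σ x δ (0, y) = σ ((extChartAt 𝓘(ℝ, E) x).symm y) := by
  simp only [sectionVariation, zero_smul, add_zero]
  exact PartialEquiv.left_inv _ (section_mem_source hp hy)

include hσ hp in
theorem pullback_sectionVariation_horizontalForm {n : ℕ} (F : HorForm E M r n) {w : ℝ × E}
    (hw : w ∈ variationDomain σ x δ) :
    pullback 𝓘(ℝ, ℝ × E) (sectionVariation σ x δ) (horizontalForm F Φ) w =
      ((F (sectionVariation σ x δ w).1 : E [⋀^Fin n]→L[ℝ] ℝ).compContinuousLinearMap
        (mfderiv 𝓘(ℝ, E) 𝓘(ℝ, E) (extChartAt 𝓘(ℝ, E) x).symm w.2 :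
          E →L[ℝ] E)).compContinuousLinearMap (ContinuousLinearMap.snd ℝ ℝ E) := by
  have hU := isOpen_variationDomain hσ hp (x := x) (δ := δ)
  have h1 := mfderiv_comp w (contMDiff_proj_opens.mdifferentiable (by simp) _)
    (((contMDiffOn_sectionVariation hσ hp).contMDiffAt (hU.mem_nhds hw)).mdifferentiableAt
      (by simp))
  have h2 : proj Φ ∘ sectionVariation σ x δ =ᶠ[nhds w]
      (extChartAt 𝓘(ℝ, E) x).symm ∘ Prod.snd := by
    filter_upwards [hU.mem_nhds hw] with w' hw'
    exact proj_sectionVariation hp hw'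
  have h3 : HasMFDerivAt 𝓘(ℝ, ℝ × E) 𝓘(ℝ, E) (Prod.snd : ℝ × E → E) w
      (ContinuousLinearMap.snd ℝ ℝ E) :=
    (ContinuousLinearMap.snd ℝ ℝ E).hasFDerivAt.hasMFDerivAt
  have h4 := ((contMDiffAt_extChartAt_symm (I := 𝓘(ℝ, E)) hw.1).mdifferentiableAt
    (n := ∞) (by simp)).hasMFDerivAt
  have h5 := h1.symm.trans (h2.mfderiv_eq.trans (h4.comp w h3).mfderiv)
  exact congrArg (fun L : ℝ × E →L[ℝ] E =>
    (F (sectionVariation σ x δ w).1 : E [⋀^Fin n]→L[ℝ] ℝ).compContinuousLinearMap L) h5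

include hσ hp in
-- Because the variation covers the identity of `M` and `δ` is constant in the chart, the
-- pulled-back coordinate is affine in `t` and has no `dt` component.
theorem pullback_sectionVariation_tautForm (j : J) {w : ℝ × E}
    (hw : w ∈ variationDomain σ x δ) :
    pullback 𝓘(ℝ, ℝ × E) (sectionVariation σ x δ) (tautForm Φ j) w =
      ((sectionInChart σ x w.2).2 j + w.1 • δ j).compContinuousLinearMap
        (ContinuousLinearMap.snd ℝ ℝ E) := by
  refine (pullback_sectionVariation_horizontalForm hσ hp (fun z => component z.2 j) hw).trans ?_
  congr 1
  have h1 : proj Φ (sectionVariation σ x δ w) ∈ (extChartAt 𝓘(ℝ, E) (proj Φ (σ x))).source := by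
    rw [proj_sectionVariation hp hw, hp x]
    exact PartialEquiv.map_target _ hw.1
  have h2 := extChartAt_bundle_snd (z := (σ x).1) (z' := (sectionVariation σ x δ w).1) j h1
  have h3 : (σ x).1.proj = x := hp x
  have h4 : (sectionVariation σ x δ w).1.proj = (extChartAt 𝓘(ℝ, E) x).symm w.2 :=
    proj_sectionVariation hp hw
  rw [← extChartAt_opens_apply, extChartAt_sectionVariation hw, h3, h4,
    PartialEquiv.right_inv _ hw.1] at h2
  exact h2.symm

end Variation

/-! ### Contraction of tautological and Cartan-Poincaré forms with a vertical variation -/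

section Horizontal

variable {X : Type*} [NormedAddCommGroup X] [NormedSpace ℝ X] [FiniteDimensional ℝ X]
  {E : Type*} [NormedAddCommGroup E] [NormedSpace ℝ E]
  {H : Type*} [TopologicalSpace H] {I : ModelWithCorners ℝ E H} [I.Boundaryless]
  {N : Type*} [TopologicalSpace N] [ChartedSpace H N] [IsManifold I ∞ N]
  {G : ℝ × X → N} {U : Set (ℝ × X)}

omit [FiniteDimensional ℝ X] [I.Boundaryless] [IsManifold I ∞ N] in
theorem contraction_of_horizontal {k : ℕ} {α : DiffForm I N (k + 1)} {t : ℝ} {y : X}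
    (hG : MDifferentiableAt 𝓘(ℝ, ℝ × X) I G (t, y)) {b : X [⋀^Fin (k + 1)]→L[ℝ] ℝ}
    (hb : pullback 𝓘(ℝ, ℝ × X) G α (t, y) =
      b.compContinuousLinearMap (ContinuousLinearMap.snd ℝ ℝ X)) :
    contraction G α t y = 0 := by
  rw [contraction_eq hG, hb]
  ext w
  exact b.map_coord_zero 0 rfl

/-- Without a `dt` component the contraction of `α` vanishes identically, so Cartan's formula leaves
only the derivative in `t`. Applied to `y^A`, this says that contracting `dy^A` with the variation
gives `δy^A`. -/
theorem contraction_extD_of_horizontal {n : ℕ} {α : DiffForm I N n} (hα : IsSmoothForm α)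
    (hU : IsOpen U) (hG : ContMDiffOn 𝓘(ℝ, ℝ × X) I ∞ G U) {b : X → X [⋀^Fin n]→L[ℝ] ℝ}
    {d : X [⋀^Fin n]→L[ℝ] ℝ}
    (hb : ∀ w ∈ U, pullback 𝓘(ℝ, ℝ × X) G α w =
      (b w.2 + w.1 • d).compContinuousLinearMap (ContinuousLinearMap.snd ℝ ℝ X))
    {t : ℝ} {y : X} (hy : (t, y) ∈ U) : contraction G (extD α) t y = d := by
  have hmd : ∀ {p}, p ∈ U → MDifferentiableAt 𝓘(ℝ, ℝ × X) I G p := fun hp =>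
    (hG.contMDiffAt (hU.mem_nhds hp)).mdifferentiableAt (by simp)
  have hc : Continuous fun s : ℝ => (s, y) := by fun_prop
  have hc' : Continuous fun y : X => (t, y) := by fun_prop
  refine ContinuousAlternatingMap.ext fun w => ?_
  have h1 : HasDerivAt (fun s => pullback 𝓘(ℝ, X) (fun y => G (s, y)) α y w) (d w) t := by
    have h2 : (fun s => pullback 𝓘(ℝ, X) (fun y => G (s, y)) α y w) =ᶠ[nhds t]
        fun s => b y w + s * d w := by
      filter_upwards [hc.continuousAt.preimage_mem_nhds (hU.mem_nhds hy)] with s hs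
      exact (pullback_apply_inr (hmd hs) w).symm.trans (DFunLike.congr_fun (hb _ hs) _)
    refine HasDerivAt.congr_of_eventuallyEq ?_ h2
    simpa using ((hasDerivAt_id t).mul_const (d w)).const_add (b y w)
  cases n with
  | zero => exact (hasDerivAt_pullback_slice_zero hα hU hG hy w).unique h1
  | succ k =>
    have h2 : contraction G α t =ᶠ[nhds y] fun _ => 0 := by
      filter_upwards [hc'.continuousAt.preimage_mem_nhds (hU.mem_nhds hy)] with z hz
      exact contraction_of_horizontal (hmd hz) (hb _ hz)
    have h3 := (hasDerivAt_pullback_slice hα hU hG hy w).unique h1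
    rw [h2.extDeriv_eq] at h3
    rw [← h3]
    simp [extDeriv, ContinuousAlternatingMap.alternatizeUncurryFin_apply]

end Horizontal

section Phase

variable {m : ℕ} {M : Type*} [TopologicalSpace M]
  [ChartedSpace (EuclideanSpace ℝ (Fin (m + 1))) M] [IsManifold (𝓡 (m + 1)) ∞ M]
  {ι : Type*} [Fintype ι] {q : ι → ℕ} {Φ : TopologicalSpace.Opens (PhaseTotal (m := m) M q)}
  {H : Hamiltonian (m := m) M q}

local notation "𝔼" => EuclideanSpace ℝ (Fin (m + 1))

theorem PhaseSection.proj_map (σ : PhaseSection Φ) (x : M) : proj Φ (σ.map x) = x := rfl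

theorem PhaseSection.contMDiff_map (σ : PhaseSection Φ) :
    ContMDiff 𝓘(ℝ, 𝔼) (bundleModel 𝔼 (phaseDeg m q)) ∞ σ.map := σ.smooth

theorem inChart_coord (σ : PhaseSection Φ) (j : PhaseIndex m q) (x : M) {y : 𝔼}
    (hy : y ∈ (extChartAt 𝓘(ℝ, 𝔼) x).target) :
    inChart (I := 𝓘(ℝ, 𝔼)) (σ.coord j) x y = (sectionInChart σ.map x y).2 j := by
  have h := extChartAt_bundle_snd (z := (σ.map x).1)
    (z' := (σ.map ((extChartAt 𝓘(ℝ, 𝔼) x).symm y)).1) j (PartialEquiv.map_target _ hy)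
  refine Eq.trans ?_ h.symm
  have e : extChartAt 𝓘(ℝ, 𝔼) x ((extChartAt 𝓘(ℝ, 𝔼) x).symm y) = y :=
    (extChartAt 𝓘(ℝ, 𝔼) x).right_inv hy
  change _ = (component (σ.map ((extChartAt 𝓘(ℝ, 𝔼) x).symm y)).1.2 j :
    𝔼 [⋀^Fin (phaseDeg m q j)]→L[ℝ] ℝ).compContinuousLinearMap
      (mfderiv 𝓘(ℝ, 𝔼) 𝓘(ℝ, 𝔼) (extChartAt 𝓘(ℝ, 𝔼) x).symm
        (extChartAt 𝓘(ℝ, 𝔼) x ((extChartAt 𝓘(ℝ, 𝔼) x).symm y)) : 𝔼 →L[ℝ] 𝔼)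
  have e2 : ∀ y y' : 𝔼, y = y' → (mfderiv 𝓘(ℝ, 𝔼) 𝓘(ℝ, 𝔼) (extChartAt 𝓘(ℝ, 𝔼) x).symm y :
      𝔼 →L[ℝ] 𝔼) = mfderiv 𝓘(ℝ, 𝔼) 𝓘(ℝ, 𝔼) (extChartAt 𝓘(ℝ, 𝔼) x).symm y' := by
    rintro y _ rfl; rfl
  rw [e2 _ _ e]
  rfl

theorem contDiffOn_sectionInChart_component (σ : PhaseSection Φ) (j : PhaseIndex m q) (x : M) :
    ContDiffOn ℝ ∞ (fun y => (sectionInChart σ.map x y).2 j) (extChartAt 𝓘(ℝ, 𝔼) x).target :=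
  (((ContinuousLinearMap.proj (R := ℝ) (φ := fun j => 𝔼 [⋀^Fin (phaseDeg m q j)]→L[ℝ] ℝ) j).comp
      (ContinuousLinearMap.snd ℝ 𝔼 (FormFibre 𝔼 (phaseDeg m q)))).contDiff).comp_contDiffOn
    (contDiffOn_sectionInChart σ.contMDiff_map σ.proj_map)

theorem extD_coord (σ : PhaseSection Φ) (j : PhaseIndex m q) (x : M) :
    extD (σ.coord j) x = extDeriv (fun y => (sectionInChart σ.map x y).2 j)
      (extChartAt 𝓘(ℝ, 𝔼) x x) := by
  rw [extD_apply_eq]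
  exact Filter.EventuallyEq.extDeriv_eq (Filter.eventually_of_mem
    ((isOpen_extChartAt_target (I := 𝓘(ℝ, 𝔼)) x).mem_nhds (mem_extChartAt_target x))
      fun y hy => inChart_coord σ j x hy)

omit [Fintype ι] in
theorem phaseDeg_momentum_add_one (A : {A : ι // q A ≤ m}) :
    phaseDeg m q (Sum.inr A) + (phaseDeg m q (Sum.inl A.1) + 1) = m + 1 := by
  have := A.2
  simp only [phaseDeg, Sum.elim_inl, Sum.elim_inr]
  omega

theorem cartanPoincare_apply (z : Φ) (u : Fin (m + 1) → 𝔼 × FormFibre 𝔼 (phaseDeg m q)) :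
    (cartanPoincare Φ H z : (𝔼 × FormFibre 𝔼 (phaseDeg m q)) [⋀^Fin (m + 1)]→L[ℝ] ℝ) u =
      ∑ A : {A : ι // q A ≤ m}, (-1 : ℝ) ^ (m + 1 - q A.1) *
        (wedge (V := 𝔼 × FormFibre 𝔼 (phaseDeg m q)) (tautForm Φ (Sum.inr A) z)
          (extD (tautForm Φ (Sum.inl A.1)) z) (phaseDeg_momentum_add_one A) :
            (𝔼 × FormFibre 𝔼 (phaseDeg m q)) [⋀^Fin (m + 1)]→L[ℝ] ℝ) u +
      (horizontalForm H Φ z : (𝔼 × FormFibre 𝔼 (phaseDeg m q)) [⋀^Fin (m + 1)]→L[ℝ] ℝ) u := by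
  refine (ContinuousAlternatingMap.add_apply (M := 𝔼 × FormFibre 𝔼 (phaseDeg m q)) _ _ _).trans ?_
  refine congrArg₂ (· + ·) ?_ rfl
  exact ContinuousAlternatingMap.sum_apply (M := 𝔼 × FormFibre 𝔼 (phaseDeg m q)) _ _

theorem pullback_cartanPoincare_apply {X : Type*} [NormedAddCommGroup X] [NormedSpace ℝ X]
    (f : X → Φ) (w : X) (u : Fin (m + 1) → X) :
    (pullback 𝓘(ℝ, X) f (cartanPoincare Φ H) w : X [⋀^Fin (m + 1)]→L[ℝ] ℝ) u =
      ∑ A : {A : ι // q A ≤ m}, (-1 : ℝ) ^ (m + 1 - q A.1) *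
        (wedge (V := X) (pullback 𝓘(ℝ, X) f (tautForm Φ (Sum.inr A)) w)
          (pullback 𝓘(ℝ, X) f (extD (tautForm Φ (Sum.inl A.1))) w)
          (phaseDeg_momentum_add_one A) : X [⋀^Fin (m + 1)]→L[ℝ] ℝ) u +
      (pullback 𝓘(ℝ, X) f (horizontalForm H Φ) w : X [⋀^Fin (m + 1)]→L[ℝ] ℝ) u := by
  let L : X →L[ℝ] 𝔼 × FormFibre 𝔼 (phaseDeg m q) :=
    mfderiv 𝓘(ℝ, X) (phaseModel m q) f w
  refine (cartanPoincare_apply (f w) fun i => L (u i)).trans ?_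
  refine congrArg₂ (· + ·) ?_ rfl
  refine Finset.sum_congr rfl fun A _ => ?_
  refine congrArg (fun r : ℝ => (-1 : ℝ) ^ (m + 1 - q A.1) * r) ?_
  have h2 := wedge_compContinuousLinearMap (n := m + 1)
    (tautForm Φ (Sum.inr A) (f w) :
      (𝔼 × FormFibre 𝔼 (phaseDeg m q)) [⋀^Fin (phaseDeg m q (Sum.inr A))]→L[ℝ] ℝ)
    (extD (tautForm Φ (Sum.inl A.1)) (f w) :
      (𝔼 × FormFibre 𝔼 (phaseDeg m q)) [⋀^Fin (phaseDeg m q (Sum.inl A.1) + 1)]→L[ℝ] ℝ)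
    (phaseDeg_momentum_add_one A) L
  exact DFunLike.congr_fun h2 u

end Phase

section Vertical

variable {m : ℕ} {M : Type*} [TopologicalSpace M]
  [ChartedSpace (EuclideanSpace ℝ (Fin (m + 1))) M] [IsManifold (𝓡 (m + 1)) ∞ M]
  {ι : Type*} [Fintype ι] {q : ι → ℕ} {Φ : TopologicalSpace.Opens (PhaseTotal (m := m) M q)}
  {H : Hamiltonian (m := m) M q}

variable {σ : PhaseSection Φ} {x : M}
  {δ : FormFibre (EuclideanSpace ℝ (Fin (m + 1))) (phaseDeg m q)} {t : ℝ}
  {y : EuclideanSpace ℝ (Fin (m + 1))}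

local notation "𝔼" => EuclideanSpace ℝ (Fin (m + 1))

theorem contMDiffAt_sectionVariation_slice (hy : (t, y) ∈ variationDomain σ.map x δ) :
    MDifferentiableAt 𝓘(ℝ, ℝ × 𝔼) (phaseModel m q) (sectionVariation σ.map x δ) (t, y) :=
  ((contMDiffOn_sectionVariation σ.contMDiff_map σ.proj_map).contMDiffAt
    ((isOpen_variationDomain σ.contMDiff_map σ.proj_map).mem_nhds hy)).mdifferentiableAt (by simp)

theorem pullback_slice_tautForm (j : PhaseIndex m q) (hy : (t, y) ∈ variationDomain σ.map x δ) :
    (pullback 𝓘(ℝ, 𝔼) (fun y => sectionVariation σ.map x δ (t, y)) (tautForm Φ j) y :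
      𝔼 [⋀^Fin (phaseDeg m q j)]→L[ℝ] ℝ) = (sectionInChart σ.map x y).2 j + t • δ j := by
  refine ContinuousAlternatingMap.ext fun u => ?_
  refine (pullback_apply_inr (contMDiffAt_sectionVariation_slice hy) u).symm.trans ?_
  exact DFunLike.congr_fun
    (pullback_sectionVariation_tautForm σ.contMDiff_map σ.proj_map j hy) _

/-- The added term `t • δ j` is constant in `y`, so the exterior derivative does not see it. -/
theorem pullback_slice_extD_tautForm (j : PhaseIndex m q)
    (hy : (t, y) ∈ variationDomain σ.map x δ) :
    (pullback 𝓘(ℝ, 𝔼) (fun y => sectionVariation σ.map x δ (t, y)) (extD (tautForm Φ j)) y :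
      𝔼 [⋀^Fin (phaseDeg m q j + 1)]→L[ℝ] ℝ) =
      extDeriv (fun y => (sectionInChart σ.map x y).2 j) y := by
  have hc : Continuous fun y : 𝔼 => (t, y) := by fun_prop
  have ho := isOpen_variationDomain σ.contMDiff_map σ.proj_map (x := x) (δ := δ)
  have hU : IsOpen {y | (t, y) ∈ variationDomain σ.map x δ} := ho.preimage hc
  have hG : ContMDiffOn 𝓘(ℝ, 𝔼) (phaseModel m q) ∞ (fun y => sectionVariation σ.map x δ (t, y))
      {y | (t, y) ∈ variationDomain σ.map x δ} :=
    (contMDiffOn_sectionVariation σ.contMDiff_map σ.proj_map).comp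
      (contDiff_prodMk_right t).contMDiff.contMDiffOn fun y hy => hy
  rw [← extDeriv_pullback_eq (isSmoothForm_tautForm j) hU hG hy]
  have h1 : (pullback 𝓘(ℝ, 𝔼) (fun y => sectionVariation σ.map x δ (t, y)) (tautForm Φ j) :
      𝔼 → 𝔼 [⋀^Fin (phaseDeg m q j)]→L[ℝ] ℝ) =ᶠ[nhds y]
      fun y => (sectionInChart σ.map x y).2 j + t • δ j :=
    Filter.eventually_of_mem (hU.mem_nhds hy) fun z hz => pullback_slice_tautForm j hz
  rw [h1.extDeriv_eq, extDeriv, extDeriv, fderiv_add_const]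

/-- Both `p_A` and `H` are horizontal, so the vertical velocity meets only `dy^A` and turns it into
`δy^A`. Moving past `p_A` costs `(-1)^(n - q_A - 1)`, which with the factor `(-1)^(n - q_A)` in `θ`
gives `-1` for every field. -/
theorem contraction_cartanPoincare (hy : y ∈ (extChartAt 𝓘(ℝ, 𝔼) x).target) :
    contraction (sectionVariation σ.map x δ) (cartanPoincare Φ H) 0 y =
      -∑ A : {A : ι // q A ≤ m}, wedge ((sectionInChart σ.map x y).2 (Sum.inr A))
        (δ (Sum.inl A.1)) (Nat.succ.inj (phaseDeg_momentum_add_one A)) := by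
  have hy0 := zero_mem_variationDomain (δ := δ) σ.proj_map hy
  have hmd := contMDiffAt_sectionVariation_slice hy0
  refine ContinuousAlternatingMap.ext fun u => ?_
  rw [contraction_eq hmd]
  let b : 𝔼 [⋀^Fin (m + 1)]→L[ℝ] ℝ :=
    (H (sectionVariation σ.map x δ (0, y)).1 : 𝔼 [⋀^Fin (m + 1)]→L[ℝ] ℝ).compContinuousLinearMap
      (mfderiv 𝓘(ℝ, 𝔼) 𝓘(ℝ, 𝔼) (extChartAt 𝓘(ℝ, 𝔼) x).symm y : 𝔼 →L[ℝ] 𝔼)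
  have h2 : (pullback 𝓘(ℝ, ℝ × 𝔼) (sectionVariation σ.map x δ) (horizontalForm H Φ) (0, y) :
      (ℝ × 𝔼) [⋀^Fin (m + 1)]→L[ℝ] ℝ)
        (Matrix.vecCons ((1, 0) : ℝ × 𝔼) fun i => ((0, u i) : ℝ × 𝔼)) = 0 :=
    (DFunLike.congr_fun (pullback_sectionVariation_horizontalForm σ.contMDiff_map σ.proj_map H hy0)
      _).trans (b.map_coord_zero 0 rfl)
  rw [ContinuousAlternatingMap.neg_apply, ContinuousAlternatingMap.sum_apply,
    ← Finset.sum_neg_distrib]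
  refine (pullback_cartanPoincare_apply (H := H) (sectionVariation σ.map x δ) (0, y)
    (Matrix.vecCons ((1, 0) : ℝ × 𝔼) fun i => ((0, u i) : ℝ × 𝔼))).trans
      ((congrArg₂ (· + ·) (Finset.sum_congr rfl fun A _ => ?_) h2).trans (add_zero _))
  have h3 := curryLeft_wedge_comp (V := ℝ × 𝔼) ((sectionInChart σ.map x y).2 (Sum.inr A))
    (ContinuousLinearMap.snd ℝ ℝ 𝔼)
    (pullback 𝓘(ℝ, ℝ × 𝔼) (sectionVariation σ.map x δ) (extD (tautForm Φ (Sum.inl A.1))) (0, y))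
    (phaseDeg_momentum_add_one A) (u := ((1, 0) : ℝ × 𝔼)) rfl
  have h4 := contraction_extD_of_horizontal (isSmoothForm_tautForm (Φ := Φ) (Sum.inl A.1))
    (isOpen_variationDomain σ.contMDiff_map σ.proj_map)
    (contMDiffOn_sectionVariation σ.contMDiff_map σ.proj_map)
    (b := fun y => (sectionInChart σ.map x y).2 (Sum.inl A.1)) (d := δ (Sum.inl A.1))
    (fun w hw => pullback_sectionVariation_tautForm σ.contMDiff_map σ.proj_map _ hw) hy0
  rw [contraction_eq hmd] at h4
  have h5 := congrArg (fun a : (ℝ × 𝔼) [⋀^Fin m]→L[ℝ] ℝ =>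
    a.compContinuousLinearMap (ContinuousLinearMap.inr ℝ ℝ 𝔼)) h3
  have h6 : ((sectionInChart σ.map x y).2 (Sum.inr A)).compContinuousLinearMap
      ((ContinuousLinearMap.snd ℝ ℝ 𝔼).comp (ContinuousLinearMap.inr ℝ ℝ 𝔼)) =
      (sectionInChart σ.map x y).2 (Sum.inr A) := rfl
  have h7 := wedge_compContinuousLinearMap
    (((sectionInChart σ.map x y).2 (Sum.inr A)).compContinuousLinearMap
      (ContinuousLinearMap.snd ℝ ℝ 𝔼)) ((pullback 𝓘(ℝ, ℝ × 𝔼) (sectionVariation σ.map x δ)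
        (extD (tautForm Φ (Sum.inl A.1))) (0, y) :
          (ℝ × 𝔼) [⋀^Fin (phaseDeg m q (Sum.inl A.1) + 1)]→L[ℝ] ℝ).curryLeft (1, 0))
    (Nat.succ.inj (phaseDeg_momentum_add_one A)) (ContinuousLinearMap.inr ℝ ℝ 𝔼)
  rw [h4] at h7
  have h8 := (DFunLike.congr_fun h5 u).trans (congrArg
    (fun c : ℝ => (-1 : ℝ) ^ phaseDeg m q (Sum.inr A) * c) (DFunLike.congr_fun h7 u))
  have h9 : (-1 : ℝ) ^ (m + 1 - q A.1) * (-1 : ℝ) ^ phaseDeg m q (Sum.inr A) = -1 := by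
    have e : m + 1 - q A.1 = phaseDeg m q (Sum.inr A) + 1 := by
      have := A.2
      simp only [phaseDeg, Sum.elim_inr]; omega
    rw [e, ← pow_add]
    exact Odd.neg_one_pow ⟨phaseDeg m q (Sum.inr A), by omega⟩
  have h10 := pullback_sectionVariation_tautForm σ.contMDiff_map σ.proj_map (Sum.inr A) hy0
  simp only [zero_smul, add_zero] at h10
  refine (congrArg (fun a : (ℝ × 𝔼) [⋀^Fin (phaseDeg m q (Sum.inr A))]→L[ℝ] ℝ =>
    (-1 : ℝ) ^ (m + 1 - q A.1) * (wedge (V := ℝ × 𝔼) a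
      (pullback 𝓘(ℝ, ℝ × 𝔼) (sectionVariation σ.map x δ) (extD (tautForm Φ (Sum.inl A.1))) (0, y))
      (phaseDeg_momentum_add_one A) : (ℝ × 𝔼) [⋀^Fin (m + 1)]→L[ℝ] ℝ)
        (Matrix.vecCons ((1, 0) : ℝ × 𝔼) fun i => ((0, u i) : ℝ × 𝔼))) h10).trans ?_
  refine (congrArg (fun c : ℝ => (-1 : ℝ) ^ (m + 1 - q A.1) * c) h8).trans ?_
  rw [← mul_assoc, h9, neg_one_mul]
  rfl

end Vertical

section WedgeConst

variable {V : Type*} [NormedAddCommGroup V] [NormedSpace ℝ V] [FiniteDimensional ℝ V]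

/-- Needed for `d(p_A ∧ δy^A) = dp_A ∧ δy^A`, where `δy^A` is constant in the chart. -/
theorem extDeriv_neg_sum_wedge_const {A : Type*} [Fintype A] {k l : A → ℕ} {n : ℕ}
    {f : (a : A) → V → V [⋀^Fin (k a)]→L[ℝ] ℝ} (b : (a : A) → V [⋀^Fin (l a)]→L[ℝ] ℝ)
    (h : ∀ a, k a + l a = n) {y : V} (hf : ∀ a, DifferentiableAt ℝ (f a) y) :
    extDeriv (fun y => -∑ a, wedge (f a y) (b a) (h a)) y =
      -∑ a, wedge (extDeriv (f a) y) (b a) (by have := h a; omega) := by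
  let T : (a : A) → (V [⋀^Fin (k a)]→L[ℝ] ℝ) →L[ℝ] (V [⋀^Fin n]→L[ℝ] ℝ) := fun a =>
    LinearMap.toContinuousLinearMap ((wedgeLM (h a)).flip (b a))
  have h1 : HasFDerivAt (fun y => -∑ a, wedge (f a y) (b a) (h a))
      (-∑ a, (T a).comp (fderiv ℝ (f a) y)) y :=
    (HasFDerivAt.fun_sum fun a _ => (T a).hasFDerivAt.comp y (hf a).hasFDerivAt).neg
  rw [extDeriv, h1.fderiv]
  have h2 : ∀ L, ContinuousAlternatingMap.alternatizeUncurryFin L =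
    ContinuousAlternatingMap.alternatizeUncurryFinCLM (n := n) ℝ V ℝ L := fun _ => rfl
  rw [h2, map_neg, map_sum]
  refine congrArg Neg.neg (Finset.sum_congr rfl fun a _ => ?_)
  exact alternatizeUncurryFin_wedge (fderiv ℝ (f a) y) (b a) (h a) _ fun u => rfl

end WedgeConst

/-! ### Derivative of the Hamiltonian along a vertical variation -/

section Variation

variable {E : Type*} [NormedAddCommGroup E] [NormedSpace ℝ E] [FiniteDimensional ℝ E]
  {M : Type*} [TopologicalSpace M] [ChartedSpace E M] [IsManifold 𝓘(ℝ, E) ∞ M]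
  {J : Type*} [Fintype J] {r : J → ℕ} {Φ : TopologicalSpace.Opens (FormBundle E M r)}
  {σ : M → Φ} (hσ : ContMDiff 𝓘(ℝ, E) (bundleModel E r) ∞ σ) (hp : ∀ x, proj Φ (σ x) = x)
  {x : M} {δ : FormFibre E r}

theorem sectionInChart_self :
    sectionInChart σ x (extChartAt 𝓘(ℝ, E) x x) = extChartAt (bundleModel E r) (σ x) (σ x) := by
  rw [sectionInChart, extChartAt_to_inv]

theorem velocity_sectionVariation :
    (velocity (bundleModel E r) (sectionVariation σ x δ) 0 (extChartAt 𝓘(ℝ, E) x x) :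
      E × FormFibre E r) = (0, δ) := by
  set p := extChartAt (bundleModel E r) (σ x) (σ x)
  have h1 : HasMFDerivAt 𝓘(ℝ, ℝ) 𝓘(ℝ, E × FormFibre E r)
      (fun s : ℝ => p + s • ((0 : E), δ)) 0
      ((ContinuousLinearMap.id ℝ ℝ).smulRight ((0 : E), δ)) :=
    (((hasFDerivAt_id (𝕜 := ℝ) (0 : ℝ)).smul_const ((0 : E), δ)).const_add p).hasMFDerivAt
  have hz : p + (0 : ℝ) • ((0 : E), δ) = p := by simp
  have h2 := ((contMDiffAt_extChartAt_symm (I := bundleModel E r) (p := σ x) (y := p)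
    (mem_extChartAt_target _)).mdifferentiableAt (by simp)).hasMFDerivAt
  have h3 : ∀ p' : E × FormFibre E r, p' = p → HasMFDerivAt 𝓘(ℝ, E × FormFibre E r)
      (bundleModel E r) (extChartAt (bundleModel E r) (σ x)).symm p'
      (ContinuousLinearMap.id ℝ (E × FormFibre E r)) := by
    rintro _ rfl
    have h4 := mfderiv_extChartAt_symm_self (I := bundleModel E r) (σ x)
    exact h4 ▸ h2
  have h4 := (HasMFDerivAt.comp (0 : ℝ) (f := fun s : ℝ => p + s • ((0 : E), δ))
    (h3 _ hz) h1).mfderiv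
  have h5 : (fun s => sectionVariation σ x δ (s, extChartAt 𝓘(ℝ, E) x x)) =
      (extChartAt (bundleModel E r) (σ x)).symm ∘ fun s : ℝ => p + s • ((0 : E), δ) := by
    funext s
    rw [sectionVariation, sectionInChart_self]
    rfl
  have h6 : ∀ f g : ℝ → Φ, f = g → (mfderiv 𝓘(ℝ, ℝ) (bundleModel E r) f 0 :
      ℝ →L[ℝ] E × FormFibre E r) = mfderiv 𝓘(ℝ, ℝ) (bundleModel E r) g 0 := by
    rintro f _ rfl; rfl
  refine (DFunLike.congr_fun ((h6 _ _ h5).trans h4) (1 : ℝ)).trans ?_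
  exact one_smul ℝ ((0 : E), δ)

include hσ hp in
theorem mfderiv_sectionVariation_zero :
    (mfderiv 𝓘(ℝ, E) (bundleModel E r) (fun y => sectionVariation σ x δ (0, y))
      (extChartAt 𝓘(ℝ, E) x x) : E →L[ℝ] E × FormFibre E r) =
      mfderiv 𝓘(ℝ, E) (bundleModel E r) σ x := by
  have hx := mem_extChartAt_target (I := 𝓘(ℝ, E)) x
  have h1 : (fun y => sectionVariation σ x δ (0, y)) =ᶠ[nhds (extChartAt 𝓘(ℝ, E) x x)]
      σ ∘ (extChartAt 𝓘(ℝ, E) x).symm :=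
    Filter.eventually_of_mem ((isOpen_extChartAt_target x).mem_nhds hx)
      fun y hy => sectionVariation_zero hp hy
  have h2 := mfderiv_comp (extChartAt 𝓘(ℝ, E) x x) (hσ.mdifferentiable (by simp) _)
    ((contMDiffAt_extChartAt_symm hx).mdifferentiableAt (n := ∞) (by simp))
  have h3 : ∀ x', x' = x → (mfderiv 𝓘(ℝ, E) (bundleModel E r) σ x' :
      E →L[ℝ] E × FormFibre E r) = mfderiv 𝓘(ℝ, E) (bundleModel E r) σ x := by
    rintro _ rfl; rfl
  have h4 : (mfderiv 𝓘(ℝ, E) (bundleModel E r) (σ ∘ (extChartAt 𝓘(ℝ, E) x).symm)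
      (extChartAt 𝓘(ℝ, E) x x) : E →L[ℝ] E × FormFibre E r) =
      (mfderiv 𝓘(ℝ, E) (bundleModel E r) σ
        ((extChartAt 𝓘(ℝ, E) x).symm (extChartAt 𝓘(ℝ, E) x x)) : E →L[ℝ] E × FormFibre E r).comp
      (mfderiv 𝓘(ℝ, E) 𝓘(ℝ, E) (extChartAt 𝓘(ℝ, E) x).symm (extChartAt 𝓘(ℝ, E) x x) :
        E →L[ℝ] E) := h2
  refine Eq.trans h1.mfderiv_eq (h4.trans ?_)
  rw [mfderiv_extChartAt_symm_self, h3 _ (extChartAt_to_inv x)]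
  rfl

theorem totalSpace_eq_of_component {Z : FormBundle E M r}
    {f : FormFibre E r} (h1 : Z.proj = x)
    (h2 : ∀ j, (component Z.2 j : E [⋀^Fin (r j)]→L[ℝ] ℝ) = f j) : Z = ⟨x, f⟩ := by
  obtain ⟨p, g⟩ := Z
  obtain rfl : p = x := h1
  have : (g : FormFibre E r) = f := funext h2
  rw [← this]

include hp in
-- Over the centre `x` the bundle chart acts on the fibre as the identity. At this point the chart
-- variation is therefore the linear variation used in the simple derivatives of `H`.
theorem sectionVariation_val {s : ℝ}
    (hs : (s, extChartAt 𝓘(ℝ, E) x x) ∈ variationDomain σ x δ) {f : FormFibre E r}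
    (hf : ∀ j, (component (σ x).1.2 j : E [⋀^Fin (r j)]→L[ℝ] ℝ) = f j) :
    (sectionVariation σ x δ (s, extChartAt 𝓘(ℝ, E) x x)).1 = ⟨x, f + s • δ⟩ := by
  have hpr : (sectionVariation σ x δ (s, extChartAt 𝓘(ℝ, E) x x)).1.proj = x :=
    (proj_sectionVariation hp hs).trans (extChartAt_to_inv x)
  have h3 : (σ x).1.proj = x := hp x
  have key : ∀ Z : FormBundle E M r, Z.proj = x → ∀ j,
      (extChartAt (bundleModel E r) (σ x).1 Z).2 j =
        (component Z.2 j : E [⋀^Fin (r j)]→L[ℝ] ℝ) := by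
    intro Z hZ j
    have h1 := extChartAt_bundle_snd (z := (σ x).1) (z' := Z) j
      (by rw [hZ, h3]; exact mem_extChartAt_source x)
    rw [h3, hZ, mfderiv_extChartAt_symm_self] at h1
    exact h1
  refine totalSpace_eq_of_component hpr fun j => ?_
  rw [← key _ hpr j, ← extChartAt_opens_apply, extChartAt_sectionVariation hs, sectionInChart_self]
  change (extChartAt (bundleModel E r) (σ x).1 (σ x).1).2 j + s • δ j = _
  rw [key _ h3 j, hf]
  rfl

end Variation

section Vertical

variable {m : ℕ} {M : Type*} [TopologicalSpace M]
  [ChartedSpace (EuclideanSpace ℝ (Fin (m + 1))) M] [IsManifold (𝓡 (m + 1)) ∞ M]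
  {ι : Type*} [Fintype ι] {q : ι → ℕ} {Φ : TopologicalSpace.Opens (PhaseTotal (m := m) M q)}
  {H : Hamiltonian (m := m) M q}

local notation "𝔼" => EuclideanSpace ℝ (Fin (m + 1))

omit [Fintype ι] in
theorem phaseDeg_add_one_add (A : {A : ι // q A ≤ m}) :
    phaseDeg m q (Sum.inr A) + 1 + phaseDeg m q (Sum.inl A.1) = m + 1 := by
  have := phaseDeg_momentum_add_one (q := q) A
  omega

/-- The values of a section, in the typical fibre. -/
def PhaseSection.fibre (σ : PhaseSection Φ) (x : M) : FormFibre 𝔼 (phaseDeg m q) := σ.val x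

/-- The exterior derivative of a component of a section. -/
noncomputable def PhaseSection.coordD (σ : PhaseSection Φ) (j : PhaseIndex m q) (x : M) :
    𝔼 [⋀^Fin (phaseDeg m q j + 1)]→L[ℝ] ℝ := extD (σ.coord j) x

/-- The value of the linearised Hamilton equations on a variation `δ`. -/
noncomputable def hamiltonPairing (σ : PhaseSection Φ) (x : M) (δ : FormFibre 𝔼 (phaseDeg m q)) :
    𝔼 [⋀^Fin (m + 1)]→L[ℝ] ℝ :=
  ∑ A : {A : ι // q A ≤ m}, ((-1 : ℝ) ^ (m + 1 - q A.1) •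
    wedge (δ (Sum.inr A)) (σ.coordD (Sum.inl A.1) x) (phaseDeg_momentum_add_one A) +
    wedge (σ.coordD (Sum.inr A) x) (δ (Sum.inl A.1)) (phaseDeg_add_one_add A))

theorem sectionInChart_snd_self (σ : PhaseSection Φ) (x : M) (j : PhaseIndex m q) :
    (sectionInChart σ.map x (extChartAt 𝓘(ℝ, 𝔼) x x)).2 j = σ.coord j x := by
  have h := sectionVariation_val (σ := σ.map) σ.proj_map (x := x) (δ := 0) (s := 0)
    (zero_mem_variationDomain σ.proj_map (mem_extChartAt_target x)) (f := σ.val x) fun j => rfl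
  rw [sectionInChart_self]
  have h1 := extChartAt_bundle_snd (z := (σ.map x).1) (z' := (σ.map x).1) j
    (mem_extChartAt_source _)
  exact h1.trans (congrArg (fun L : 𝔼 →L[ℝ] 𝔼 =>
    (σ.coord j x : 𝔼 [⋀^Fin (phaseDeg m q j)]→L[ℝ] ℝ).compContinuousLinearMap L)
      (mfderiv_extChartAt_symm_self (I := 𝓘(ℝ, 𝔼)) x))

/-- The first variation of `θ` along `σ + s δ`, solved for the derivative of `H`. The variation of
`σ_s^* θ` is that of `H` plus `(-1)^(n - q_A) δp_A ∧ dy^A`, since `dy^A` stays fixed; the exact term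
of Cartan's formula is `-dp_A ∧ δy^A`. What remains is `dθ` on `δ` and on vectors tangent to the
section. -/
theorem hasDerivAt_hamiltonian (hH : IsSmoothForm (horizontalForm H Φ)) (σ : PhaseSection Φ)
    (x : M) (δ : FormFibre 𝔼 (phaseDeg m q)) (w : Fin (m + 1) → 𝔼) :
    HasDerivAt (fun s : ℝ => (H ⟨x, σ.fibre x + s • δ⟩ :
        𝔼 [⋀^Fin (m + 1)]→L[ℝ] ℝ) w)
      ((extD (cartanPoincare Φ H) (σ.map x) :
          (𝔼 × FormFibre 𝔼 (phaseDeg m q)) [⋀^Fin (m + 1 + 1)]→L[ℝ] ℝ)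
        (Matrix.vecCons ((0 : 𝔼), δ) fun i => (mfderiv 𝓘(ℝ, 𝔼) (phaseModel m q) σ.map x :
          𝔼 →L[ℝ] 𝔼 × FormFibre 𝔼 (phaseDeg m q)) (w i)) - hamiltonPairing σ x δ w) 0 := by
  set y₀ := extChartAt 𝓘(ℝ, 𝔼) x x with hy₀
  have hyt : y₀ ∈ (extChartAt 𝓘(ℝ, 𝔼) x).target := mem_extChartAt_target x
  have hU := isOpen_variationDomain σ.contMDiff_map σ.proj_map (x := x) (δ := δ)
  have hG := contMDiffOn_sectionVariation σ.contMDiff_map σ.proj_map (x := x) (δ := δ)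
  have hy := zero_mem_variationDomain (δ := δ) σ.proj_map hyt
  have hd := hasDerivAt_pullback_slice (isSmoothForm_cartanPoincare hH) hU hG hy w
  -- the contraction with `θ`
  have ho := isOpen_extChartAt_target (I := 𝓘(ℝ, 𝔼)) x
  have h1 : extDeriv (contraction (sectionVariation σ.map x δ) (cartanPoincare Φ H) 0) y₀ =
      -∑ A : {A : ι // q A ≤ m}, wedge (σ.coordD (Sum.inr A) x)
        (δ (Sum.inl A.1)) (phaseDeg_add_one_add A) := by
    rw [Filter.EventuallyEq.extDeriv_eq (Filter.eventually_of_mem (ho.mem_nhds hyt)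
      fun y hy => contraction_cartanPoincare (H := H) (δ := δ) hy)]
    rw [extDeriv_neg_sum_wedge_const (fun A : {A : ι // q A ≤ m} => δ (Sum.inl A.1))
      (fun A => Nat.succ.inj (phaseDeg_momentum_add_one A)) (f := fun A y =>
        (sectionInChart σ.map x y).2 (Sum.inr A)) fun A =>
      ((contDiffOn_sectionInChart_component σ (Sum.inr A) x).contDiffAt
        (ho.mem_nhds hyt)).differentiableAt (by simp)]
    refine congrArg Neg.neg (Finset.sum_congr rfl fun A _ => ?_)
    exact congrArg (fun a : 𝔼 [⋀^Fin (phaseDeg m q (Sum.inr A) + 1)]→L[ℝ] ℝ =>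
      wedge a (δ (Sum.inl A.1)) (phaseDeg_add_one_add A)) (extD_coord σ (Sum.inr A) x).symm
  -- the contraction with `dθ`
  have h2 : contraction (sectionVariation σ.map x δ) (extD (cartanPoincare Φ H)) 0 y₀ w =
      (extD (cartanPoincare Φ H) (σ.map x) :
          (𝔼 × FormFibre 𝔼 (phaseDeg m q)) [⋀^Fin (m + 1 + 1)]→L[ℝ] ℝ)
        (Matrix.vecCons ((0 : 𝔼), δ) fun i => (mfderiv 𝓘(ℝ, 𝔼) (phaseModel m q) σ.map x :
          𝔼 →L[ℝ] 𝔼 × FormFibre 𝔼 (phaseDeg m q)) (w i)) := by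
    have e1 : sectionVariation σ.map x δ (0, y₀) = σ.map x :=
      (sectionVariation_zero σ.proj_map hyt).trans (congrArg σ.map (extChartAt_to_inv x))
    have e2 : ∀ z z' : Φ, z = z' → (extD (cartanPoincare Φ H) z :
        (𝔼 × FormFibre 𝔼 (phaseDeg m q)) [⋀^Fin (m + 1 + 1)]→L[ℝ] ℝ) =
          extD (cartanPoincare Φ H) z' := by
      rintro z _ rfl; rfl
    change (extD (cartanPoincare Φ H) (sectionVariation σ.map x δ (0, y₀)) :
        (𝔼 × FormFibre 𝔼 (phaseDeg m q)) [⋀^Fin (m + 1 + 1)]→L[ℝ] ℝ) _ = _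
    rw [e2 _ _ e1]
    congr 1
    funext i
    refine Fin.cases ?_ (fun i => ?_) i
    · exact velocity_sectionVariation
    · exact DFunLike.congr_fun
        (mfderiv_sectionVariation_zero σ.contMDiff_map σ.proj_map (δ := δ)) (w i)
  -- the other terms of the slices
  let dY : (A : {A : ι // q A ≤ m}) → 𝔼 [⋀^Fin (phaseDeg m q (Sum.inl A.1) + 1)]→L[ℝ] ℝ :=
    fun A => σ.coordD (Sum.inl A.1) x
  let p : (A : {A : ι // q A ≤ m}) → 𝔼 [⋀^Fin (phaseDeg m q (Sum.inr A))]→L[ℝ] ℝ :=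
    fun A => σ.coord (Sum.inr A) x
  have hc : Continuous fun s : ℝ => (s, y₀) := by fun_prop
  -- Near `s = 0` the Hamiltonian is the pullback of `θ` minus the terms `p_A ∧ dy^A`, which are
  -- affine in `s`.
  have h3 : (fun s : ℝ => (H ⟨x, σ.fibre x + s • δ⟩ :
      𝔼 [⋀^Fin (m + 1)]→L[ℝ] ℝ) w) =ᶠ[nhds 0] fun s =>
      pullback 𝓘(ℝ, 𝔼) (fun y => sectionVariation σ.map x δ (s, y)) (cartanPoincare Φ H) y₀ w -
        ∑ A : {A : ι // q A ≤ m}, (-1 : ℝ) ^ (m + 1 - q A.1) *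
          (wedge (p A) (dY A) (phaseDeg_momentum_add_one A) w +
            s * wedge (δ (Sum.inr A)) (dY A) (phaseDeg_momentum_add_one A) w) := by
    filter_upwards [hc.continuousAt.preimage_mem_nhds (hU.mem_nhds hy)] with s hs
    have e1 := pullback_cartanPoincare_apply (H := H)
      (fun y => sectionVariation σ.map x δ (s, y)) y₀ w
    refine eq_sub_of_add_eq' (Eq.trans ?_ e1.symm)
    refine congrArg₂ (· + ·) (Finset.sum_congr rfl fun A _ => ?_) ?_
    · refine congrArg (fun c : ℝ => (-1 : ℝ) ^ (m + 1 - q A.1) * c) ?_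
      have e2 : (pullback 𝓘(ℝ, 𝔼) (fun y => sectionVariation σ.map x δ (s, y))
          (tautForm Φ (Sum.inr A)) y₀ : 𝔼 [⋀^Fin (phaseDeg m q (Sum.inr A))]→L[ℝ] ℝ) =
          p A + s • δ (Sum.inr A) :=
        (pullback_slice_tautForm (Sum.inr A) hs).trans
          (congrArg (· + s • δ (Sum.inr A)) (sectionInChart_snd_self σ x (Sum.inr A)))
      have e3 : (pullback 𝓘(ℝ, 𝔼) (fun y => sectionVariation σ.map x δ (s, y))
          (extD (tautForm Φ (Sum.inl A.1))) y₀ :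
            𝔼 [⋀^Fin (phaseDeg m q (Sum.inl A.1) + 1)]→L[ℝ] ℝ) = dY A :=
        (pullback_slice_extD_tautForm (Sum.inl A.1) hs).trans (extD_coord σ (Sum.inl A.1) x).symm
      refine Eq.symm ((congrArg₂ (fun
        (a : 𝔼 [⋀^Fin (phaseDeg m q (Sum.inr A))]→L[ℝ] ℝ)
        (b : 𝔼 [⋀^Fin (phaseDeg m q (Sum.inl A.1) + 1)]→L[ℝ] ℝ) =>
          wedge a b (phaseDeg_momentum_add_one A) w) e2 e3).trans ?_)
      simp only [wedge_add_left, wedge_smul_left, ContinuousAlternatingMap.add_apply,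
        ContinuousAlternatingMap.smul_apply, smul_eq_mul]
    · have e4 := pullback_apply_inr (α := horizontalForm H Φ)
        (contMDiffAt_sectionVariation_slice hs) w
      refine Eq.trans ?_ e4
      refine Eq.trans ?_ (DFunLike.congr_fun
        (pullback_sectionVariation_horizontalForm σ.contMDiff_map σ.proj_map H hs) _).symm
      have e5 := sectionVariation_val (σ := σ.map) σ.proj_map hs (f := σ.val x) fun j => rfl
      have e6 : ∀ Z Z' : PhaseTotal (m := m) M q, Z = Z' →
          (H Z : 𝔼 [⋀^Fin (m + 1)]→L[ℝ] ℝ) = H Z' := by rintro Z _ rfl; rfl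
      rw [e6 _ _ e5]
      have e7 := mfderiv_extChartAt_symm_self (I := 𝓘(ℝ, 𝔼)) x
      exact (congrArg (fun L : 𝔼 →L[ℝ] 𝔼 =>
        (H ⟨x, σ.fibre x + s • δ⟩ : 𝔼 [⋀^Fin (m + 1)]→L[ℝ] ℝ)
          fun i => L (w i)) e7).symm
  refine HasDerivAt.congr_of_eventuallyEq ?_ h3
  have h4 : HasDerivAt (fun s : ℝ => ∑ A : {A : ι // q A ≤ m}, (-1 : ℝ) ^ (m + 1 - q A.1) *
          (wedge (p A) (dY A) (phaseDeg_momentum_add_one A) w +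
            s * wedge (δ (Sum.inr A)) (dY A) (phaseDeg_momentum_add_one A) w))
      (∑ A : {A : ι // q A ≤ m}, (-1 : ℝ) ^ (m + 1 - q A.1) *
        wedge (δ (Sum.inr A)) (dY A) (phaseDeg_momentum_add_one A) w) 0 := by
    refine HasDerivAt.fun_sum fun A _ => HasDerivAt.const_mul _ (HasDerivAt.const_add _ ?_)
    simpa using (hasDerivAt_id (0 : ℝ)).mul_const
      (wedge (δ (Sum.inr A)) (dY A) (phaseDeg_momentum_add_one A) w)
  refine (hd.sub h4).congr_deriv ?_
  have h5 : hamiltonPairing σ x δ w = (∑ A : {A : ι // q A ≤ m}, (-1 : ℝ) ^ (m + 1 - q A.1) *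
        wedge (δ (Sum.inr A)) (dY A) (phaseDeg_momentum_add_one A) w) +
      ∑ A : {A : ι // q A ≤ m}, wedge (σ.coordD (Sum.inr A) x)
        (δ (Sum.inl A.1)) (phaseDeg_add_one_add A) w := by
    rw [hamiltonPairing, ContinuousAlternatingMap.sum_apply, ← Finset.sum_add_distrib]
    rfl
  have h6 : extDeriv (contraction (sectionVariation σ.map x δ) (cartanPoincare Φ H) 0) y₀ w =
      -∑ A : {A : ι // q A ≤ m}, wedge (σ.coordD (Sum.inr A) x)
        (δ (Sum.inl A.1)) (phaseDeg_add_one_add A) w := by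
    rw [h1, ContinuousAlternatingMap.neg_apply, ContinuousAlternatingMap.sum_apply]
  rw [h5]
  refine (congrArg₂ (fun a b : ℝ => a + b - _) h2 h6).trans ?_
  ring

end Vertical

/-! ### The Hamilton equations as vanishing of `dθ` on vertical vectors -/

section SingleFibre

variable {E : Type*} [NormedAddCommGroup E] [NormedSpace ℝ E] {J : Type*} {r : J → ℕ}

open scoped Classical in
/-- The element of the typical fibre with a single component `δ`. -/
noncomputable def singleFibre (j : J) (δ : E [⋀^Fin (r j)]→L[ℝ] ℝ) : FormFibre E r :=
  Pi.single j δ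

open scoped Classical in
theorem singleFibre_same (j : J) (δ : E [⋀^Fin (r j)]→L[ℝ] ℝ) :
    (singleFibre j δ : FormFibre E r) j = δ := Pi.single_eq_same _ _

open scoped Classical in
theorem singleFibre_of_ne {j i : J} (h : i ≠ j) (δ : E [⋀^Fin (r j)]→L[ℝ] ℝ) :
    (singleFibre j δ : FormFibre E r) i = 0 := Pi.single_eq_of_ne h _

open scoped Classical in
theorem sum_singleFibre [Fintype J] (δ : FormFibre E r) : ∑ j, singleFibre j (δ j) = δ :=
  Finset.univ_sum_single δ

/-- A form as a linear function of its first argument. -/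
noncomputable def insertFirst {V : Type*} [NormedAddCommGroup V] [NormedSpace ℝ V] {n : ℕ}
    (a : V [⋀^Fin (n + 1)]→L[ℝ] ℝ) (T : Fin n → V) : V →ₗ[ℝ] ℝ where
  toFun u := a.curryLeft u T
  map_add' u v := by rw [map_add, ContinuousAlternatingMap.add_apply]
  map_smul' c u := by rw [map_smul, ContinuousAlternatingMap.smul_apply, RingHom.id_apply]

end SingleFibre

section Vertical

variable {m : ℕ} {M : Type*} [TopologicalSpace M]
  [ChartedSpace (EuclideanSpace ℝ (Fin (m + 1))) M] [IsManifold (𝓡 (m + 1)) ∞ M]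
  {ι : Type*} [Fintype ι] {q : ι → ℕ} {Φ : TopologicalSpace.Opens (PhaseTotal (m := m) M q)}
  {H : Hamiltonian (m := m) M q}

local notation "𝔼" => EuclideanSpace ℝ (Fin (m + 1))

theorem hamiltonPairing_single_inr (σ : PhaseSection Φ) (x : M) (A : {A : ι // q A ≤ m})
    (δ : 𝔼 [⋀^Fin (phaseDeg m q (Sum.inr A))]→L[ℝ] ℝ) :
    hamiltonPairing σ x (singleFibre (Sum.inr A) δ) =
      (-1 : ℝ) ^ (m + 1 - q A.1) •
        wedge δ (σ.coordD (Sum.inl A.1) x) (phaseDeg_momentum_add_one A) := by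
  rw [hamiltonPairing, Finset.sum_eq_single A]
  · rw [singleFibre_same, singleFibre_of_ne (by simp)]
    ext w
    simp [wedge_apply_sum]
  · intro B _ hB
    rw [singleFibre_of_ne (by simpa using hB), singleFibre_of_ne (by simp)]
    ext w
    simp [wedge_apply_sum]
  · simp

theorem hamiltonPairing_single_inl (σ : PhaseSection Φ) (x : M) (A : {A : ι // q A ≤ m})
    (δ : 𝔼 [⋀^Fin (phaseDeg m q (Sum.inl A.1))]→L[ℝ] ℝ) :
    hamiltonPairing σ x (singleFibre (Sum.inl A.1) δ) =
      wedge (σ.coordD (Sum.inr A) x) δ (phaseDeg_add_one_add A) := by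
  rw [hamiltonPairing, Finset.sum_eq_single A]
  · rw [singleFibre_same, singleFibre_of_ne (by simp)]
    ext w
    simp [wedge_apply_sum]
  · intro B _ hB
    rw [singleFibre_of_ne (by simp), singleFibre_of_ne (by
      simpa [Subtype.ext_iff] using hB)]
    ext w
    simp [wedge_apply_sum]
  · simp

theorem hamiltonPairing_single_top (σ : PhaseSection Φ) (x : M) {A : ι} (hA : q A = m + 1)
    (δ : 𝔼 [⋀^Fin (phaseDeg m q (Sum.inl A))]→L[ℝ] ℝ) :
    hamiltonPairing σ x (singleFibre (Sum.inl A) δ) = 0 := by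
  refine Finset.sum_eq_zero fun B _ => ?_
  have hB : B.1 ≠ A := by
    rintro rfl
    have := B.2
    omega
  rw [singleFibre_of_ne (by simp), singleFibre_of_ne (by simpa using hB)]
  ext w
  simp [wedge_apply_sum]

/-- The exterior derivative of the Cartan-Poincaré form on a vertical vector and vectors tangent
to a section. -/
noncomputable def verticalDerivative (H : Hamiltonian (m := m) M q) (σ : PhaseSection Φ) (x : M)
    (w : Fin (m + 1) → 𝔼) : FormFibre 𝔼 (phaseDeg m q) →ₗ[ℝ] ℝ :=
  (insertFirst (V := 𝔼 × FormFibre 𝔼 (phaseDeg m q)) (extD (cartanPoincare Φ H) (σ.map x))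
    fun i => (mfderiv 𝓘(ℝ, 𝔼) (phaseModel m q) σ.map x :
      𝔼 →L[ℝ] 𝔼 × FormFibre 𝔼 (phaseDeg m q)) (w i)).comp (LinearMap.inr ℝ 𝔼 _)

theorem hasDerivAt_hamiltonian' (hH : IsSmoothForm (horizontalForm H Φ)) (σ : PhaseSection Φ)
    (x : M) (δ : FormFibre 𝔼 (phaseDeg m q)) (w : Fin (m + 1) → 𝔼) :
    HasDerivAt (fun s : ℝ => (H ⟨x, σ.fibre x + s • δ⟩ : 𝔼 [⋀^Fin (m + 1)]→L[ℝ] ℝ) w)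
      (verticalDerivative H σ x w δ - hamiltonPairing σ x δ w) 0 :=
  hasDerivAt_hamiltonian hH σ x δ w

/-- The covariant Hamilton equations, with the derivatives in the typical fibre. -/
theorem hamiltonEquations_iff_hasDerivAt (σ : PhaseSection Φ) :
    HamiltonEquations H σ ↔
      (∀ (x : M) (A : {A : ι // q A ≤ m}) δ (w : Fin (m + 1) → 𝔼), HasDerivAt
        (fun s : ℝ => (H ⟨x, σ.fibre x + s • singleFibre (Sum.inr A) δ⟩ :
          𝔼 [⋀^Fin (m + 1)]→L[ℝ] ℝ) w)
        ((-1 : ℝ) ^ (m - q A.1) *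
          wedge δ (σ.coordD (Sum.inl A.1) x) (phaseDeg_momentum_add_one A) w) 0) ∧
      (∀ (x : M) (A : {A : ι // q A ≤ m}) δ (w : Fin (m + 1) → 𝔼), HasDerivAt
        (fun s : ℝ => (H ⟨x, σ.fibre x + s • singleFibre (Sum.inl A.1) δ⟩ :
          𝔼 [⋀^Fin (m + 1)]→L[ℝ] ℝ) w)
        (-wedge (σ.coordD (Sum.inr A) x) δ (phaseDeg_add_one_add A) w) 0) ∧
      (∀ (x : M) (A : ι) (_ : q A = m + 1) δ (w : Fin (m + 1) → 𝔼), HasDerivAt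
        (fun s : ℝ => (H ⟨x, σ.fibre x + s • singleFibre (Sum.inl A) δ⟩ :
          𝔼 [⋀^Fin (m + 1)]→L[ℝ] ℝ) w) 0 0) := by
  have e1 : ∀ (x : M) (A : {A : ι // q A ≤ m}) (δ : 𝔼 [⋀^Fin (phaseDeg m q (Sum.inr A))]→L[ℝ] ℝ)
      (w : Fin (m + 1) → 𝔼) h, wedge (V := 𝔼) (n := m + 1) δ ((-1 : ℝ) ^ (m - q A.1) •
        extD (σ.coord (Sum.inl A.1)) x) h w = (-1 : ℝ) ^ (m - q A.1) *
          wedge δ (σ.coordD (Sum.inl A.1) x) (phaseDeg_momentum_add_one A) w :=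
    fun x A δ w h => DFunLike.congr_fun (wedge_smul_right _ δ (σ.coordD (Sum.inl A.1) x) h) w
  have e2 : ∀ (x : M) (A : {A : ι // q A ≤ m})
      (δ : 𝔼 [⋀^Fin (phaseDeg m q (Sum.inl A.1))]→L[ℝ] ℝ) (w : Fin (m + 1) → 𝔼) h,
      (wedge (V := 𝔼) (-extD (σ.coord (Sum.inr A)) x) δ h : 𝔼 [⋀^Fin (m + 1)]→L[ℝ] ℝ) w =
        -wedge (σ.coordD (Sum.inr A) x) δ (phaseDeg_add_one_add A) w := by
    intro x A δ w h
    have h1 : -σ.coordD (Sum.inr A) x = (-1 : ℝ) • σ.coordD (Sum.inr A) x :=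
      (neg_one_smul ℝ _).symm
    have h2 := wedge_smul_left (-1) (σ.coordD (Sum.inr A) x) δ h
    rw [← h1] at h2
    exact (DFunLike.congr_fun h2 w).trans (neg_one_mul _)
  have e3 : ∀ (A : ι) (δ : 𝔼 [⋀^Fin (phaseDeg m q (Sum.inl A))]→L[ℝ] ℝ)
      (w : Fin (m + 1) → 𝔼) h, wedge (n := m + 1) (0 : 𝔼 [⋀^Fin 0]→L[ℝ] ℝ) δ h w = 0 :=
    fun A δ w h => DFunLike.congr_fun (wedge_zero_left δ h) w
  refine and_congr ?_ (and_congr ?_ ?_)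
  · exact ⟨fun h x A δ w => (h x A.1 A.2 δ w).congr_deriv (e1 x A δ w _),
      fun h x A hA δ w => (h x ⟨A, hA⟩ δ w).congr_deriv (e1 x ⟨A, hA⟩ δ w _).symm⟩
  · exact ⟨fun h x A δ w => (h x A.1 A.2 δ w).congr_deriv (e2 x A δ w _),
      fun h x A hA δ w => (h x ⟨A, hA⟩ δ w).congr_deriv (e2 x ⟨A, hA⟩ δ w _).symm⟩
  · exact ⟨fun h x A hA δ w => (h x A hA δ w).congr_deriv (e3 A δ w _),
      fun h x A hA δ w => (h x A hA δ w).congr_deriv (e3 A δ w _).symm⟩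

/-- The covariant Hamilton equations say that `dθ` vanishes on a vertical vector and vectors
tangent to the section. -/
theorem hamiltonEquations_iff (hq : ∀ A, q A ≤ m + 1) (hH : IsSmoothForm (horizontalForm H Φ))
    (σ : PhaseSection Φ) :
    HamiltonEquations H σ ↔ ∀ (x : M) (w : Fin (m + 1) → 𝔼) (δ : FormFibre 𝔼 (phaseDeg m q)),
      verticalDerivative H σ x w δ = 0 := by
  -- The form `θ` carries `(-1)^(n - q_A)` and the Hamilton equation `(-1)^(n - q_A - 1)`; the
  -- difference is the minus sign in front of the pairing.
  have hsgn : ∀ A : ι, q A ≤ m → (-1 : ℝ) ^ (m + 1 - q A) = -(-1 : ℝ) ^ (m - q A) := by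
    intro A hA
    rw [show m + 1 - q A = m - q A + 1 by omega, pow_succ]
    ring
  rw [hamiltonEquations_iff_hasDerivAt]
  constructor
  · rintro ⟨h1, h2, h3⟩ x w δ
    -- By linearity it suffices to vary a single component; each kind of component meets one of the
    -- three families of equations, and a top degree field has no pairing term.
    rw [← sum_singleFibre δ, map_sum]
    refine Finset.sum_eq_zero fun j _ => ?_
    have hd := hasDerivAt_hamiltonian' hH σ x (singleFibre j (δ j)) w
    rcases j with A | A
    · rcases (hq A).lt_or_eq with hA | hA
      · have hu := hd.unique (h2 x ⟨A, by omega⟩ (δ (Sum.inl A)) w)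
        rw [hamiltonPairing_single_inl σ x ⟨A, by omega⟩] at hu
        linarith
      · have hu := hd.unique (h3 x A hA (δ (Sum.inl A)) w)
        rw [hamiltonPairing_single_top σ x hA] at hu
        exact (sub_zero _).symm.trans hu
    · have hu := hd.unique (h1 x A (δ (Sum.inr A)) w)
      rw [hamiltonPairing_single_inr σ x A, ContinuousAlternatingMap.smul_apply, hsgn A.1 A.2,
        smul_eq_mul] at hu
      linarith
  · intro h
    refine ⟨fun x A δ w => ?_, fun x A δ w => ?_, fun x A hA δ w => ?_⟩
    · refine (hasDerivAt_hamiltonian' hH σ x (singleFibre (Sum.inr A) δ) w).congr_deriv ?_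
      rw [h, hamiltonPairing_single_inr σ x A, ContinuousAlternatingMap.smul_apply, hsgn A.1 A.2,
        smul_eq_mul]
      ring
    · refine (hasDerivAt_hamiltonian' hH σ x (singleFibre (Sum.inl A.1) δ) w).congr_deriv ?_
      rw [h, hamiltonPairing_single_inl σ x A, zero_sub]
    · refine (hasDerivAt_hamiltonian' hH σ x (singleFibre (Sum.inl A) δ) w).congr_deriv ?_
      rw [h, hamiltonPairing_single_top σ x hA]
      exact sub_zero _

end Vertical

theorem form_eq_zero_of_finrank_lt {V : Type*} [NormedAddCommGroup V] [NormedSpace ℝ V]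
    [FiniteDimensional ℝ V] {n : ℕ} (a : V [⋀^Fin n]→L[ℝ] ℝ) (h : Module.finrank ℝ V < n) :
    a = 0 := by
  ext v
  refine a.toAlternatingMap.map_linearDependent v fun hv => ?_
  have := hv.fintype_card_le_finrank
  simp at this
  omega

/-! ### Hamilton equations and closed Noether currents -/

section Phase

variable {m : ℕ} {M : Type*} [TopologicalSpace M]
  [ChartedSpace (EuclideanSpace ℝ (Fin (m + 1))) M] [IsManifold (𝓡 (m + 1)) ∞ M]
  {ι : Type*} [Fintype ι] {q : ι → ℕ} {Φ : TopologicalSpace.Opens (PhaseTotal (m := m) M q)}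
  {H : Hamiltonian (m := m) M q} {G : Subgroup (Equiv.Perm Φ)}

local notation "𝔼" => EuclideanSpace ℝ (Fin (m + 1))
local notation "𝔽" => EuclideanSpace ℝ (Fin (m + 1)) × FormFibre (EuclideanSpace ℝ (Fin (m + 1))) (phaseDeg m q)

theorem extD_noetherCurrent_apply (hH : IsSmoothForm (horizontalForm H Φ))
    (hG : IsSymmetryGroup Φ H G) (σ : PhaseSection Φ) {v : VField (phaseModel m q) Φ}
    (hv : v ∈ lieAlg Φ G) (x : M) (w : Fin (m + 1) → 𝔼) :
    (extD (pullback (𝓡 (m + 1)) σ.map (noetherCurrent Φ H v)) x : 𝔼 [⋀^Fin (m + 1)]→L[ℝ] ℝ) w =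
      -insertFirst (V := 𝔽) (extD (cartanPoincare Φ H) (σ.map x))
        (fun i => (mfderiv 𝓘(ℝ, 𝔼) (phaseModel m q) σ.map x : 𝔼 →L[ℝ] 𝔽) (w i))
        (v (σ.map x)) :=
  DFunLike.congr_fun (congrFun (noether_identity_lieAlg hH hG σ hv).2 x) w

/-- By Noether's identity the values of the Lie algebra lie in the kernel of the linear form `dθ(·,
Tσ w)`. A kernel is a subspace, so it contains their span and, by vertical transitivity, every
vertical vector. -/
theorem hamiltonEquations_of_closed (hq : ∀ A, q A ≤ m + 1)
    (hH : IsSmoothForm (horizontalForm H Φ)) (hG : IsSymmetryGroup Φ H G)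
    (hvt : IsVerticallyTransitive Φ G) (σ : PhaseSection Φ)
    (h : ∀ v ∈ lieAlg Φ G, ∀ x : M,
      extD (pullback (𝓡 (m + 1)) σ.map (noetherCurrent Φ H v)) x = 0) : HamiltonEquations H σ := by
  rw [hamiltonEquations_iff hq hH]
  intro x w δ
  have h1 := hvt (σ.map x) ((0 : 𝔼), δ) (mfderiv_proj_apply (σ.map x) ((0 : 𝔼), δ))
  let L : 𝔽 →ₗ[ℝ] ℝ := insertFirst (V := 𝔽) (extD (cartanPoincare Φ H) (σ.map x))
    (fun i => (mfderiv 𝓘(ℝ, 𝔼) (phaseModel m q) σ.map x : 𝔼 →L[ℝ] 𝔽) (w i))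
  change L ((0 : 𝔼), δ) = 0
  have h2 : Submodule.span ℝ {u : 𝔽 | ∃ v ∈ lieAlg Φ G, u = v (σ.map x)} ≤ LinearMap.ker L := by
    refine Submodule.span_le.2 ?_
    rintro u ⟨v, hv, rfl⟩
    have h3 := extD_noetherCurrent_apply hH hG σ hv x w
    have h4 : (extD (pullback (𝓡 (m + 1)) σ.map (noetherCurrent Φ H v)) x :
        𝔼 [⋀^Fin (m + 1)]→L[ℝ] ℝ) w = 0 := DFunLike.congr_fun (h v hv x) w
    exact neg_eq_zero.1 (h3.symm.trans h4)
  exact h2 h1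

theorem mfderiv_section_fst (σ : PhaseSection Φ) (x : M) (u : 𝔼) :
    ((mfderiv 𝓘(ℝ, 𝔼) (phaseModel m q) σ.map x : 𝔼 →L[ℝ] 𝔽) u).1 = u := by
  have h1 := mfderiv_comp x (contMDiff_proj_opens (Φ := Φ) |>.mdifferentiable (by simp) (σ.map x))
    (σ.contMDiff_map.mdifferentiable (by simp) x)
  have h2 : (mfderiv 𝓘(ℝ, 𝔼) 𝓘(ℝ, 𝔼) (proj Φ ∘ σ.map) x : 𝔼 →L[ℝ] 𝔼) =
      ContinuousLinearMap.id ℝ 𝔼 := mfderiv_id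
  have h3 := DFunLike.congr_fun (h2.symm.trans h1) u
  exact (mfderiv_proj_apply (σ.map x) _).symm.trans h3.symm

/-- Along `σ` the field `v` is the sum of a vector tangent to the section and a vertical one. The
Hamilton equations remove the vertical part; the tangent part evaluates the `(n+1)`-form `σ^* dθ` on
an `n`-dimensional space. -/
theorem extD_noetherCurrent_eq_zero (hq : ∀ A, q A ≤ m + 1)
    (hH : IsSmoothForm (horizontalForm H Φ)) (hG : IsSymmetryGroup Φ H G)
    (σ : PhaseSection Φ) (hσ : HamiltonEquations H σ) {v : VField (phaseModel m q) Φ}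
    (hv : v ∈ lieAlg Φ G) (x : M) :
    extD (pullback (𝓡 (m + 1)) σ.map (noetherCurrent Φ H v)) x = 0 := by
  rw [hamiltonEquations_iff hq hH] at hσ
  refine ContinuousAlternatingMap.ext fun w => ?_
  refine (extD_noetherCurrent_apply hH hG σ hv x w).trans (neg_eq_zero.2 ?_)
  let T : 𝔼 →L[ℝ] 𝔽 := mfderiv 𝓘(ℝ, 𝔼) (phaseModel m q) σ.map x
  let a : 𝔽 [⋀^Fin (m + 1 + 1)]→L[ℝ] ℝ := extD (cartanPoincare Φ H) (σ.map x)
  let u : 𝔽 := v (σ.map x)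
  change insertFirst a (fun i => T (w i)) u = 0
  have h1 : u = T u.1 + (0, u.2 - (T u.1).2) := by
    refine Prod.ext ?_ ?_
    · exact ((mfderiv_section_fst σ x u.1).symm.trans (add_zero _).symm)
    · exact (add_sub_cancel _ _).symm
  have h2 : insertFirst a (fun i => T (w i)) (T u.1) = 0 := by
    have h3 := form_eq_zero_of_finrank_lt (a.compContinuousLinearMap T) (by simp)
    have h4 := DFunLike.congr_fun h3 (Matrix.vecCons u.1 w)
    refine Eq.trans ?_ h4
    change a _ = a _
    congr 1
    funext i
    refine Fin.cases rfl (fun i => rfl) i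
  have h3 : insertFirst a (fun i => T (w i)) ((0 : 𝔼), u.2 - (T u.1).2) = 0 := hσ x w _
  rw [h1, map_add, h2, h3, add_zero]

end Phase

/-! ### Integration of densities against an orientation form -/

section TopForms

variable {m : ℕ}

local notation "𝔼" => EuclideanSpace ℝ (Fin m)

/-- The standard frame of `ℝ^m`. -/
noncomputable def stdFrame (m : ℕ) (j : Fin m) : EuclideanSpace ℝ (Fin m) :=
  EuclideanSpace.single j 1

theorem basisFun_eq_stdFrame : ⇑(EuclideanSpace.basisFun (Fin m) ℝ).toBasis = stdFrame m := by
  ext j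
  simp [stdFrame]

theorem topForm_eq_smul_det (a : 𝔼 [⋀^Fin m]→L[ℝ] ℝ) :
    a.toAlternatingMap = a (stdFrame m) • (EuclideanSpace.basisFun (Fin m) ℝ).toBasis.det := by
  have h := a.toAlternatingMap.eq_smul_basis_det (EuclideanSpace.basisFun (Fin m) ℝ).toBasis
  rw [basisFun_eq_stdFrame] at h
  exact h

theorem topForm_comp (a : 𝔼 [⋀^Fin m]→L[ℝ] ℝ) (L : 𝔼 →L[ℝ] 𝔼) :
    a.compContinuousLinearMap L (stdFrame m) = L.det * a (stdFrame m) := by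
  have h := DFunLike.congr_fun (topForm_eq_smul_det a) (L ∘ stdFrame m)
  refine h.trans ?_
  rw [AlternatingMap.smul_apply, smul_eq_mul, mul_comm]
  congr 1
  rw [← basisFun_eq_stdFrame]
  have h2 := (EuclideanSpace.basisFun (Fin m) ℝ).toBasis.det_comp (L : 𝔼 →ₗ[ℝ] 𝔼)
    (EuclideanSpace.basisFun (Fin m) ℝ).toBasis
  rw [Module.Basis.det_self, mul_one] at h2
  exact h2

theorem topForm_ext {a b : 𝔼 [⋀^Fin m]→L[ℝ] ℝ} (h : a (stdFrame m) = b (stdFrame m)) : a = b := by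
  refine ContinuousAlternatingMap.toAlternatingMap_injective ?_
  rw [topForm_eq_smul_det a, topForm_eq_smul_det b, h]

end TopForms

section Integration

variable {m : ℕ} {S : Type*} [TopologicalSpace S] [ChartedSpace (EuclideanSpace ℝ (Fin m)) S]
  [IsManifold (𝓡 m) ∞ S]

local notation "𝔼" => EuclideanSpace ℝ (Fin m)

/-- The quotient of a top degree form by the orientation form. -/
noncomputable def density (o : OrientationForm m S) (α : DiffForm (𝓡 m) S m) (x : S) : ℝ :=
  (α x : 𝔼 [⋀^Fin m]→L[ℝ] ℝ) (stdFrame m) / (o.form x : 𝔼 [⋀^Fin m]→L[ℝ] ℝ) (stdFrame m)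

/-- The density of the measure defined by the orientation form, in the chart around `i`. -/
noncomputable def chartWeight (o : OrientationForm m S) (i : S) (y : 𝔼) : ℝ :=
  |(inChart (I := 𝓘(ℝ, 𝔼)) o.form i y : 𝔼 [⋀^Fin m]→L[ℝ] ℝ) (stdFrame m)|

/-- The integral of a function over the chart around `i`. -/
noncomputable def chartIntegral (o : OrientationForm m S) (i : S) (h : S → ℝ) : ℝ :=
  ∫ y in (extChartAt 𝓘(ℝ, 𝔼) i).target, chartWeight o i y * h ((extChartAt 𝓘(ℝ, 𝔼) i).symm y)

omit [IsManifold (𝓡 m) ∞ S] in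
theorem orientationForm_apply_ne_zero (o : OrientationForm m S) (x : S) :
    (o.form x : 𝔼 [⋀^Fin m]→L[ℝ] ℝ) (stdFrame m) ≠ 0 := fun h => by
  have h1 : (o.form x : 𝔼 [⋀^Fin m]→L[ℝ] ℝ) = 0 := topForm_ext (h.trans rfl)
  exact o.ne_zero x h1

omit [IsManifold (𝓡 m) ∞ S] in
theorem inChart_stdFrame (α : DiffForm (𝓡 m) S m) (i : S) (y : 𝔼) :
    (inChart (I := 𝓘(ℝ, 𝔼)) α i y : 𝔼 [⋀^Fin m]→L[ℝ] ℝ) (stdFrame m) =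
      (mfderiv 𝓘(ℝ, 𝔼) 𝓘(ℝ, 𝔼) (extChartAt 𝓘(ℝ, 𝔼) i).symm y : 𝔼 →L[ℝ] 𝔼).det *
        (α ((extChartAt 𝓘(ℝ, 𝔼) i).symm y) : 𝔼 [⋀^Fin m]→L[ℝ] ℝ) (stdFrame m) :=
  topForm_comp _ _

theorem det_mfderiv_extChartAt_symm_ne_zero {i : S} {y : 𝔼}
    (hy : y ∈ (extChartAt 𝓘(ℝ, 𝔼) i).target) :
    (mfderiv 𝓘(ℝ, 𝔼) 𝓘(ℝ, 𝔼) (extChartAt 𝓘(ℝ, 𝔼) i).symm y : 𝔼 →L[ℝ] 𝔼).det ≠ 0 := by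
  have : IsManifold 𝓘(ℝ, 𝔼) 1 S := IsManifold.of_le (n := ∞) (by simp)
  let A : 𝔼 →L[ℝ] 𝔼 := mfderiv 𝓘(ℝ, 𝔼) 𝓘(ℝ, 𝔼) (extChartAt 𝓘(ℝ, 𝔼) i).symm y
  let B : 𝔼 →L[ℝ] 𝔼 := mfderiv 𝓘(ℝ, 𝔼) 𝓘(ℝ, 𝔼) (extChartAt 𝓘(ℝ, 𝔼) i)
    ((extChartAt 𝓘(ℝ, 𝔼) i).symm y)
  have h1 : B.comp A = ContinuousLinearMap.id ℝ 𝔼 := by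
    have h2 := mfderiv_extChartAt_comp_mfderivWithin_extChartAt_symm (I := 𝓘(ℝ, 𝔼)) hy
    rw [ModelWithCorners.range_eq_univ, mfderivWithin_univ] at h2
    exact h2
  have h2 : LinearMap.det ((B : 𝔼 →ₗ[ℝ] 𝔼) ∘ₗ (A : 𝔼 →ₗ[ℝ] 𝔼)) = 1 :=
    (congrArg (fun L : 𝔼 →L[ℝ] 𝔼 => LinearMap.det (L : 𝔼 →ₗ[ℝ] 𝔼)) h1).trans LinearMap.det_id
  rw [LinearMap.det_comp] at h2
  exact right_ne_zero_of_mul_eq_one h2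

theorem inChart_orientationForm_ne_zero (o : OrientationForm m S) {i : S} {y : 𝔼}
    (hy : y ∈ (extChartAt 𝓘(ℝ, 𝔼) i).target) :
    (inChart (I := 𝓘(ℝ, 𝔼)) o.form i y : 𝔼 [⋀^Fin m]→L[ℝ] ℝ) (stdFrame m) ≠ 0 := by
  rw [inChart_stdFrame]
  exact mul_ne_zero (det_mfderiv_extChartAt_symm_ne_zero hy) (orientationForm_apply_ne_zero o _)

/-- Numerator and denominator scale by the same nonzero determinant, so the density may be computed
in any chart. -/
theorem density_eq_inChart (o : OrientationForm m S) (α : DiffForm (𝓡 m) S m) {i : S} {y : 𝔼}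
    (hy : y ∈ (extChartAt 𝓘(ℝ, 𝔼) i).target) :
    density o α ((extChartAt 𝓘(ℝ, 𝔼) i).symm y) =
      (inChart (I := 𝓘(ℝ, 𝔼)) α i y : 𝔼 [⋀^Fin m]→L[ℝ] ℝ) (stdFrame m) /
        (inChart (I := 𝓘(ℝ, 𝔼)) o.form i y : 𝔼 [⋀^Fin m]→L[ℝ] ℝ) (stdFrame m) := by
  rw [inChart_stdFrame, inChart_stdFrame, mul_div_mul_left _ _
    (det_mfderiv_extChartAt_symm_ne_zero hy)]
  rfl

theorem chartWeight_pos (o : OrientationForm m S) {i : S} {y : 𝔼}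
    (hy : y ∈ (extChartAt 𝓘(ℝ, 𝔼) i).target) : 0 < chartWeight o i y :=
  abs_pos.2 (inChart_orientationForm_ne_zero o hy)

omit [IsManifold (𝓡 m) ∞ S] in
theorem contDiffOn_inChart_stdFrame {α : DiffForm (𝓡 m) S m} (hα : IsSmoothForm α) (i : S) :
    ContDiffOn ℝ ∞ (fun y => (inChart (I := 𝓘(ℝ, 𝔼)) α i y : 𝔼 [⋀^Fin m]→L[ℝ] ℝ) (stdFrame m))
      (extChartAt 𝓘(ℝ, 𝔼) i).target :=
  (ContinuousAlternatingMap.apply ℝ 𝔼 ℝ (stdFrame m)).contDiff.comp_contDiffOn (hα i)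

omit [IsManifold (𝓡 m) ∞ S] in
theorem continuousOn_chartWeight (o : OrientationForm m S) (i : S) :
    ContinuousOn (chartWeight o i) (extChartAt 𝓘(ℝ, 𝔼) i).target :=
  (contDiffOn_inChart_stdFrame o.smooth i).continuousOn.abs

theorem contDiffOn_density_symm (o : OrientationForm m S) {α : DiffForm (𝓡 m) S m}
    (hα : IsSmoothForm α) (i : S) :
    ContDiffOn ℝ ∞ (fun y => density o α ((extChartAt 𝓘(ℝ, 𝔼) i).symm y))
      (extChartAt 𝓘(ℝ, 𝔼) i).target :=
  ((contDiffOn_inChart_stdFrame hα i).div (contDiffOn_inChart_stdFrame o.smooth i)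
    fun _ hy => inChart_orientationForm_ne_zero o hy).congr fun _ hy => density_eq_inChart o α hy

theorem contMDiff_density (o : OrientationForm m S) {α : DiffForm (𝓡 m) S m}
    (hα : IsSmoothForm α) : ContMDiff (𝓡 m) 𝓘(ℝ, ℝ) ∞ (density o α) := by
  intro x
  have h1 := ((contDiffOn_density_symm o hα x).contDiffAt ((isOpen_extChartAt_target x).mem_nhds
    (mem_extChartAt_target (I := 𝓘(ℝ, 𝔼)) x))).contMDiffAt
  have h2 := h1.comp x (contMDiffAt_extChartAt (I := 𝓘(ℝ, 𝔼)) (n := ∞) (x := x))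
  refine h2.congr_of_eventuallyEq ?_
  filter_upwards [extChartAt_source_mem_nhds (I := 𝓘(ℝ, 𝔼)) x] with z hz
  exact (congrArg (density o α) ((extChartAt 𝓘(ℝ, 𝔼) x).left_inv hz)).symm

/-- Change of variables: the weights differ by the absolute value of the Jacobian of the transition
map, and outside the overlap of the charts the integrands vanish. -/
theorem chartIntegral_eq_of_support (o : OrientationForm m S) {i j : S} {h : S → ℝ}
    (hi : ∀ x, h x ≠ 0 → x ∈ (extChartAt 𝓘(ℝ, 𝔼) i).source)
    (hj : ∀ x, h x ≠ 0 → x ∈ (extChartAt 𝓘(ℝ, 𝔼) j).source) :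
    chartIntegral o i h = chartIntegral o j h := by
  set ci := extChartAt 𝓘(ℝ, 𝔼) i
  set cj := extChartAt 𝓘(ℝ, 𝔼) j
  have key : ∀ i j : S, ∀ y ∈ (extChartAt 𝓘(ℝ, 𝔼) i).target,
      (extChartAt 𝓘(ℝ, 𝔼) i).symm y ∈ (extChartAt 𝓘(ℝ, 𝔼) j).source →
      HasFDerivAt (extChartAt 𝓘(ℝ, 𝔼) j ∘ (extChartAt 𝓘(ℝ, 𝔼) i).symm)
        (fderiv ℝ (extChartAt 𝓘(ℝ, 𝔼) j ∘ (extChartAt 𝓘(ℝ, 𝔼) i).symm) y) y := by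
    intro i j y hy hy'
    exact ((contDiffAt_extChartAt_comp (contMDiffAt_extChartAt_symm hy) hy').differentiableAt
      (by simp)).hasFDerivAt
  have hw : ∀ y ∈ ci.target, ci.symm y ∈ cj.source → chartWeight o i y =
      |(fderiv ℝ (cj ∘ ci.symm) y).det| * chartWeight o j (cj (ci.symm y)) := by
    intro y hy hy'
    have h1 := pullback_eq_inChart (I := 𝓘(ℝ, 𝔼)) o.form
      ((contMDiffAt_extChartAt_symm (I := 𝓘(ℝ, 𝔼)) hy).mdifferentiableAt (by simp)) (p := j) hy'
    rw [chartWeight, chartWeight, ← abs_mul, ← topForm_comp]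
    exact congrArg (fun a : 𝔼 [⋀^Fin m]→L[ℝ] ℝ => |a (stdFrame m)|) h1
  let s := ci.target ∩ ci.symm ⁻¹' cj.source
  let t := cj.target ∩ cj.symm ⁻¹' ci.source
  have hs : IsOpen s := (continuousOn_extChartAt_symm i).isOpen_inter_preimage
    (isOpen_extChartAt_target i) (isOpen_extChartAt_source j)
  have hti : MeasurableSet ci.target := (isOpen_extChartAt_target (I := 𝓘(ℝ, 𝔼)) i).measurableSet
  have htj : MeasurableSet cj.target := (isOpen_extChartAt_target (I := 𝓘(ℝ, 𝔼)) j).measurableSet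
  have himg : (cj ∘ ci.symm) '' s = t := by
    ext z
    constructor
    · rintro ⟨y, hy, rfl⟩
      refine ⟨cj.map_source hy.2, ?_⟩
      simp only [Set.mem_preimage, Function.comp_apply, cj.left_inv hy.2]
      exact ci.map_target hy.1
    · rintro ⟨hz, hz'⟩
      refine ⟨ci (cj.symm z), ⟨ci.map_source hz', ?_⟩, ?_⟩
      · simp only [Set.mem_preimage, ci.left_inv hz']
        exact cj.map_target hz
      · simp only [Function.comp_apply, ci.left_inv hz', cj.right_inv hz]
  have hinj : Set.InjOn (cj ∘ ci.symm) s := by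
    intro y hy z hz hyz
    exact ci.symm.injOn hy.1 hz.1 (cj.injOn hy.2 hz.2 hyz)
  have e1 : chartIntegral o i h = ∫ y in s, chartWeight o i y * h (ci.symm y) :=
    (MeasureTheory.setIntegral_eq_of_subset_of_forall_sdiff_eq_zero
      (f := fun y => chartWeight o i y * h (ci.symm y)) (μ := MeasureTheory.volume) hti
      (show s ⊆ ci.target from Set.inter_subset_left)
      fun y hy => by
        have : h (ci.symm y) = 0 := by
          by_contra hne
          exact hy.2 ⟨hy.1, hj _ hne⟩
        exact mul_eq_zero_of_right _ this)
  have e2 : chartIntegral o j h = ∫ y in t, chartWeight o j y * h (cj.symm y) :=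
    (MeasureTheory.setIntegral_eq_of_subset_of_forall_sdiff_eq_zero
      (f := fun y => chartWeight o j y * h (cj.symm y)) (μ := MeasureTheory.volume) htj
      (show t ⊆ cj.target from Set.inter_subset_left)
      fun y hy => by
        have : h (cj.symm y) = 0 := by
          by_contra hne
          exact hy.2 ⟨hy.1, hi _ hne⟩
        exact mul_eq_zero_of_right _ this)
  rw [e1, e2, ← himg, MeasureTheory.integral_image_eq_integral_abs_det_fderiv_smul _
    hs.measurableSet (fun y hy => (key i j y hy.1 hy.2).hasFDerivWithinAt) hinj]
  refine MeasureTheory.setIntegral_congr_fun hs.measurableSet fun y hy => ?_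
  simp only [Function.comp_apply, smul_eq_mul]
  rw [hw y hy.1 hy.2, cj.left_inv hy.2, mul_assoc]

omit [IsManifold (𝓡 m) ∞ S] in
theorem integrableOn_chart (o : OrientationForm m S) [CompactSpace S] {i : S}
    {h : S → ℝ} (hc : Continuous h)
    (hs : tsupport h ⊆ (extChartAt 𝓘(ℝ, 𝔼) i).source) :
    MeasureTheory.IntegrableOn
      (fun y => chartWeight o i y * h ((extChartAt 𝓘(ℝ, 𝔼) i).symm y))
      (extChartAt 𝓘(ℝ, 𝔼) i).target := by
  have hK : IsCompact (extChartAt 𝓘(ℝ, 𝔼) i '' tsupport h) :=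
    (isClosed_tsupport h).isCompact.image_of_continuousOn
      ((continuousOn_extChartAt i).mono hs)
  have hKt : extChartAt 𝓘(ℝ, 𝔼) i '' tsupport h ⊆ (extChartAt 𝓘(ℝ, 𝔼) i).target := by
    rintro _ ⟨x, hx, rfl⟩
    exact PartialEquiv.map_source _ (hs hx)
  have hcont : ContinuousOn (fun y => chartWeight o i y * h ((extChartAt 𝓘(ℝ, 𝔼) i).symm y))
      (extChartAt 𝓘(ℝ, 𝔼) i).target :=
    (continuousOn_chartWeight o i).mul (hc.comp_continuousOn (continuousOn_extChartAt_symm i))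
  refine ((hcont.mono hKt).integrableOn_compact hK).of_forall_sdiff_eq_zero
    (isOpen_extChartAt_target (I := 𝓘(ℝ, 𝔼)) i).measurableSet fun y hy => ?_
  have : h ((extChartAt 𝓘(ℝ, 𝔼) i).symm y) = 0 := by
    by_contra hne
    exact hy.2 ⟨_, subset_tsupport _ hne, PartialEquiv.right_inv _ hy.1⟩
  rw [this, mul_zero]

end Integration

section Integration

variable {m : ℕ} {S : Type*} [TopologicalSpace S] [ChartedSpace (EuclideanSpace ℝ (Fin m)) S]
  [IsManifold (𝓡 m) ∞ S] [CompactSpace S] [T2Space S]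

local notation "𝔼" => EuclideanSpace ℝ (Fin m)

theorem tsupport_chartPartition (i : S) :
    tsupport (chartPartition m S i) ⊆ (extChartAt 𝓘(ℝ, 𝔼) i).source := by
  rw [extChartAt_source]
  exact (SmoothPartitionOfUnity.exists_isSubordinate_chartAt_source (𝓡 m) S).choose_spec i

variable (m S) in
theorem exists_finset_chartPartition : ∃ I : Finset S,
    (∀ i ∉ I, ∀ x, chartPartition m S i x = 0) ∧ ∀ x, ∑ i ∈ I, chartPartition m S i x = 1 := by
  have hf := (chartPartition m S).locallyFinite.finite_nonempty_of_compact
  have h1 : ∀ i ∉ hf.toFinset, ∀ x, chartPartition m S i x = 0 := by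
    intro i hi x
    by_contra hne
    exact hi (hf.mem_toFinset.2 ⟨x, hne⟩)
  refine ⟨hf.toFinset, h1, fun x => ?_⟩
  rw [← (chartPartition m S).sum_eq_one (Set.mem_univ x)]
  refine (finsum_eq_sum_of_support_subset _ fun i hi => ?_).symm
  by_contra hne
  exact hi (h1 i hne x)

/-- The integral of a function with respect to an orientation form. -/
noncomputable def integralFun (o : OrientationForm m S) (h : S → ℝ) : ℝ :=
  ∑ᶠ i : S, chartIntegral o i fun x => chartPartition m S i x * h x

/-- In a chart, `sign(o) α = |o| (α / o)`. So the oriented integral of a form is the integral of a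
function against a positive density, and orientations no longer matter. -/
theorem integral_eq_integralFun (o : OrientationForm m S) (α : DiffForm (𝓡 m) S m) :
    integral o α = integralFun o (density o α) := by
  refine finsum_congr fun i => ?_
  refine MeasureTheory.setIntegral_congr_fun
    (isOpen_extChartAt_target (I := 𝓘(ℝ, 𝔼)) i).measurableSet fun y hy => ?_
  have h1 := density_eq_inChart o α hy
  have h2 := inChart_orientationForm_ne_zero o hy
  beta_reduce
  rw [h1, chartWeight, ← self_mul_sign]
  change chartPartition m S i ((extChartAt 𝓘(ℝ, 𝔼) i).symm y) *
    (SignType.sign ((inChart (I := 𝓘(ℝ, 𝔼)) o.form i y : 𝔼 [⋀^Fin m]→L[ℝ] ℝ) (stdFrame m)) : ℝ) *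
    (inChart (I := 𝓘(ℝ, 𝔼)) α i y : 𝔼 [⋀^Fin m]→L[ℝ] ℝ) (stdFrame m) = _
  generalize (inChart (I := 𝓘(ℝ, 𝔼)) o.form i y : 𝔼 [⋀^Fin m]→L[ℝ] ℝ) (stdFrame m) = b at h2 ⊢
  generalize (inChart (I := 𝓘(ℝ, 𝔼)) α i y : 𝔼 [⋀^Fin m]→L[ℝ] ℝ) (stdFrame m) = a
  field_simp

theorem integralFun_eq_sum (o : OrientationForm m S) {I : Finset S}
    (hI : ∀ i ∉ I, ∀ x, chartPartition m S i x = 0) (h : S → ℝ) :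
    integralFun o h = ∑ i ∈ I, chartIntegral o i fun x => chartPartition m S i x * h x := by
  refine finsum_eq_sum_of_support_subset _ fun i hi => ?_
  by_contra hne
  refine hi ?_
  simp [chartIntegral, hI i hne]

theorem integrableOn_chartPartition_mul (o : OrientationForm m S) (i : S) {h : S → ℝ}
    (hc : Continuous h) : MeasureTheory.IntegrableOn (fun y => chartWeight o i y *
      (chartPartition m S i ((extChartAt 𝓘(ℝ, 𝔼) i).symm y) *
        h ((extChartAt 𝓘(ℝ, 𝔼) i).symm y))) (extChartAt 𝓘(ℝ, 𝔼) i).target :=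
  integrableOn_chart o (h := fun x => chartPartition m S i x * h x)
    ((chartPartition m S i).contMDiff.continuous.mul hc)
    ((tsupport_mul_subset_left).trans (tsupport_chartPartition i))

theorem integralFun_add (o : OrientationForm m S) {g h : S → ℝ} (hg : Continuous g)
    (hh : Continuous h) :
    integralFun o (fun x => g x + h x) = integralFun o g + integralFun o h := by
  obtain ⟨I, hI, -⟩ := exists_finset_chartPartition m S
  rw [integralFun_eq_sum o hI, integralFun_eq_sum o hI, integralFun_eq_sum o hI,
    ← Finset.sum_add_distrib]
  refine Finset.sum_congr rfl fun i _ => ?_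
  rw [chartIntegral, chartIntegral, chartIntegral,
    ← MeasureTheory.integral_add (integrableOn_chartPartition_mul o i hg)
      (integrableOn_chartPartition_mul o i hh)]
  exact congrArg _ (funext fun y => by ring)

theorem integralFun_zero (o : OrientationForm m S) : integralFun o (fun _ => 0) = 0 := by
  simp [integralFun, chartIntegral]

theorem integralFun_sum (o : OrientationForm m S) {A : Type*} (s : Finset A) {g : A → S → ℝ}
    (hg : ∀ a ∈ s, Continuous (g a)) :
    integralFun o (fun x => ∑ a ∈ s, g a x) = ∑ a ∈ s, integralFun o (g a) := by
  classical
  induction s using Finset.induction_on with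
  | empty => simpa using integralFun_zero o
  | insert a s ha ih =>
    simp only [Finset.sum_insert ha]
    rw [integralFun_add o (hg a (Finset.mem_insert_self a s)) (continuous_finsetSum _ fun b hb =>
      hg b (Finset.mem_insert_of_mem hb)), ih fun b hb => hg b (Finset.mem_insert_of_mem hb)]

/-- Each piece `ρ_i h` is supported in the charts around `i` and around `j`, so it can be moved to
`j`, where the pieces add up to `h`. -/
theorem integralFun_eq_chartIntegral (o : OrientationForm m S) {h : S → ℝ} (hc : Continuous h)
    {j : S} (hs : tsupport h ⊆ (extChartAt 𝓘(ℝ, 𝔼) j).source) :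
    integralFun o h = chartIntegral o j h := by
  obtain ⟨I, hI, hI1⟩ := exists_finset_chartPartition m S
  rw [integralFun_eq_sum o hI]
  have h1 : ∀ i ∈ I, chartIntegral o i (fun x => chartPartition m S i x * h x) =
      chartIntegral o j (fun x => chartPartition m S i x * h x) := by
    intro i _
    refine chartIntegral_eq_of_support o (fun x hx => ?_) fun x hx => ?_
    · exact tsupport_chartPartition i (subset_tsupport _ (left_ne_zero_of_mul hx))
    · exact hs (subset_tsupport _ (right_ne_zero_of_mul hx))
  rw [Finset.sum_congr rfl h1]
  simp only [chartIntegral]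
  rw [← MeasureTheory.integral_finsetSum]
  · refine congrArg _ (funext fun y => ?_)
    rw [← Finset.mul_sum, ← Finset.sum_mul, hI1, one_mul]
  · intro i _
    exact integrableOn_chart o (h := fun x => chartPartition m S i x * h x)
      ((chartPartition m S i).contMDiff.continuous.mul hc)
      ((tsupport_mul_subset_right).trans hs)

theorem hasDerivAt_integralFun (o : OrientationForm m S) {g g' : ℝ → S → ℝ}
    (hg : ∀ t, Continuous (g t)) (hd : ∀ t x, HasDerivAt (fun s => g s x) (g' t x) t)
    (hg' : Continuous fun p : ℝ × S => g' p.1 p.2) (t : ℝ) :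
    HasDerivAt (fun s => integralFun o (g s)) (integralFun o (g' t)) t := by
  obtain ⟨I, hI, -⟩ := exists_finset_chartPartition m S
  simp only [integralFun_eq_sum o hI]
  refine HasDerivAt.fun_sum fun i _ => ?_
  -- Compactness of `[t - 1, t + 1] × S` yields the uniform bound that allows differentiation under
  -- the integral on the ball of radius `1`.
  obtain ⟨C, hC⟩ := ((isCompact_Icc (a := t - 1) (b := t + 1)).prod
    (isCompact_univ (X := S))).exists_bound_of_continuousOn hg'.continuousOn
  have hcont : ∀ s, Continuous (g' s) := fun s => hg'.comp (by fun_prop : Continuous fun x => (s, x))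
  refine (hasDerivAt_integral_of_dominated_loc_of_deriv_le (s := Metric.ball t 1)
    (F := fun s y => chartWeight o i y *
      (chartPartition m S i ((extChartAt 𝓘(ℝ, 𝔼) i).symm y) *
        g s ((extChartAt 𝓘(ℝ, 𝔼) i).symm y)))
    (F' := fun s y => chartWeight o i y *
      (chartPartition m S i ((extChartAt 𝓘(ℝ, 𝔼) i).symm y) *
        g' s ((extChartAt 𝓘(ℝ, 𝔼) i).symm y)))
    (bound := fun y => chartWeight o i y *
      (chartPartition m S i ((extChartAt 𝓘(ℝ, 𝔼) i).symm y) * C))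
    (Metric.ball_mem_nhds t one_pos) (Filter.Eventually.of_forall fun s =>
      (integrableOn_chartPartition_mul o i (hg s)).aestronglyMeasurable)
    (integrableOn_chartPartition_mul o i (hg t))
    (integrableOn_chartPartition_mul o i (hcont t)).aestronglyMeasurable
    (Filter.Eventually.of_forall fun y s hs => ?_)
    (integrableOn_chartPartition_mul o i continuous_const)
    (Filter.Eventually.of_forall fun y s hs => ?_)).2
  · have hw : 0 ≤ chartWeight o i y := abs_nonneg _
    rw [norm_mul, norm_mul, Real.norm_of_nonneg hw,
      Real.norm_of_nonneg ((chartPartition m S).nonneg _ _)]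
    refine mul_le_mul_of_nonneg_left (mul_le_mul_of_nonneg_left ?_
      ((chartPartition m S).nonneg _ _)) (abs_nonneg _)
    refine hC (s, _) ⟨?_, trivial⟩
    rw [Metric.mem_ball, Real.dist_eq, abs_lt] at hs
    exact ⟨by linarith [hs.1], by linarith [hs.2]⟩
  · exact ((hd s _).const_mul _).const_mul _

/-- All summands are nonnegative, hence zero. In a chart whose `ρ_i` does not vanish at `x`, a
continuous nonnegative integrand with integral zero vanishes everywhere, and the weight there is
positive. -/
theorem eq_zero_of_integralFun_sq (o : OrientationForm m S) {h : S → ℝ} (hc : Continuous h)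
    (h0 : integralFun o (fun x => h x ^ 2) = 0) (x : S) : h x = 0 := by
  obtain ⟨I, hI, hI1⟩ := exists_finset_chartPartition m S
  rw [integralFun_eq_sum o hI] at h0
  have hnn : ∀ i y, 0 ≤ chartWeight o i y * (chartPartition m S i ((extChartAt 𝓘(ℝ, 𝔼) i).symm y) *
      h ((extChartAt 𝓘(ℝ, 𝔼) i).symm y) ^ 2) := fun i y =>
    mul_nonneg (abs_nonneg _) (mul_nonneg ((chartPartition m S).nonneg _ _) (sq_nonneg _))
  have h1 := (Finset.sum_eq_zero_iff_of_nonneg fun i _ =>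
    MeasureTheory.integral_nonneg (hnn i)).1 h0
  by_contra hx
  obtain ⟨i, hi, hix⟩ : ∃ i ∈ I, chartPartition m S i x ≠ 0 := by
    by_contra hne
    push Not at hne
    have := hI1 x
    rw [Finset.sum_eq_zero hne] at this
    exact zero_ne_one this
  have hxs : x ∈ (extChartAt 𝓘(ℝ, 𝔼) i).source :=
    tsupport_chartPartition i (subset_tsupport _ hix)
  have ho := isOpen_extChartAt_target (I := 𝓘(ℝ, 𝔼)) i
  have h2 := (MeasureTheory.setIntegral_eq_zero_iff_of_nonneg_ae
    (Filter.Eventually.of_forall (hnn i))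
    (integrableOn_chartPartition_mul o i (hc.pow 2))).1 (h1 i hi)
  have hcont : ContinuousOn (fun y => chartWeight o i y *
      (chartPartition m S i ((extChartAt 𝓘(ℝ, 𝔼) i).symm y) *
        h ((extChartAt 𝓘(ℝ, 𝔼) i).symm y) ^ 2)) (extChartAt 𝓘(ℝ, 𝔼) i).target :=
    (continuousOn_chartWeight o i).mul (((chartPartition m S i).contMDiff.continuous.mul
      (hc.pow 2)).comp_continuousOn (continuousOn_extChartAt_symm i))
  have h3 := MeasureTheory.Measure.eqOn_open_of_ae_eq h2 ho hcont continuousOn_const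
    ((extChartAt 𝓘(ℝ, 𝔼) i).map_source hxs)
  simp only [(extChartAt 𝓘(ℝ, 𝔼) i).left_inv hxs, Pi.zero_apply] at h3
  have h4 := chartWeight_pos o ((extChartAt 𝓘(ℝ, 𝔼) i).map_source hxs)
  exact (mul_ne_zero h4.ne' (mul_ne_zero hix (pow_ne_zero 2 hx))) h3

end Integration

/-! ### Stokes' theorem on a closed manifold -/

section Euclidean

variable {V : Type*} [NormedAddCommGroup V] [NormedSpace ℝ V] [FiniteDimensional ℝ V]
  [MeasurableSpace V] [BorelSpace V] {μ : MeasureTheory.Measure V} [μ.IsAddHaarMeasure]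

theorem integral_fderiv_apply_eq_zero {f : V → ℝ} (hf : ContDiff ℝ 1 f) (hs : HasCompactSupport f)
    (v : V) : ∫ y, fderiv ℝ f y v ∂μ = 0 := by
  have h1 : MeasureTheory.Integrable (fun y => fderiv ℝ f y v) μ := by
    refine Continuous.integrable_of_hasCompactSupport
      ((hf.continuous_fderiv one_ne_zero).clm_apply continuous_const) ?_
    exact (hs.fderiv ℝ).comp_left (g := fun L : V →L[ℝ] ℝ => L v) rfl
  -- Integration by parts against the constant function `1`.
  have h2 := integral_bilinear_hasLineDerivAt_right_eq_neg_left_of_integrable (μ := μ)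
    (f := fun _ => (1 : ℝ)) (f' := fun _ => 0) (g := f) (g' := fun y => fderiv ℝ f y v) (v := v)
    (B := ContinuousLinearMap.mul ℝ ℝ) (by simp) (by simpa using h1)
    (by simpa using hf.continuous.integrable_of_hasCompactSupport hs)
    (fun x _ => by simpa using (hasFDerivAt_const (1 : ℝ) x).hasLineDerivAt v)
    (fun x _ => ((hf.differentiable (by simp)) x).hasFDerivAt.hasLineDerivAt v)
  simpa using h2

theorem integral_extDeriv_apply_eq_zero {k : ℕ} {η : V → V [⋀^Fin k]→L[ℝ] ℝ}
    (hη : ContDiff ℝ 1 η) (hs : HasCompactSupport η) (v : Fin (k + 1) → V) :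
    ∫ y, extDeriv η y v ∂μ = 0 := by
  have hc : ∀ u : Fin k → V, ContDiff ℝ 1 fun y => η y u := fun u =>
    (ContinuousAlternatingMap.apply ℝ V ℝ u).contDiff.comp hη
  have hcs : ∀ u : Fin k → V, HasCompactSupport fun y => η y u := fun u =>
    hs.comp_left (g := fun a : V [⋀^Fin k]→L[ℝ] ℝ => a u) rfl
  simp_rw [extDeriv_apply ((hη.differentiable (by simp)) _) v]
  rw [MeasureTheory.integral_finsetSum]
  · refine Finset.sum_eq_zero fun i _ => ?_
    have h0 := integral_fderiv_apply_eq_zero (μ := μ) (hc (i.removeNth v)) (hcs _) (v i)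
    rcases neg_one_pow_eq_or ℤ (i : ℕ) with h | h
    · simpa only [h, one_smul] using h0
    · simp only [h, neg_smul, one_smul, MeasureTheory.integral_neg, h0, neg_zero]
  · intro i _
    have h0 : MeasureTheory.Integrable
        (fun y => fderiv ℝ (fun x => η x (i.removeNth v)) y (v i)) μ :=
      Continuous.integrable_of_hasCompactSupport
        (((hc _).continuous_fderiv one_ne_zero).clm_apply continuous_const)
        (((hcs _).fderiv ℝ).comp_left (g := fun L : V →L[ℝ] ℝ => L (v i)) rfl)
    rcases neg_one_pow_eq_or ℤ (i : ℕ) with h | h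
    · simpa only [h, one_smul] using h0
    · simp only [h, neg_smul, one_smul]
      exact h0.neg

end Euclidean

section Support

variable {E : Type*} [NormedAddCommGroup E] [NormedSpace ℝ E]
  {H : Type*} [TopologicalSpace H] {I : ModelWithCorners ℝ E H} [I.Boundaryless]
  {N : Type*} [TopologicalSpace N] [ChartedSpace H N] {k : ℕ}

theorem extD_eq_zero_of_notMem [IsManifold I ∞ N] {γ : DiffForm I N k} {K : Set N} (hK : IsClosed K)
    (hγ : ∀ x ∉ K, γ x = 0) {x : N} (hx : x ∉ K) : extD γ x = 0 := by
  rw [extD_apply_eq]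
  have h1 : inChart γ x =ᶠ[nhds (extChartAt I x x)] fun _ => 0 := by
    have h2 : (extChartAt I x).symm ⁻¹' Kᶜ ∈ nhds (extChartAt I x x) := by
      refine (continuousAt_extChartAt_symm x).preimage_mem_nhds (hK.isOpen_compl.mem_nhds ?_)
      rwa [extChartAt_to_inv]
    filter_upwards [h2] with y hy
    simp only [inChart]
    rw [hγ _ hy]
    rfl
  rw [h1.extDeriv_eq]
  ext v
  simp [extDeriv, ContinuousAlternatingMap.alternatizeUncurryFin_apply]
  rfl

theorem IsSmoothForm.fun_smul {γ : DiffForm I N k} (hγ : IsSmoothForm γ) [IsManifold I ∞ N]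
    {ρ : N → ℝ} (hρ : ContMDiff I 𝓘(ℝ, ℝ) ∞ ρ) :
    IsSmoothForm (fun x => ρ x • γ x : DiffForm I N k) := by
  intro p
  have h1 : ContDiffOn ℝ ∞ (fun y => ρ ((extChartAt I p).symm y)) (extChartAt I p).target :=
    (hρ.comp_contMDiffOn (contMDiffOn_extChartAt_symm p)).contDiffOn
  exact (h1.smul (hγ p)).congr fun y _ => rfl

end Support

section Stokes

variable {k : ℕ} {S : Type*} [TopologicalSpace S]
  [ChartedSpace (EuclideanSpace ℝ (Fin (k + 1))) S] [IsManifold (𝓡 (k + 1)) ∞ S] [CompactSpace S]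
  [T2Space S]

local notation "𝔼" => EuclideanSpace ℝ (Fin (k + 1))

/-- In the chart the integrand is `sign(o) dγ`. As the sign is locally constant it can be moved
under `d`, which gives the exterior derivative of a compactly supported form on a vector space. -/
theorem integralFun_density_extD_of_subset_chart (o : OrientationForm (k + 1) S)
    {γ : DiffForm (𝓡 (k + 1)) S k} (hγ : IsSmoothForm γ) {K : Set S} (hK : IsClosed K) {j : S}
    (hKj : K ⊆ (extChartAt 𝓘(ℝ, 𝔼) j).source) (hγK : ∀ x ∉ K, γ x = 0) :
    integralFun o (density o (extD γ)) = 0 := by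
  set c := extChartAt 𝓘(ℝ, 𝔼) j with hc
  have ho : IsOpen c.target := isOpen_extChartAt_target j
  have hsupp : tsupport (density o (extD γ)) ⊆ K := by
    refine closure_minimal (fun x hx => ?_) hK
    by_contra hne
    refine hx ?_
    rw [density, extD_eq_zero_of_notMem hK hγK hne]
    exact zero_div _
  rw [integralFun_eq_chartIntegral o (contMDiff_density o hγ.extD).continuous
    (hsupp.trans hKj), chartIntegral]
  let b : 𝔼 → ℝ := fun y =>
    (inChart (I := 𝓘(ℝ, 𝔼)) o.form j y : 𝔼 [⋀^Fin (k + 1)]→L[ℝ] ℝ) (stdFrame (k + 1))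
  have hb : ContinuousOn b c.target := (contDiffOn_inChart_stdFrame o.smooth j).continuousOn
  have hb0 : ∀ y ∈ c.target, b y ≠ 0 := fun y hy => inChart_orientationForm_ne_zero o hy
  let sg : 𝔼 → ℝ := fun y => (SignType.sign (b y) : ℝ)
  let g : 𝔼 → 𝔼 [⋀^Fin k]→L[ℝ] ℝ := inChart (I := 𝓘(ℝ, 𝔼)) γ j
  let η : 𝔼 → 𝔼 [⋀^Fin k]→L[ℝ] ℝ := c.target.indicator fun y => sg y • g y
  have hKc : IsCompact (c '' K) :=
    hK.isCompact.image_of_continuousOn ((continuousOn_extChartAt j).mono hKj)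
  have hη0 : ∀ y ∉ c '' K, η y = 0 := by
    intro y hy
    by_cases hyt : y ∈ c.target
    · have h1 : c.symm y ∉ K := fun h => hy ⟨_, h, c.right_inv hyt⟩
      have h2 : g y = 0 := by
        simp only [g, inChart]
        rw [hγK _ h1]
        rfl
      simp only [η, Set.indicator_of_mem hyt, h2, smul_zero]
    · exact Set.indicator_of_notMem hyt _
  -- The target of the chart need not be connected, so the sign is constant only near each point;
  -- `o` does not vanish, and this suffices for derivatives.
  have hηt : ∀ y ∈ c.target, η =ᶠ[nhds y] fun z => sg y • g z := by
    intro y hy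
    have h1 : ∀ᶠ z in nhds y, sg z = sg y := by
      have hby := (hb.continuousAt (ho.mem_nhds hy))
      rcases (hb0 y hy).lt_or_gt with h | h
      · filter_upwards [hby.eventually_lt continuousAt_const h] with z hz
        simp only [sg, sign_neg hz, sign_neg h]
      · filter_upwards [continuousAt_const.eventually_lt hby h] with z hz
        simp only [sg, sign_pos hz, sign_pos h]
    filter_upwards [h1, ho.mem_nhds hy] with z hz hzt
    simp only [η, Set.indicator_of_mem hzt, hz]
  have hη0' : ∀ y ∉ c '' K, η =ᶠ[nhds y] fun _ => 0 := fun y hy =>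
    Filter.eventually_of_mem (hKc.isClosed.isOpen_compl.mem_nhds hy) hη0
  have hKt : c '' K ⊆ c.target := by
    rintro _ ⟨x, hx, rfl⟩
    exact c.map_source (hKj hx)
  have hη : ContDiff ℝ 1 η := by
    rw [contDiff_iff_contDiffAt]
    intro y
    by_cases hy : y ∈ c '' K
    · have h1 : ContDiffAt ℝ 1 g y := (inChart_contDiffAt hγ (hKt hy)).of_le (by simp)
      have h2 : ContDiffAt ℝ 1 (fun z => sg y • g z) y := h1.const_smul (sg y)
      exact h2.congr_of_eventuallyEq (hηt y (hKt hy))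
    · exact contDiffAt_const.congr_of_eventuallyEq (hη0' y hy)
  have hηs : HasCompactSupport η := HasCompactSupport.intro hKc hη0
  have h0 : ∫ y in c.target, extDeriv η y (stdFrame (k + 1)) = 0 := by
    refine (MeasureTheory.setIntegral_eq_integral_of_forall_compl_eq_zero ?_).trans
      (integral_extDeriv_apply_eq_zero (μ := MeasureTheory.volume) hη hηs (stdFrame (k + 1)))
    intro y hy
    rw [(hη0' y fun h => hy (hKt h)).extDeriv_eq]
    simp [extDeriv, ContinuousAlternatingMap.alternatizeUncurryFin_apply]
  rw [← h0]
  refine MeasureTheory.setIntegral_congr_fun ho.measurableSet fun y hy => ?_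
  have h1 : extDeriv η y = sg y • extDeriv g y := by
    rw [(hηt y hy).extDeriv_eq]
    exact extDeriv_fun_smul (sg y) g
  have h2 := inChart_extD hγ (p := j) hy
  rw [h1, density_eq_inChart o _ hy, h2, ContinuousAlternatingMap.smul_apply, chartWeight,
    ← self_mul_sign, smul_eq_mul]
  have h3 := hb0 y hy
  change b y * sg y * (extDeriv g y (stdFrame (k + 1)) / b y) = _
  field_simp

/-- Stokes' theorem on a compact manifold without boundary. -/
theorem integralFun_density_extD (o : OrientationForm (k + 1) S)
    {γ : DiffForm (𝓡 (k + 1)) S k} (hγ : IsSmoothForm γ) :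
    integralFun o (density o (extD γ)) = 0 := by
  obtain ⟨I, -, hI⟩ := exists_finset_chartPartition (k + 1) S
  let γ' : S → DiffForm (𝓡 (k + 1)) S k := fun j x => chartPartition (k + 1) S j x • γ x
  have hγ' : ∀ j, IsSmoothForm (γ' j) := fun j =>
    hγ.fun_smul (chartPartition (k + 1) S j).contMDiff
  have h1 : γ = ∑ j ∈ I, γ' j := by
    funext x
    rw [Finset.sum_apply, ← Finset.sum_smul, hI, one_smul]
  have h2 : density o (extD γ) = fun x => ∑ j ∈ I, density o (extD (γ' j)) x := by
    funext x
    conv_lhs => rw [h1, extD_sum fun j _ => hγ' j]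
    simp only [density]
    rw [Finset.sum_apply, ← Finset.sum_div]
    congr 1
    exact ContinuousAlternatingMap.sum_apply (M := 𝔼) _ _
  rw [h2, integralFun_sum o I fun j _ => (contMDiff_density o (hγ' j).extD).continuous]
  refine Finset.sum_eq_zero fun j _ => ?_
  refine integralFun_density_extD_of_subset_chart o (hγ' j)
    (isClosed_tsupport (chartPartition (k + 1) S j)) (tsupport_chartPartition j) fun x hx => ?_
  change chartPartition (k + 1) S j x • γ x = 0
  rw [image_eq_zero_of_notMem_tsupport hx, zero_smul]

end Stokes

/-! ### First variation of the integral of a form -/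

section FamiliesOfMaps

variable {m : ℕ} {S : Type*} [TopologicalSpace S] [ChartedSpace (EuclideanSpace ℝ (Fin m)) S]
  [IsManifold (𝓡 m) ∞ S]
  {E : Type*} [NormedAddCommGroup E] [NormedSpace ℝ E]
  {H : Type*} [TopologicalSpace H] {I : ModelWithCorners ℝ E H}
  {M : Type*} [TopologicalSpace M] [ChartedSpace H M] {k : ℕ} {F : ℝ × S → M}

local notation "𝔼" => EuclideanSpace ℝ (Fin m)

/-- The contraction of a form with the velocity of a family of maps `F (t, ·)`, pulled back. -/
noncomputable def variationForm (F : ℝ × S → M) (α : DiffForm I M (k + 1)) (t : ℝ) :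
    DiffForm (𝓡 m) S k :=
  fun x => (ContinuousAlternatingMap.curryLeft (E := E) (α (F (t, x)))
    (mfderiv 𝓘(ℝ, ℝ) I (fun s => F (s, x)) t (1 : ℝ))).compContinuousLinearMap
      (mfderiv (𝓡 m) I (fun x => F (t, x)) x : 𝔼 →L[ℝ] E)

/-- A family of maps in the chart around `i`. -/
noncomputable def chartFamily (F : ℝ × S → M) (i : S) (w : ℝ × 𝔼) : M :=
  F (w.1, (extChartAt 𝓘(ℝ, 𝔼) i).symm w.2)

theorem contMDiffOn_chartFamily (hF : ContMDiff (𝓘(ℝ, ℝ).prod (𝓡 m)) I ∞ F) (i : S) :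
    ContMDiffOn 𝓘(ℝ, ℝ × 𝔼) I ∞ (chartFamily F i)
      (Set.univ ×ˢ (extChartAt 𝓘(ℝ, 𝔼) i).target) := by
  have h1 : ContMDiffOn 𝓘(ℝ, ℝ × 𝔼) 𝓘(ℝ, 𝔼) ∞
      (fun w : ℝ × 𝔼 => (extChartAt 𝓘(ℝ, 𝔼) i).symm w.2)
      (Set.univ ×ˢ (extChartAt 𝓘(ℝ, 𝔼) i).target) :=
    (contMDiffOn_extChartAt_symm i).comp contDiff_snd.contMDiff.contMDiffOn fun w hw => hw.2
  exact hF.comp_contMDiffOn (contDiff_fst.contMDiff.contMDiffOn.prodMk h1)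

omit [IsManifold (𝓡 m) ∞ S] in
theorem contMDiff_slice (hF : ContMDiff (𝓘(ℝ, ℝ).prod (𝓡 m)) I ∞ F) (t : ℝ) :
    ContMDiff (𝓡 m) I ∞ fun x => F (t, x) :=
  hF.comp (contMDiff_const.prodMk contMDiff_id)

theorem inChart_variationForm (hF : ContMDiff (𝓘(ℝ, ℝ).prod (𝓡 m)) I ∞ F)
    (α : DiffForm I M (k + 1)) (t : ℝ) {i : S} {y : 𝔼}
    (hy : y ∈ (extChartAt 𝓘(ℝ, 𝔼) i).target) :
    inChart (I := 𝓘(ℝ, 𝔼)) (variationForm F α t) i y = contraction (chartFamily F i) α t y := by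
  have h1 : MDifferentiableAt 𝓘(ℝ, 𝔼) 𝓘(ℝ, 𝔼) (extChartAt 𝓘(ℝ, 𝔼) i).symm y :=
    (contMDiffAt_extChartAt_symm (I := 𝓘(ℝ, 𝔼)) hy).mdifferentiableAt (by simp)
  have h2 : MDifferentiableAt (𝓡 m) I (fun x => F (t, x)) ((extChartAt 𝓘(ℝ, 𝔼) i).symm y) :=
    (contMDiff_slice hF t).mdifferentiable (by simp) _
  have h3 := mfderiv_comp y h2 h1
  ext w
  change (α (F (t, (extChartAt 𝓘(ℝ, 𝔼) i).symm y)) : E [⋀^Fin (k + 1)]→L[ℝ] ℝ) _ =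
    (α (F (t, (extChartAt 𝓘(ℝ, 𝔼) i).symm y)) : E [⋀^Fin (k + 1)]→L[ℝ] ℝ) _
  congr 1
  funext j
  refine Fin.cases rfl (fun j => ?_) j
  exact (DFunLike.congr_fun h3 (w j)).symm

variable [I.Boundaryless] [IsManifold I ∞ M]

theorem IsSmoothForm.variationForm {α : DiffForm I M (k + 1)} (hα : IsSmoothForm α)
    (hF : ContMDiff (𝓘(ℝ, ℝ).prod (𝓡 m)) I ∞ F) (t : ℝ) :
    IsSmoothForm (variationForm F α t : DiffForm (𝓡 m) S k) := fun i =>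
  ((contDiffOn_contraction hα (isOpen_univ.prod (isOpen_extChartAt_target i))
    (contMDiffOn_chartFamily hF i) t).mono fun _ hy => ⟨trivial, hy⟩).congr
      fun _ hy => inChart_variationForm hF α t hy

omit [I.Boundaryless] [IsManifold I ∞ M] in
theorem inChart_pullback_slice (hF : ContMDiff (𝓘(ℝ, ℝ).prod (𝓡 m)) I ∞ F)
    (α : DiffForm I M k) (t : ℝ) {i : S} {y : 𝔼} (hy : y ∈ (extChartAt 𝓘(ℝ, 𝔼) i).target) :
    inChart (I := 𝓘(ℝ, 𝔼)) (pullback (𝓡 m) (fun x => F (t, x)) α) i y =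
      pullback 𝓘(ℝ, 𝔼) (fun y => chartFamily F i (t, y)) α y :=
  inChart_pullback (contMDiff_slice hF t) hy

variable (o : OrientationForm m S)

theorem contDiffOn_density_pullback {α : DiffForm I M m} (hα : IsSmoothForm α)
    (hF : ContMDiff (𝓘(ℝ, ℝ).prod (𝓡 m)) I ∞ F) (i : S) :
    ContDiffOn ℝ ∞ (fun p : ℝ × 𝔼 => density o (pullback (𝓡 m) (fun x => F (p.1, x)) α)
      ((extChartAt 𝓘(ℝ, 𝔼) i).symm p.2)) (Set.univ ×ˢ (extChartAt 𝓘(ℝ, 𝔼) i).target) := by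
  have hU : IsOpen ((Set.univ : Set ℝ) ×ˢ (extChartAt 𝓘(ℝ, 𝔼) i).target) :=
    isOpen_univ.prod (isOpen_extChartAt_target i)
  have hG := contMDiffOn_chartFamily hF i
  have h1 : ContDiffOn ℝ ∞ (fun p : ℝ × 𝔼 => (pullback 𝓘(ℝ, ℝ × 𝔼) (chartFamily F i) α p :
      (ℝ × 𝔼) [⋀^Fin m]→L[ℝ] ℝ) fun j => ((0, stdFrame m j) : ℝ × 𝔼))
      (Set.univ ×ˢ (extChartAt 𝓘(ℝ, 𝔼) i).target) :=
    (ContinuousAlternatingMap.apply ℝ (ℝ × 𝔼) ℝ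
      fun j => ((0, stdFrame m j) : ℝ × 𝔼)).contDiff.comp_contDiffOn (contDiffOn_pullback hα hU hG)
  have h2 : ContDiffOn ℝ ∞ (fun p : ℝ × 𝔼 => (inChart (I := 𝓘(ℝ, 𝔼)) o.form i p.2 :
      𝔼 [⋀^Fin m]→L[ℝ] ℝ) (stdFrame m)) (Set.univ ×ˢ (extChartAt 𝓘(ℝ, 𝔼) i).target) :=
    (contDiffOn_inChart_stdFrame o.smooth i).comp contDiff_snd.contDiffOn fun p hp => hp.2
  refine (h1.div h2 fun p hp => inChart_orientationForm_ne_zero o hp.2).congr fun p hp => ?_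
  rw [density_eq_inChart o _ hp.2, inChart_pullback_slice hF α p.1 hp.2]
  congr 1
  exact (pullback_apply_inr ((hG.contMDiffAt (hU.mem_nhds hp)).mdifferentiableAt (by simp)) _).symm

omit [I.Boundaryless] [IsManifold I ∞ M] in
theorem hasDerivAt_density_pullback {α : DiffForm I M m}
    (hF : ContMDiff (𝓘(ℝ, ℝ).prod (𝓡 m)) I ∞ F) (β : DiffForm (𝓡 m) S m) (t : ℝ) (x : S)
    (h : HasDerivAt (fun s => pullback 𝓘(ℝ, 𝔼) (fun y => chartFamily F x (s, y)) α
      (extChartAt 𝓘(ℝ, 𝔼) x x) (stdFrame m))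
        ((inChart (I := 𝓘(ℝ, 𝔼)) β x (extChartAt 𝓘(ℝ, 𝔼) x x) : 𝔼 [⋀^Fin m]→L[ℝ] ℝ)
          (stdFrame m)) t) :
    HasDerivAt (fun s => density o (pullback (𝓡 m) (fun x => F (s, x)) α) x) (density o β x) t := by
  have hx := mem_extChartAt_target (I := 𝓘(ℝ, 𝔼)) x
  have h1 := fun β : DiffForm (𝓡 m) S m => density_eq_inChart o β hx
  simp only [extChartAt_to_inv] at h1
  simp only [h1]
  refine (h.div_const _).congr_of_eventuallyEq (Filter.Eventually.of_forall fun s => ?_)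
  beta_reduce
  rw [inChart_pullback_slice hF α s hx]
  rfl

omit [IsManifold (𝓡 m) ∞ S] in
-- The derivative `g'` is only known pointwise in `x`. In a chart it is the partial derivative `∂_t`
-- of a jointly smooth function, hence jointly continuous.
theorem continuous_of_hasDerivAt_chart {g g' : ℝ → S → ℝ}
    (hg : ∀ i, ContDiffOn ℝ ∞ (fun p : ℝ × 𝔼 => g p.1 ((extChartAt 𝓘(ℝ, 𝔼) i).symm p.2))
      (Set.univ ×ˢ (extChartAt 𝓘(ℝ, 𝔼) i).target))
    (hd : ∀ t x, HasDerivAt (fun s => g s x) (g' t x) t) :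
    Continuous fun p : ℝ × S => g' p.1 p.2 := by
  rw [continuous_iff_continuousAt]
  rintro ⟨t, x⟩
  set c := extChartAt 𝓘(ℝ, 𝔼) x
  let h : ℝ × 𝔼 → ℝ := fun p => g p.1 (c.symm p.2)
  have hU : IsOpen ((Set.univ : Set ℝ) ×ˢ c.target) :=
    isOpen_univ.prod (isOpen_extChartAt_target x)
  have h1 : ∀ s, ∀ y ∈ c.target, g' s (c.symm y) = fderiv ℝ h (s, y) (1, 0) := by
    intro s y hy
    have h2 : HasFDerivAt h (fderiv ℝ h (s, y)) (s, y) :=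
      (((hg x).contDiffAt (hU.mem_nhds ⟨trivial, hy⟩)).differentiableAt (by simp)).hasFDerivAt
    have h3 := HasFDerivAt.comp_hasDerivAt s (f := fun s : ℝ => (s, y)) h2
      ((hasDerivAt_id s).prodMk (hasDerivAt_const s y))
    exact (hd s (c.symm y)).unique h3
  have h4 : ContinuousAt (fun p : ℝ × 𝔼 => fderiv ℝ h p (1, 0)) (t, c x) :=
    (((hg x).continuousOn_fderiv_of_isOpen hU (by simp)).continuousAt
      (hU.mem_nhds ⟨trivial, mem_extChartAt_target x⟩)).clm_apply continuousAt_const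
  have h5 : ContinuousAt (fun p : ℝ × S => (p.1, c p.2)) (t, x) :=
    continuousAt_fst.prodMk 
      (ContinuousAt.comp (f := Prod.snd) (x := (t, x)) (continuousAt_extChartAt x) continuousAt_snd)
  refine (ContinuousAt.comp (f := fun p : ℝ × S => (p.1, c p.2)) h4 h5).congr ?_
  have h6 := (continuousAt_snd (p := (t, x))).preimage_mem_nhds
    (extChartAt_source_mem_nhds (I := 𝓘(ℝ, 𝔼)) x)
  filter_upwards [h6] with p hp
  refine (h1 p.1 (c p.2) (c.map_source hp)).symm.trans ?_
  rw [c.left_inv hp]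

variable [CompactSpace S] [T2Space S]

theorem hasDerivAt_integralFun_density_pullback {α : DiffForm I M m} (hα : IsSmoothForm α)
    (hF : ContMDiff (𝓘(ℝ, ℝ).prod (𝓡 m)) I ∞ F) {g' : ℝ → S → ℝ}
    (hd : ∀ t x, HasDerivAt (fun s => density o (pullback (𝓡 m) (fun x => F (s, x)) α) x)
      (g' t x) t) (t : ℝ) :
    HasDerivAt (fun s => integral o (pullback (𝓡 m) (fun x => F (s, x)) α))
      (integralFun o (g' t)) t := by
  simp only [integral_eq_integralFun]
  exact hasDerivAt_integralFun o
    (fun s => (contMDiff_density o (hα.pullback (contMDiff_slice hF s))).continuous) hd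
    (continuous_of_hasDerivAt_chart (contDiffOn_density_pullback o hα hF) hd) t

end FamiliesOfMaps

/-- The first variation of the integral of a form along a family of maps. -/
theorem hasDerivAt_integral_pullback {m : ℕ} {S : Type*} [TopologicalSpace S]
    [ChartedSpace (EuclideanSpace ℝ (Fin m)) S] [IsManifold (𝓡 m) ∞ S] [CompactSpace S] [T2Space S]
    (o : OrientationForm m S) {E : Type*} [NormedAddCommGroup E] [NormedSpace ℝ E]
    {H : Type*} [TopologicalSpace H] {I : ModelWithCorners ℝ E H} [I.Boundaryless]
    {M : Type*} [TopologicalSpace M] [ChartedSpace H M] [IsManifold I ∞ M] {F : ℝ × S → M}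
    {α : DiffForm I M m} (hα : IsSmoothForm α) (hF : ContMDiff (𝓘(ℝ, ℝ).prod (𝓡 m)) I ∞ F)
    (t : ℝ) : HasDerivAt (fun s => integral o (pullback (𝓡 m) (fun x => F (s, x)) α))
      (integral o (variationForm F (extD α) t)) t := by
  cases m with
  | zero =>
    -- In dimension `0` there is no exact term, so Stokes' theorem is not needed.
    rw [integral_eq_integralFun]
    refine hasDerivAt_integralFun_density_pullback o hα hF
      (g' := fun t => density o (variationForm F (extD α) t)) (fun t x => ?_) t
    refine hasDerivAt_density_pullback o hF _ t x ?_
    have hx := mem_extChartAt_target (I := 𝓘(ℝ, EuclideanSpace ℝ (Fin 0))) x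
    rw [inChart_variationForm hF _ t hx]
    exact hasDerivAt_pullback_slice_zero hα (isOpen_univ.prod (isOpen_extChartAt_target x))
      (contMDiffOn_chartFamily hF x) ⟨trivial, hx⟩ _
  | succ k =>
    -- By Stokes the exact term of Cartan's formula can be added for free; the integrand is then the
    -- pointwise derivative.
    have h1 : integral o (variationForm F (extD α) t) = integralFun o fun x =>
        density o (variationForm F (extD α) t) x + density o (extD (variationForm F α t)) x := by
      rw [integralFun_add o (contMDiff_density o (hα.extD.variationForm hF t)).continuous
        (contMDiff_density o (hα.variationForm hF t).extD).continuous,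
        integralFun_density_extD o (hα.variationForm hF t), add_zero, integral_eq_integralFun]
    rw [h1]
    refine hasDerivAt_integralFun_density_pullback o hα hF (g' := fun t x =>
      density o (variationForm F (extD α) t) x + density o (extD (variationForm F α t)) x)
        (fun t x => ?_) t
    have h2 : density o (variationForm F (extD α) t) x + density o (extD (variationForm F α t)) x =
        density o (variationForm F (extD α) t + extD (variationForm F α t)) x :=
      (add_div _ _ _).symm
    rw [h2]
    refine hasDerivAt_density_pullback o hF _ t x ?_
    have hx := mem_extChartAt_target (I := 𝓘(ℝ, EuclideanSpace ℝ (Fin (k + 1)))) x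
    have ho := isOpen_extChartAt_target (I := 𝓘(ℝ, EuclideanSpace ℝ (Fin (k + 1)))) x
    refine (hasDerivAt_pullback_slice hα (isOpen_univ.prod ho)
      (contMDiffOn_chartFamily hF x) ⟨trivial, hx⟩ _).congr_deriv ?_
    have h3 := inChart_extD (hα.variationForm hF t) hx
    have h4 : extDeriv (inChart (variationForm F α t) x) (extChartAt (𝓡 (k + 1)) x x) =
        extDeriv (contraction (chartFamily F x) α t) (extChartAt (𝓡 (k + 1)) x x) :=
      Filter.EventuallyEq.extDeriv_eq (Filter.eventually_of_mem (ho.mem_nhds hx)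
        fun y hy => inChart_variationForm hF α t hy)
    rw [← inChart_variationForm hF _ t hx, ← h4, ← h3]
    rfl

/-! ### Embeddings composed with diffeomorphisms -/

section Embeddings

universe u

variable {E : Type*} [NormedAddCommGroup E] [NormedSpace ℝ E]
  {E' : Type*} [NormedAddCommGroup E'] [NormedSpace ℝ E']
  {V : Type*} [NormedAddCommGroup V] [NormedSpace ℝ V]
  {F : Type*} [NormedAddCommGroup F] [NormedSpace ℝ F]
  {H : Type*} [TopologicalSpace H] {H' : Type*} [TopologicalSpace H']
  {I : ModelWithCorners ℝ E H} {J : ModelWithCorners ℝ E' H'} [J.Boundaryless]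
  {S : Type*} [TopologicalSpace S] [ChartedSpace H S]
  {N : Type*} [TopologicalSpace N] [ChartedSpace H' N]
  {M : Type*} [TopologicalSpace M] [ChartedSpace V M] [IsManifold 𝓘(ℝ, V) ∞ M]

/-- The chart of `M` obtained from a chart of a diffeomorphic manifold. -/
noncomputable def transportChart (D : Diffeomorph J 𝓘(ℝ, V) N M ∞) (L : E' ≃L[ℝ] V)
    (e : OpenPartialHomeomorph N H') : OpenPartialHomeomorph M V :=
  (D.toHomeomorph.symm.toOpenPartialHomeomorph.trans e).trans
    (J.toHomeomorph.trans L.toHomeomorph).toOpenPartialHomeomorph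

omit [IsManifold 𝓘(ℝ, V) ∞ M] in
theorem transportChart_source (D : Diffeomorph J 𝓘(ℝ, V) N M ∞) (L : E' ≃L[ℝ] V)
    (e : OpenPartialHomeomorph N H') :
    (transportChart D L e).source = D.symm ⁻¹' e.source := by
  ext x
  simp [transportChart]

omit [IsManifold 𝓘(ℝ, V) ∞ M] in
theorem transportChart_target (D : Diffeomorph J 𝓘(ℝ, V) N M ∞) (L : E' ≃L[ℝ] V)
    (e : OpenPartialHomeomorph N H') :
    (transportChart D L e).target = L.symm ⁻¹' (J '' e.target) := by
  ext x
  have h : ∀ y : E', y ∈ J '' e.target ↔ J.symm y ∈ e.target := fun y =>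
    ⟨by rintro ⟨z, hz, rfl⟩; rwa [J.left_inv], fun hy => ⟨_, hy, J.toHomeomorph.right_inv y⟩⟩
  rw [Set.mem_preimage, h]
  simp [transportChart]

theorem transportChart_mem_maximalAtlas (D : Diffeomorph J 𝓘(ℝ, V) N M ∞) (L : E' ≃L[ℝ] V)
    {e : OpenPartialHomeomorph N H'} (he : e ∈ IsManifold.maximalAtlas J ∞ N) :
    transportChart D L e ∈ IsManifold.maximalAtlas 𝓘(ℝ, V) ∞ M := by
  refine OpenPartialHomeomorph.mem_maximalAtlas_of_contMDiffOn _ ?_ ?_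
  · rw [transportChart_source]
    have h1 : ContMDiffOn J 𝓘(ℝ, V) ∞ (L ∘ e.extend J) e.source :=
      L.contDiff.contMDiff.comp_contMDiffOn (OpenPartialHomeomorph.contMDiffOn_extend he)
    exact h1.comp D.symm.contMDiff.contMDiffOn fun x hx => hx
  · rw [transportChart_target]
    exact D.contMDiff.comp_contMDiffOn ((contMDiffOn_extend_symm he).comp
      L.symm.contDiff.contMDiff.contMDiffOn fun x hx => hx)

/-- The local normal form is kept and the codomain chart is transported through `D`. The isomorphism
`L` is needed because the model spaces may differ, as for `ℝ^m × ℝ` and `ℝ^(m+1)`. -/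
theorem isImmersionAtOfComplement_diffeomorph_comp (D : Diffeomorph J 𝓘(ℝ, V) N M ∞)
    (L : E' ≃L[ℝ] V) {f : S → N} {x : S}
    (hf : Manifold.IsImmersionAtOfComplement F I J ∞ f x) :
    Manifold.IsImmersionAtOfComplement F I 𝓘(ℝ, V) ∞ (D ∘ f) x := by
  refine .mk_of_charts (hf.equiv.trans L) hf.domChart (transportChart D L hf.codChart)
    hf.mem_domChart_source ?_ hf.domChart_mem_maximalAtlas
    (transportChart_mem_maximalAtlas D L hf.codChart_mem_maximalAtlas) ?_ ?_
  · rw [transportChart_source]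
    simpa using hf.mem_codChart_source
  · intro y hy
    rw [Set.mem_preimage, transportChart_source]
    simpa using hf.source_subset_preimage_source hy
  · intro y hy
    have h1 := hf.writtenInCharts hy
    have h2 : ∀ z : N, (transportChart D L hf.codChart).extend 𝓘(ℝ, V) (D z) =
        L (hf.codChart.extend J z) := fun z => by
      have : D.symm (D z) = z := D.symm_apply_apply z
      simp only [transportChart]
      change L (J (hf.codChart (D.symm (D z)))) = _
      rw [this]
      rfl
    exact (h2 _).trans (congrArg L h1)

theorem isSmoothEmbedding_diffeomorph_comp (D : Diffeomorph J 𝓘(ℝ, V) N M ∞)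
    (L : E' ≃L[ℝ] V) {f : S → N} (hf : Manifold.IsSmoothEmbedding I J ∞ f) :
    Manifold.IsSmoothEmbedding I 𝓘(ℝ, V) ∞ (D ∘ f) := by
  obtain ⟨⟨F, _, _, hF⟩, he⟩ := hf
  have h1 : Manifold.IsImmersionOfComplement F I 𝓘(ℝ, V) ∞ (D ∘ f) := fun x =>
    isImmersionAtOfComplement_diffeomorph_comp D L (hF x)
  exact ⟨h1.isImmersion, D.toHomeomorph.isEmbedding.comp he⟩

variable [IsManifold I ∞ S]

variable (I S) in
theorem isSmoothEmbedding_slice :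
    Manifold.IsSmoothEmbedding I (I.prod 𝓘(ℝ, ℝ)) ∞ (fun x : S => (x, (0 : ℝ))) := by
  have h1 : Manifold.IsImmersionOfComplement ℝ I (I.prod 𝓘(ℝ, ℝ)) ∞
      (fun x : S => (x, (0 : ℝ))) := by
    intro x
    refine .mk_of_charts (ContinuousLinearEquiv.refl ℝ (E × ℝ)) (chartAt H x)
      (chartAt (ModelProd H ℝ) (x, (0 : ℝ))) (mem_chart_source H x)
      (mem_chart_source (ModelProd H ℝ) (x, (0 : ℝ))) (IsManifold.chart_mem_maximalAtlas x)
      (IsManifold.chart_mem_maximalAtlas (x, (0 : ℝ))) (fun y hy => ?_) fun y hy => ?_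
    · simpa [prodChartedSpace_chartAt] using hy
    · have h2 := ((chartAt H x).extend I).right_inv hy
      exact Prod.ext h2 rfl
  exact ⟨h1.isImmersion, Topology.IsEmbedding.of_comp (by fun_prop) continuous_fst
    Topology.IsEmbedding.id⟩

/-- The diffeomorphism `(x, s) ↦ (x, s + φ x)` of a cylinder. -/
noncomputable def shear {φ : S → ℝ} (hφ : ContMDiff I 𝓘(ℝ, ℝ) ∞ φ) :
    Diffeomorph (I.prod 𝓘(ℝ, ℝ)) (I.prod 𝓘(ℝ, ℝ)) (S × ℝ) (S × ℝ) ∞ where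
  toFun p := (p.1, p.2 + φ p.1)
  invFun p := (p.1, p.2 - φ p.1)
  left_inv p := by simp
  right_inv p := by simp
  contMDiff_toFun := contMDiff_fst.prodMk (contMDiff_snd.add (hφ.comp contMDiff_fst))
  contMDiff_invFun := contMDiff_fst.prodMk (contMDiff_snd.sub (hφ.comp contMDiff_fst))

end Embeddings

theorem topForm_eq_zero_of_span {V : Type*} [NormedAddCommGroup V] [NormedSpace ℝ V]
    [FiniteDimensional ℝ V] {n : ℕ} (hn : Module.finrank ℝ V = n) {b : Fin n → V}
    (hb : ⊤ ≤ Submodule.span ℝ (Set.range b)) {a : V [⋀^Fin n]→L[ℝ] ℝ} (h : a b = 0) : a = 0 := by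
  let B := basisOfTopLeSpanOfCardEqFinrank b hb (by simp [hn])
  refine ContinuousAlternatingMap.toAlternatingMap_injective ?_
  refine (AlternatingMap.map_basis_eq_zero_iff B a.toAlternatingMap).1 ?_
  rw [show ⇑B = b from coe_basisOfTopLeSpanOfCardEqFinrank b hb _]
  exact h

/-- The frame `∂_s, ∂_1, …, ∂_m` of `ℝ^m × ℝ`. -/
noncomputable def cylinderFrame (m : ℕ) : Fin (m + 1) → EuclideanSpace ℝ (Fin m) × ℝ :=
  Matrix.vecCons (0, 1) fun j => (stdFrame m j, 0)

theorem span_cylinderFrame (m : ℕ) : ⊤ ≤ Submodule.span ℝ (Set.range (cylinderFrame m)) := by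
  rintro ⟨y, s⟩ -
  have h1 : ((y, s) : EuclideanSpace ℝ (Fin m) × ℝ) =
      s • cylinderFrame m 0 + ∑ j, y j • cylinderFrame m (Fin.succ j) := by
    have h2 : ∑ j, y j • stdFrame m j = y := by
      have h3 := (EuclideanSpace.basisFun (Fin m) ℝ).toBasis.sum_repr y
      rw [basisFun_eq_stdFrame] at h3
      exact h3
    refine Prod.ext ?_ ?_
    · simp [cylinderFrame, Prod.fst_sum, h2]
    · simp [cylinderFrame, Prod.snd_sum]
  rw [h1]
  exact add_mem (Submodule.smul_mem _ _ (Submodule.subset_span ⟨0, rfl⟩))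
    (Submodule.sum_mem _ fun j _ => Submodule.smul_mem _ _ (Submodule.subset_span ⟨j.succ, rfl⟩))

/-! ### Hypersurfaces in a cylinder: closedness from integrals, and translations -/

section Cylinder

variable {m : ℕ} {S : Type*} [TopologicalSpace S] [ChartedSpace (EuclideanSpace ℝ (Fin m)) S]
  [IsManifold (𝓡 m) ∞ S]
  {M : Type*} [TopologicalSpace M] [ChartedSpace (EuclideanSpace ℝ (Fin (m + 1))) M]
  [IsManifold (𝓡 (m + 1)) ∞ M]
  (Ψ : Diffeomorph ((𝓡 m).prod 𝓘(ℝ, ℝ)) (𝓡 (m + 1)) (S × ℝ) M ∞)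

/-- The family `(t, x) ↦ Ψ (x, c + t φ(x))` of hypersurfaces. -/
noncomputable def graphFamily (c : ℝ) (φ : S → ℝ) (p : ℝ × S) : M := Ψ (p.2, c + p.1 * φ p.2)

local notation "𝔼" => EuclideanSpace ℝ (Fin m)
local notation "𝕍" => EuclideanSpace ℝ (Fin (m + 1))

omit [IsManifold (𝓡 m) ∞ S] [IsManifold (𝓡 (m + 1)) ∞ M] in
theorem contMDiff_graphFamily (c : ℝ) {φ : S → ℝ} (hφ : ContMDiff (𝓡 m) 𝓘(ℝ, ℝ) ∞ φ) :
    ContMDiff (𝓘(ℝ, ℝ).prod (𝓡 m)) (𝓡 (m + 1)) ∞ (graphFamily Ψ c φ) :=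
  Ψ.contMDiff.comp (contMDiff_snd.prodMk
    (contMDiff_const.add (contMDiff_fst.mul (hφ.comp contMDiff_snd))))

/-- A graph is the zero slice moved by a shear of the cylinder, so it is embedded for every `t`,
without any smallness argument. -/
theorem isSmoothEmbedding_graphFamily (c : ℝ) {φ : S → ℝ} (hφ : ContMDiff (𝓡 m) 𝓘(ℝ, ℝ) ∞ φ)
    (t : ℝ) : Manifold.IsSmoothEmbedding (𝓡 m) (𝓡 (m + 1)) ∞
      (fun x => graphFamily Ψ c φ (t, x)) := by
  have h1 : ContMDiff (𝓡 m) 𝓘(ℝ, ℝ) ∞ fun x => c + t * φ x :=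
    contMDiff_const.add (contMDiff_const.mul hφ)
  have h2 := isSmoothEmbedding_diffeomorph_comp ((shear h1).trans Ψ)
    (ContinuousLinearEquiv.ofFinrankEq (by simp) : (𝔼 × ℝ) ≃L[ℝ] 𝕍)
    (isSmoothEmbedding_slice (𝓡 m) S)
  convert h2 using 1
  funext x
  change Ψ (x, c + t * φ x) = Ψ (x, 0 + (c + t * φ x))
  rw [zero_add]

omit [IsManifold (𝓡 m) ∞ S] [IsManifold (𝓡 (m + 1)) ∞ M] in
-- At `t = 0` the hypersurface is the slice at height `c` and its velocity is `φ ∂_s`, so the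
-- variation is pointwise proportional to `φ`.
theorem variationForm_graphFamily (β : DiffForm (𝓡 (m + 1)) M (m + 1)) (c : ℝ) (φ : S → ℝ)
    (x : S) : (variationForm (graphFamily Ψ c φ) β 0 x : 𝔼 [⋀^Fin m]→L[ℝ] ℝ) (stdFrame m) =
      φ x * (β (Ψ (x, c)) : 𝕍 [⋀^Fin (m + 1)]→L[ℝ] ℝ) fun i =>
        (mfderiv ((𝓡 m).prod 𝓘(ℝ, ℝ)) (𝓡 (m + 1)) Ψ (x, c) : 𝔼 × ℝ →L[ℝ] 𝕍)
          (cylinderFrame m i) := by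
  have e0 : c + 0 * φ x = c := by ring
  have hβ : ∀ s, s = c → (β (Ψ (x, s)) : 𝕍 [⋀^Fin (m + 1)]→L[ℝ] ℝ) = β (Ψ (x, c)) := by
    rintro _ rfl; rfl
  have hΨ : HasMFDerivAt ((𝓡 m).prod 𝓘(ℝ, ℝ)) (𝓡 (m + 1)) Ψ (x, c)
      (mfderiv ((𝓡 m).prod 𝓘(ℝ, ℝ)) (𝓡 (m + 1)) Ψ (x, c)) :=
    (Ψ.contMDiff.mdifferentiable (by simp) (x, c)).hasMFDerivAt
  set T : 𝔼 × ℝ →L[ℝ] 𝕍 := mfderiv ((𝓡 m).prod 𝓘(ℝ, ℝ)) (𝓡 (m + 1)) Ψ (x, c) with hT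
  have hv : (mfderiv 𝓘(ℝ, ℝ) (𝓡 (m + 1)) (fun s => graphFamily Ψ c φ (s, x)) 0 : ℝ →L[ℝ] 𝕍) 1 =
      φ x • T (0, 1) := by
    have h1 : HasMFDerivAt 𝓘(ℝ, ℝ) 𝓘(ℝ, ℝ) (fun s : ℝ => c + s * φ x) 0
        (ContinuousLinearMap.toSpanSingleton ℝ (φ x)) := by
      have h2 : HasDerivAt (fun s : ℝ => c + s * φ x) (φ x) 0 := by
        simpa using ((hasDerivAt_id (0 : ℝ)).mul_const (φ x)).const_add c
      exact h2.hasFDerivAt.hasMFDerivAt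
    have h2 := (hasMFDerivAt_const (I := 𝓘(ℝ, ℝ)) (I' := 𝓡 m) x (0 : ℝ)).prodMk h1
    have h3 : HasMFDerivAt ((𝓡 m).prod 𝓘(ℝ, ℝ)) (𝓡 (m + 1)) Ψ (x, c + 0 * φ x) T := by
      rw [e0]; exact hΨ
    have h4 := (h3.comp (0 : ℝ) h2).mfderiv
    refine (DFunLike.congr_fun h4 (1 : ℝ)).trans ?_
    change T (0, (1 : ℝ) • φ x) = _
    rw [← map_smul]
    simp
  have hs : ∀ w : 𝔼, (mfderiv (𝓡 m) (𝓡 (m + 1)) (fun x => graphFamily Ψ c φ (0, x)) x :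
      𝔼 →L[ℝ] 𝕍) w = T (w, 0) := by
    intro w
    have e1 : (fun x => graphFamily Ψ c φ (0, x)) = Ψ ∘ fun x => (x, c) := by
      funext y; simp [graphFamily]
    have h2 := (hasMFDerivAt_id (I := 𝓡 m) x).prodMk
      (hasMFDerivAt_const (I := 𝓡 m) (I' := 𝓘(ℝ, ℝ)) c x)
    have h4 := (HasMFDerivAt.comp x (f := fun y => (y, c)) hΨ h2).mfderiv
    rw [e1]
    exact DFunLike.congr_fun h4 w
  change (β (Ψ (x, c + 0 * φ x)) : 𝕍 [⋀^Fin (m + 1)]→L[ℝ] ℝ) (Matrix.vecCons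
    ((mfderiv 𝓘(ℝ, ℝ) (𝓡 (m + 1)) (fun s => graphFamily Ψ c φ (s, x)) 0 : ℝ →L[ℝ] 𝕍) 1)
    fun j => (mfderiv (𝓡 m) (𝓡 (m + 1)) (fun x => graphFamily Ψ c φ (0, x)) x : 𝔼 →L[ℝ] 𝕍)
      (stdFrame m j)) = _
  rw [hβ _ e0, hv]
  simp only [hs]
  have h5 := DFunLike.congr_fun (map_smul (ContinuousAlternatingMap.curryLeft
    (β (Ψ (x, c)) : 𝕍 [⋀^Fin (m + 1)]→L[ℝ] ℝ)) (φ x) (T (0, 1))) fun j => T (stdFrame m j, 0)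
  refine h5.trans (congrArg (fun r => φ x * r) ?_)
  change (β (Ψ (x, c)) : 𝕍 [⋀^Fin (m + 1)]→L[ℝ] ℝ) _ = _
  congr 1
  funext i
  refine Fin.cases rfl (fun j => rfl) i

variable [CompactSpace S] [T2Space S] (o : OrientationForm m S)

/-- A form on a cylinder whose integral over all hypersurfaces vanishes is closed. -/
theorem extD_eq_zero_of_integral_eq_zero
    (Ψ : Diffeomorph ((𝓡 m).prod 𝓘(ℝ, ℝ)) (𝓡 (m + 1)) (S × ℝ) M ∞)
    {α : DiffForm (𝓡 (m + 1)) M m} (hα : IsSmoothForm α)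
    (h : ∀ f : S → M, Manifold.IsSmoothEmbedding (𝓡 m) (𝓡 (m + 1)) ∞ f →
      integral o (pullback (𝓡 m) f α) = 0) (p : M) : extD α p = 0 := by
  obtain ⟨⟨x, c⟩, rfl⟩ := Ψ.surjective p
  -- The family with `φ = 1` moves with velocity `∂_s`; a general `φ` multiplies this form by `φ`.
  let κ : DiffForm (𝓡 m) S m := variationForm (graphFamily Ψ c fun _ => 1) (extD α) 0
  have hκ : IsSmoothForm κ :=
    hα.extD.variationForm (contMDiff_graphFamily Ψ c contMDiff_const) 0
  have h1 : ∀ φ : S → ℝ, ContMDiff (𝓡 m) 𝓘(ℝ, ℝ) ∞ φ →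
      integralFun o (fun x => φ x * density o κ x) = 0 := by
    intro φ hφ
    have h2 := hasDerivAt_integral_pullback o hα (contMDiff_graphFamily Ψ c hφ) 0
    simp only [h _ (isSmoothEmbedding_graphFamily Ψ c hφ _)] at h2
    have h3 := (hasDerivAt_const (0 : ℝ) (0 : ℝ)).unique h2
    rw [h3, integral_eq_integralFun]
    congr 1
    funext x
    simp only [density, κ]
    rw [variationForm_graphFamily, variationForm_graphFamily, one_mul, mul_div_assoc]
  -- The test function is the density of `κ` itself.
  have h4 := eq_zero_of_integralFun_sq o (contMDiff_density o hκ).continuous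
    (by simpa only [sq] using h1 _ (contMDiff_density o hκ)) x
  have h5 : (κ x : 𝔼 [⋀^Fin m]→L[ℝ] ℝ) (stdFrame m) = 0 :=
    (div_eq_zero_iff.1 h4).resolve_right (orientationForm_apply_ne_zero o x)
  rw [variationForm_graphFamily, one_mul] at h5
  let T : 𝔼 × ℝ →L[ℝ] 𝕍 := mfderiv ((𝓡 m).prod 𝓘(ℝ, ℝ)) (𝓡 (m + 1)) Ψ (x, c)
  have hT : Function.Surjective T :=
    (Ψ.mfderivToContinuousLinearEquiv (by simp) (x, c)).surjective
  -- A form of top degree that vanishes on one frame is zero, and `T` is surjective.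
  have h6 : (extD α (Ψ (x, c)) : 𝕍 [⋀^Fin (m + 1)]→L[ℝ] ℝ).compContinuousLinearMap T = 0 :=
    topForm_eq_zero_of_span (by simp) (span_cylinderFrame m) h5
  ext w
  choose g hg using hT
  have h7 := DFunLike.congr_fun h6 fun i => g (w i)
  refine Eq.trans (congrArg (extD α (Ψ (x, c)) : 𝕍 [⋀^Fin (m + 1)]→L[ℝ] ℝ) ?_) h7
  funext i
  exact (hg (w i)).symm

/-- The translation by `t` along the cylinder. -/
noncomputable def translate (t : ℝ) : Diffeomorph (𝓡 (m + 1)) (𝓡 (m + 1)) M M ∞ :=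
  (Ψ.symm.trans (shear (contMDiff_const (c := t)))).trans Ψ

omit [IsManifold (𝓡 m) ∞ S] [IsManifold (𝓡 (m + 1)) ∞ M] [CompactSpace S] [T2Space S] in
theorem translate_apply (t : ℝ) (p : M) :
    translate Ψ t p = Ψ ((Ψ.symm p).1, (Ψ.symm p).2 + t) := rfl

/-- The integral of a closed form over a hypersurface is invariant under translation. -/
theorem integral_translate {α : DiffForm (𝓡 (m + 1)) M m} (hα : IsSmoothForm α)
    (h : ∀ p, extD α p = 0) {f : S → M} (hf : ContMDiff (𝓡 m) (𝓡 (m + 1)) ∞ f) (t : ℝ) :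
    integral o (pullback (𝓡 m) (translate Ψ t ∘ f) α) = integral o (pullback (𝓡 m) f α) := by
  let F : ℝ × S → M := fun p => translate Ψ p.1 (f p.2)
  have hF : ContMDiff (𝓘(ℝ, ℝ).prod (𝓡 m)) (𝓡 (m + 1)) ∞ F := by
    have h1 : ContMDiff (𝓘(ℝ, ℝ).prod (𝓡 m)) ((𝓡 m).prod 𝓘(ℝ, ℝ)) ∞
        fun p : ℝ × S => Ψ.symm (f p.2) := Ψ.symm.contMDiff.comp (hf.comp contMDiff_snd)
    exact Ψ.contMDiff.comp (h1.fst.prodMk (h1.snd.add contMDiff_fst))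
  have h1 : ∀ t, HasDerivAt (fun s => integral o (pullback (𝓡 m) (fun x => F (s, x)) α)) 0 t := by
    intro t
    refine (hasDerivAt_integral_pullback o hα hF t).congr_deriv ?_
    rw [integral_eq_integralFun, ← integralFun_zero o]
    congr 1
    funext x
    have h2 : (extD α (F (t, x)) : 𝕍 [⋀^Fin (m + 1)]→L[ℝ] ℝ) = 0 := h _
    refine (congrArg (fun r => r / _) ?_).trans (zero_div _)
    change (extD α (F (t, x)) : 𝕍 [⋀^Fin (m + 1)]→L[ℝ] ℝ) _ = 0
    rw [h2]
    rfl
  have h2 := is_const_of_deriv_eq_zero (fun t => (h1 t).differentiableAt)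
    (fun t => (h1 t).deriv) t 0
  have h3 : (fun x => F (0, x)) = f := by
    funext x
    simp [F, translate_apply]
  rw [h3] at h2
  exact h2

omit [IsManifold (𝓡 m) ∞ S] [IsManifold (𝓡 (m + 1)) ∞ M] [T2Space S] in
theorem exists_disjoint_translate {f : S → M} (hf : Continuous f) :
    ∃ t, Disjoint (Set.range f) (Set.range (translate Ψ t ∘ f)) := by
  have h1 : Continuous fun x => (Ψ.symm (f x)).2 :=
    continuous_snd.comp (Ψ.symm.continuous.comp hf)
  obtain ⟨C, hC⟩ := isCompact_univ.exists_bound_of_continuousOn h1.continuousOn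
  -- The heights on the hypersurface lie in `[-C, C]`, so a shift by more than `2C` separates it
  -- from its translate.
  refine ⟨2 * C + 1, Set.disjoint_left.2 ?_⟩
  rintro _ ⟨x, rfl⟩ ⟨y, hy⟩
  have h2 : (Ψ.symm (f y)).2 + (2 * C + 1) = (Ψ.symm (f x)).2 := by
    rw [← hy, Function.comp_apply, translate_apply, Ψ.symm_apply_apply]
  have h3 := abs_le.1 (hC x trivial)
  have h4 := abs_le.1 (hC y trivial)
  linarith [h3.2, h4.1]

end Cylinder

/-! ### Localization of charges and the main theorem -/

theorem pullback_pullback_interior_congr {E : Type*} [NormedAddCommGroup E] [NormedSpace ℝ E]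
    {H : Type*} [TopologicalSpace H] {I : ModelWithCorners ℝ E H}
    {N : Type*} [TopologicalSpace N] [ChartedSpace H N]
    {E' : Type*} [NormedAddCommGroup E'] [NormedSpace ℝ E']
    {H' : Type*} [TopologicalSpace H'] {I' : ModelWithCorners ℝ E' H'}
    {N' : Type*} [TopologicalSpace N'] [ChartedSpace H' N']
    {E'' : Type*} [NormedAddCommGroup E''] [NormedSpace ℝ E'']
    {H'' : Type*} [TopologicalSpace H''] {I'' : ModelWithCorners ℝ E'' H''}
    {N'' : Type*} [TopologicalSpace N''] [ChartedSpace H'' N''] {k : ℕ}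
    (f : N → N') (g : N' → N'') {v w : VField I'' N''} (α : DiffForm I'' N'' (k + 1))
    (h : ∀ x, v (g (f x)) = w (g (f x))) :
    pullback I f (pullback I' g (interior v α)) = pullback I f (pullback I' g (interior w α)) := by
  funext x
  simp only [pullback, interior, h]

theorem integral_pullback_zero {m : ℕ} {S : Type*} [TopologicalSpace S]
    [ChartedSpace (EuclideanSpace ℝ (Fin m)) S] [IsManifold (𝓡 m) ∞ S] [CompactSpace S] [T2Space S]
    (o : OrientationForm m S) {E : Type*} [NormedAddCommGroup E] [NormedSpace ℝ E]
    {H : Type*} [TopologicalSpace H] {I : ModelWithCorners ℝ E H}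
    {M : Type*} [TopologicalSpace M] [ChartedSpace H M] (f : S → M) :
    integral o (pullback (𝓡 m) f (0 : DiffForm I M m)) = 0 := by
  rw [integral_eq_integralFun, ← integralFun_zero o]
  congr 1
  funext x
  exact zero_div _

end CovariantNoether

open CovariantNoether in
theorem mainTheorem5 {m : ℕ}
    {S : Type*} [TopologicalSpace S] [ChartedSpace (EuclideanSpace ℝ (Fin m)) S]
    [IsManifold (𝓡 m) ∞ S] [CompactSpace S] [T2Space S] (o : OrientationForm m S)
    {M : Type*} [TopologicalSpace M] [ChartedSpace (EuclideanSpace ℝ (Fin (m + 1))) M]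
    [IsManifold (𝓡 (m + 1)) ∞ M]
    (hM : Nonempty (Diffeomorph (𝓡 (m + 1)) ((𝓡 m).prod 𝓘(ℝ, ℝ)) M (S × ℝ) ∞))
    {ι : Type*} [Fintype ι] (q : ι → ℕ) (hq : ∀ A, q A ≤ m + 1)
    (Φ : TopologicalSpace.Opens (PhaseTotal (m := m) M q))
    (H : Hamiltonian (m := m) M q) (hH : IsSmoothForm (horizontalForm H Φ))
    (G : Subgroup (Equiv.Perm Φ)) (hG : IsSymmetryGroup Φ H G)
    (hvt : IsVerticallyTransitive Φ G) (σ : PhaseSection Φ) :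
    ((∀ v ∈ lieAlg Φ G, ∀ x : M,
        extD (pullback (𝓡 (m + 1)) σ.map (noetherCurrent Φ H v)) x = 0) →
      HamiltonEquations H σ) ∧
    (IsLocalizable S Φ G →
      (HamiltonEquations H σ ↔
        ∀ v ∈ lieAlg Φ G, ∀ f : S → M, Manifold.IsSmoothEmbedding (𝓡 m) (𝓡 (m + 1)) ∞ f →
          integral o (pullback (𝓡 m) f
            (pullback (𝓡 (m + 1)) σ.map (noetherCurrent Φ H v))) = 0)) := by
  refine ⟨hamiltonEquations_of_closed hq hH hG hvt σ, fun hloc => ?_⟩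
  obtain ⟨Ψ⟩ := hM
  refine ⟨fun hσ v hv f hf => ?_, fun h => ?_⟩
  · have hcl : ∀ w ∈ lieAlg Φ G, ∀ p : M,
        extD (pullback (𝓡 (m + 1)) σ.map (noetherCurrent Φ H w)) p = 0 := fun w hw p =>
      extD_noetherCurrent_eq_zero hq hH hG σ hσ hw p
    -- A distant translate serves as the second, disjoint hypersurface in the definition of
    -- localizability.
    obtain ⟨t, ht⟩ := exists_disjoint_translate Ψ.symm hf.contMDiff.continuous
    have hf' : Manifold.IsSmoothEmbedding (𝓡 m) (𝓡 (m + 1)) ∞ (translate Ψ.symm t ∘ f) :=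
      isSmoothEmbedding_diffeomorph_comp (translate Ψ.symm t) (.refl ℝ _) hf
    obtain ⟨w, hw, hwv, hw0⟩ := hloc f _ hf hf' ht v hv
    have h1 : pullback (𝓡 m) f (pullback (𝓡 (m + 1)) σ.map (noetherCurrent Φ H v)) =
        pullback (𝓡 m) f (pullback (𝓡 (m + 1)) σ.map (noetherCurrent Φ H w)) :=
      pullback_pullback_interior_congr f σ.map _ fun x => (hwv _ ⟨x, rfl⟩).symm
    have h2 : pullback (𝓡 m) (translate Ψ.symm t ∘ f)
          (pullback (𝓡 (m + 1)) σ.map (noetherCurrent Φ H w)) =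
        pullback (𝓡 m) (translate Ψ.symm t ∘ f)
          (pullback (𝓡 (m + 1)) σ.map (noetherCurrent Φ H 0)) :=
      pullback_pullback_interior_congr _ σ.map _ fun x => hw0 _ ⟨x, rfl⟩
    have h3 : pullback (𝓡 (m + 1)) σ.map (noetherCurrent Φ H 0) = 0 :=
      pullback_interior_zero σ.map _
    -- The charge of `v` on `f` is that of `w` on `f`; by conservation it is that of `w` on the
    -- translate, where `w` vanishes.
    rw [h1, ← integral_translate Ψ.symm o (noether_identity_lieAlg hH hG σ hw).1 (hcl w hw)
      hf.contMDiff t, h2, h3]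
    exact integral_pullback_zero o _
  · exact hamiltonEquations_of_closed hq hH hG hvt σ fun v hv =>
      extD_eq_zero_of_integral_eq_zero o Ψ.symm (noether_identity_lieAlg hH hG σ hv).1 (h v hv)
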